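/- Let $(M,L)$ be a Finsler manifold of dimension $n\ge 3$: $L:TM\to\mathbb R$ is continuous, smooth and positive on the slit tangent bundle $\mathcal TM=TM\setminus 0$, positively homogeneous of degree one on the fibres, and such that $g_u(v,w)=\tfrac12\,\partial_s\partial_t L^2(u+sv+tw)|_{s=t=0}$ is positive definite for $u\in\mathcal TM$. Let $\pi^{-1}(TM)$ be the pullback of $TM$ to $\mathcal TM$ by the projection $\pi$, $\eta$ its tautological section $\eta(u)=(u,u)$, $\rho:T(\mathcal TM)\to\pi^{-1}(TM)$ the map induced by $d\pi$, and $\gamma$ the vertical lift. For a linear connection $D$ on $\pi^{-1}(TM)$ put $K(X)=D_X\eta$; $D$ is regular if $T_u(\mathcal TM)=\ker\rho_u\oplus\ker K_u$ for all $u$, and then $\beta=(\rho|_{\ker K})^{-1}$ is the horizontal lift. Let $\nabla$ be the Cartan connection of $(M,L)$: the regular connection on $\pi^{-1}(TM)$ that is metric ($\nabla g=0$) and whose torsion $\mathbf T(X,Y)=\nabla_X\rho Y-\nabla_Y\rho X-\rho[X,Y]$ satisfies $\mathbf T(\beta X,\beta Y)=0$ and $g(\mathbf T(\gamma X,\beta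 Y),Z)=g(\mathbf T(\gamma X,\beta Z),Y)$ for all sections $X,Y,Z$ of $\pi^{-1}(TM)$. All tensors below are tensor fields on $\pi^{-1}(TM)$; $\overset{h}{\nabla}$ is the $h$-covariant derivative, $(\overset{h}{\nabla}T)(W,\cdot)=(\nabla_{\beta W}T)(\cdot)$. Put $$R(X,Y)Z=\mathbf K(\beta X,\beta Y)Z,\quad \mathbf K(X,Y)Z=-\nabla_X\nabla_YZ+\nabla_Y\nabla_XZ+\nabla_{[X,Y]}Z,\quad \widehat R(X,Y)=R(X,Y)\eta,$$ $$\mathrm{Ric}(X,Y)=\mathrm{Tr}\{Z\mapsto R(X,Z)Y\},\quad r=\mathrm{Tr}_g\,\mathrm{Ric},\quad G(X,Y)Z=g(X,Z)Y-g(Y,Z)X,\quad C=R-\frac{r}{n(n-1)}\,G .$$ A recurrence $k$-form is a smooth scalar tensor field of type $(0,k)$ on $\pi^{-1}(TM)$ that is not identically zero and is positively homogeneous of degree zero in the fibre variable of $TM$. In the following, "$\ne 0$" means not identically zero on $\mathcal TM$. Assume that $(M,L)$ is concircularly recurrent with recurrence form $A$, that is, $C\neq0$, $A$ is a recurrence $1$-form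 and $\overset{h}{\nabla}C=A\otimes C$. Then: (a) If $\overset{h}{\nabla}A+A\otimes A\neq0$, then $(M,L)$ is 2-concircularly recurrent: $C\neq 0$ and there is a recurrence $2$-form $\alpha$ with $\overset{h}{\nabla}\overset{h}{\nabla}C=\alpha\otimes C$. (b) If $\overset{h}{\nabla}r-rA\neq0$, then $(M,L)$ is generalized recurrent: $R\ne0$ and there are recurrence $1$-forms $A',B$ with $\overset{h}{\nabla}R=A'\otimes R+B\otimes G$; and it is generalized Ricci recurrent: $\mathrm{Ric}\neq0$ and there are recurrence $1$-forms $A'',B'$ with $\overset{h}{\nabla}\mathrm{Ric}=A''\otimes\mathrm{Ric}+B'\otimes g$. (c) If $\widehat R=0$, then $(M,L)$ is recurrent: $R\neq0$ and there is a recurrence $1$-form $A'$ with $\overset{h}{\nabla}R=A'\otimes R$. -/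

import Mathlib

open Bundle Manifold
open scoped ContDiff

noncomputable section

namespace Finsler

variable {n : ℕ} {M : Type*} [TopologicalSpace M] [ChartedSpace (EuclideanSpace ℝ (Fin n)) M]
  [IsManifold (𝓡 n) ∞ M]

/-! ### The slit tangent bundle and the pullback bundle -/

variable (n M) in
/-- The bundle projection `π : TM → M`, as a bundled smooth map. -/
def proj : C^∞⟮(𝓡 n).tangent, TangentBundle (𝓡 n) M; 𝓡 n, M⟯ :=
  ⟨TotalSpace.proj, contMDiff_proj (TangentSpace (𝓡 n))⟩

variable (n M) in
/-- The pullback bundle `π⁻¹(TM)` over `TM`; its fibre over `u = (x, y)` is `T_x M`. -/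
abbrev PB : TangentBundle (𝓡 n) M → Type :=
  (proj n M) *ᵖ (TangentSpace (𝓡 n) : M → Type)

instance (u : TangentBundle (𝓡 n) M) : AddCommGroup (PB n M u) :=
  inferInstanceAs (AddCommGroup (TangentSpace (𝓡 n) u.proj))

instance (u : TangentBundle (𝓡 n) M) : IsTopologicalAddGroup (PB n M u) :=
  inferInstanceAs (IsTopologicalAddGroup (TangentSpace (𝓡 n) u.proj))

instance (u : TangentBundle (𝓡 n) M) : ContinuousSMul ℝ (PB n M u) :=
  inferInstanceAs (ContinuousSMul ℝ (TangentSpace (𝓡 n) u.proj))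

variable (n M) in
/-- The set `𝒯M` of nonzero tangent vectors. -/
def slit : Set (TangentBundle (𝓡 n) M) := {u | u.snd ≠ 0}

variable (n M) in
/-- `π`-vector fields: sections of `π⁻¹(TM)`. Only their values on `𝒯M` are used. -/
abbrev PiField : Type _ := Π u : TangentBundle (𝓡 n) M, PB n M u

variable (n M) in
/-- Vector fields on the manifold `TM`. Only their values on `𝒯M` are used. -/
abbrev VField : Type _ := Π u : TangentBundle (𝓡 n) M, TangentSpace (𝓡 n).tangent u

/-- Smoothness of a `π`-vector field on a set of points of `TM`. -/
def SmoothOn (X : PiField n M) (U : Set (TangentBundle (𝓡 n) M)) : Prop :=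
  ContMDiffOn (𝓡 n).tangent ((𝓡 n).tangent.prod 𝓘(ℝ, EuclideanSpace ℝ (Fin n))) ∞
    (fun u ↦ (TotalSpace.mk' (EuclideanSpace ℝ (Fin n)) u (X u) :
      TotalSpace (EuclideanSpace ℝ (Fin n)) (PB n M))) U

variable (n M) in
/-- The fundamental `π`-vector field `η(u) = (u, u)`. -/
def eta : PiField n M := fun u ↦ u.snd

/-- A (smooth near `u`) `π`-vector field with prescribed value at `u`: the one with constant
components in the preferred trivialization at `u`. -/
def ext {u : TangentBundle (𝓡 n) M} (v : PB n M u) : PiField n M :=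
  FiberBundle.extend (EuclideanSpace ℝ (Fin n)) v

/-- `ρ : T(TM) → π⁻¹(TM)`, the differential of `π`. -/
def rho (u : TangentBundle (𝓡 n) M) : TangentSpace (𝓡 n).tangent u →L[ℝ] PB n M u :=
  mfderiv (𝓡 n).tangent (𝓡 n) (TotalSpace.proj : TangentBundle (𝓡 n) M → M) u

/-- `γ : π⁻¹(TM) → T(TM)`, the vertical lift: the differential at `y` of the inclusion
`T_x M → TM` of the fibre through `u = (x, y)`. -/
def gam (u : TangentBundle (𝓡 n) M) : PB n M u →L[ℝ] TangentSpace (𝓡 n).tangent u :=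
  mfderiv 𝓘(ℝ, EuclideanSpace ℝ (Fin n)) (𝓡 n).tangent
    (fun w : EuclideanSpace ℝ (Fin n) ↦ (⟨u.proj, w⟩ : TangentBundle (𝓡 n) M)) u.snd

/-! ### Finsler structures -/

/-- The Finsler metric `g_u(v, w) = ½ ∂²L²(u + s v + t w)/∂s∂t` at `s = t = 0`. -/
def metric (L : TangentBundle (𝓡 n) M → ℝ) (u : TangentBundle (𝓡 n) M) (v w : PB n M u) : ℝ :=
  letI y : PB n M u := u.snd
  deriv (fun s : ℝ ↦ deriv (fun t : ℝ ↦
    (1 / 2 : ℝ) * L ⟨u.proj, y + s • v + t • w⟩ ^ 2) 0) 0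

/-- `L` is a Finsler structure on `M`. -/
structure IsFinsler (L : TangentBundle (𝓡 n) M → ℝ) : Prop where
  continuous : Continuous L
  smooth : ContMDiffOn (𝓡 n).tangent 𝓘(ℝ, ℝ) ∞ L (slit n M)
  pos : ∀ u ∈ slit n M, 0 < L u
  homogeneous : ∀ (x : M) (y : TangentSpace (𝓡 n) x) (t : ℝ), 0 < t →
    L ⟨x, t • y⟩ = t * L ⟨x, y⟩
  posDef : ∀ u ∈ slit n M, ∀ v : PB n M u, v ≠ 0 → 0 < metric L u v v

/-! ### Linear connections on the pullback bundle

As in Mathlib, `D σ u` is the linear map `X ↦ D_X σ` on the tangent space of `TM` at `u`. -/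

variable (n M) in
/-- The type of operators underlying linear connections on `π⁻¹(TM)`. -/
abbrev Conn : Type _ :=
  PiField n M → Π u : TangentBundle (𝓡 n) M, TangentSpace (𝓡 n).tangent u →L[ℝ] PB n M u

/-- The connection map `K(X) = D_X η`. -/
def connMap (D : Conn n M) (u : TangentBundle (𝓡 n) M) :
    TangentSpace (𝓡 n).tangent u →L[ℝ] PB n M u :=
  D (eta n M) u

/-- The vertical space at `u`. -/
def vertical (u : TangentBundle (𝓡 n) M) : Submodule ℝ (TangentSpace (𝓡 n).tangent u) :=
  LinearMap.ker (rho u).toLinearMap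

/-- The horizontal space at `u`. -/
def horizontal (D : Conn n M) (u : TangentBundle (𝓡 n) M) :
    Submodule ℝ (TangentSpace (𝓡 n).tangent u) :=
  LinearMap.ker (connMap D u).toLinearMap

/-- The horizontal map `β`: the inverse of the restriction of `ρ` to the horizontal space. -/
def beta (D : Conn n M) (u : TangentBundle (𝓡 n) M) (v : PB n M u) :
    TangentSpace (𝓡 n).tangent u :=
  Function.invFunOn (rho u) (horizontal D u : Set (TangentSpace (𝓡 n).tangent u)) v

/-- The horizontal lift of a `π`-vector field. -/
def hLift (D : Conn n M) (X : PiField n M) : VField n M := fun u ↦ beta D u (X u)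

/-- The vertical lift of a `π`-vector field. -/
def vLift (X : PiField n M) : VField n M := fun u ↦ gam u (X u)

/-- The classical torsion `𝐓(X, Y) = D_X ρY - D_Y ρX - ρ[X, Y]`. -/
def torsion (D : Conn n M) (X Y : VField n M) : PiField n M := fun u ↦
  D (fun u' ↦ rho u' (Y u')) u (X u) - D (fun u' ↦ rho u' (X u')) u (Y u)
    - rho u (VectorField.mlieBracket (𝓡 n).tangent X Y u)

/-- The classical curvature `𝐊(X, Y)Z = -D_X D_Y Z + D_Y D_X Z + D_[X, Y] Z`. With this sign a
space of constant curvature `c` has `R(X, Y)Z = c (g(X, Z)Y - g(Y, Z)X)`. -/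
def curvature (D : Conn n M) (X Y : VField n M) (Z : PiField n M) : PiField n M := fun u ↦
  - D (fun u' ↦ D Z u' (Y u')) u (X u) + D (fun u' ↦ D Z u' (X u')) u (Y u)
    + D Z u (VectorField.mlieBracket (𝓡 n).tangent X Y u)

/-- `D` is the Cartan connection of the Finsler manifold `(M, L)`: the regular linear connection
on `π⁻¹(TM)` (over `𝒯M`) that is metric, has vanishing (h)h-torsion
`Q(X, Y) = 𝐓(βX, βY)`, and whose (h)hv-torsion `T(X, Y) = 𝐓(γX, βY)` satisfies
`g(T(X, Y), Z) = g(T(X, Z), Y)`. -/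
structure IsCartan (L : TangentBundle (𝓡 n) M → ℝ) (D : Conn n M) : Prop where
  isCovariantDerivative :
    IsCovariantDerivativeOn (I := (𝓡 n).tangent) (EuclideanSpace ℝ (Fin n)) D (slit n M)
  smooth : ∀ U : Set (TangentBundle (𝓡 n) M), IsOpen U → U ⊆ slit n M →
    ContMDiffCovariantDerivativeOn (I := (𝓡 n).tangent) (EuclideanSpace ℝ (Fin n)) ∞ D U
  regular : ∀ u ∈ slit n M, IsCompl (vertical u) (horizontal D u)
  metric : ∀ U : Set (TangentBundle (𝓡 n) M), IsOpen U → U ⊆ slit n M →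
    ∀ Y Z : PiField n M, SmoothOn Y U → SmoothOn Z U →
    ∀ u ∈ U, ∀ X : TangentSpace (𝓡 n).tangent u,
      mvfderiv (𝓡 n).tangent (fun u' ↦ Finsler.metric L u' (Y u') (Z u')) u X =
        Finsler.metric L u (D Y u X) (Z u) + Finsler.metric L u (Y u) (D Z u X)
  hh_torsion : ∀ U : Set (TangentBundle (𝓡 n) M), IsOpen U → U ⊆ slit n M →
    ∀ X Y : PiField n M, SmoothOn X U → SmoothOn Y U →
    ∀ u ∈ U, torsion D (hLift D X) (hLift D Y) u = 0
  hhv_torsion : ∀ U : Set (TangentBundle (𝓡 n) M), IsOpen U → U ⊆ slit n M →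
    ∀ X Y Z : PiField n M, SmoothOn X U → SmoothOn Y U → SmoothOn Z U →
    ∀ u ∈ U, Finsler.metric L u (torsion D (vLift X) (hLift D Y) u) (Z u) =
      Finsler.metric L u (torsion D (vLift X) (hLift D Z) u) (Y u)

/-! ### `π`-tensor fields and the `h`-covariant derivative -/

variable (n M) in
/-- Underlying functions of vector-valued `π`-tensor fields, of type `(1, k)`. -/
abbrev VTensor (k : ℕ) : Type _ := Π u : TangentBundle (𝓡 n) M, (Fin k → PB n M u) → PB n M u

variable (n M) in
/-- Underlying functions of scalar `π`-tensor fields, of type `(0, k)`. -/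
abbrev STensor (k : ℕ) : Type _ := Π u : TangentBundle (𝓡 n) M, (Fin k → PB n M u) → ℝ

/-- The `h`-covariant derivative of a type `(1, k)` tensor field; the first argument is the
direction of differentiation:
`(∇ʰT)(W, X₁, …) = D_βW (T(X₁, …)) - ∑ T(…, D_βW Xᵢ, …)`. -/
def nablaV (D : Conn n M) {k : ℕ} (T : VTensor n M k) : VTensor n M (k + 1) := fun u x ↦
  D (fun u' ↦ T u' (fun i ↦ ext (x i.succ) u')) u (beta D u (x 0))
    - ∑ i : Fin k, T u (Function.update (Fin.tail x) i (D (ext (x i.succ)) u (beta D u (x 0))))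

/-- The `h`-covariant derivative of a type `(0, k)` tensor field:
`(∇ʰT)(W, X₁, …) = βW · T(X₁, …) - ∑ T(…, D_βW Xᵢ, …)`. -/
def nablaS (D : Conn n M) {k : ℕ} (T : STensor n M k) : STensor n M (k + 1) := fun u x ↦
  mvfderiv (𝓡 n).tangent (fun u' ↦ T u' (fun i ↦ ext (x i.succ) u')) u (beta D u (x 0))
    - ∑ i : Fin k, T u (Function.update (Fin.tail x) i (D (ext (x i.succ)) u (beta D u (x 0))))

/-- The `h`-curvature tensor `R(X, Y)Z = 𝐊(βX, βY)Z`. -/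
def hCurv (D : Conn n M) : VTensor n M 3 := fun u x ↦
  curvature D (hLift D (ext (x 0))) (hLift D (ext (x 1))) (ext (x 2)) u

/-- The `i`-th vector of a basis of the fibre over `u`. -/
def basisVec (u : TangentBundle (𝓡 n) M) (i : Fin n) : PB n M u :=
  (EuclideanSpace.single i (1 : ℝ) : EuclideanSpace ℝ (Fin n))

/-- The `i`-th coordinate of a vector of the fibre over `u`, in the basis `basisVec u`. -/
def coord (u : TangentBundle (𝓡 n) M) (v : PB n M u) (i : Fin n) : ℝ :=
  (show EuclideanSpace ℝ (Fin n) from v) i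

/-- The horizontal Ricci tensor `Ric(X, Y) = Tr {Z ↦ R(X, Z)Y}`. -/
def ricci (D : Conn n M) : STensor n M 2 := fun u x ↦
  ∑ i : Fin n, coord u (hCurv D u ![x 0, basisVec u i, x 1]) i

/-- The Finsler metric as a type `(0, 2)` tensor field. -/
def metricTensor (L : TangentBundle (𝓡 n) M → ℝ) : STensor n M 2 := fun u x ↦
  metric L u (x 0) (x 1)

/-- The horizontal scalar curvature: the trace of `Ric` with respect to `g`. -/
def scalarCurv (L : TangentBundle (𝓡 n) M → ℝ) (D : Conn n M) (u : TangentBundle (𝓡 n) M) : ℝ :=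
  ∑ i : Fin n, ∑ j : Fin n,
    (Matrix.of fun k l : Fin n ↦ metric L u (basisVec u k) (basisVec u l))⁻¹ i j *
      ricci D u ![basisVec u i, basisVec u j]

/-- `G(X, Y)Z = g(X, Z)Y - g(Y, Z)X`. -/
def gTensor (L : TangentBundle (𝓡 n) M → ℝ) : VTensor n M 3 := fun u x ↦
  metric L u (x 0) (x 2) • x 1 - metric L u (x 1) (x 2) • x 0

/-- The concircular curvature tensor `C = R - r / (n (n - 1)) G`. -/
def concircular (L : TangentBundle (𝓡 n) M → ℝ) (D : Conn n M) : VTensor n M 3 := fun u x ↦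
  hCurv D u x - (scalarCurv L D u / ((n : ℝ) * ((n : ℝ) - 1))) • gTensor L u x

/-- `∇ʰr` as a type `(0, 1)` tensor field. -/
def nablaScalar (L : TangentBundle (𝓡 n) M → ℝ) (D : Conn n M) : STensor n M 1 :=
  nablaS D (k := 0) fun u _ ↦ scalarCurv L D u

/-- A type `(1, k)` tensor field is nonzero (not identically zero on `𝒯M`). -/
def VTensor.NonZero {k : ℕ} (T : VTensor n M k) : Prop := ∃ u ∈ slit n M, ∃ x, T u x ≠ 0

/-- A type `(0, k)` tensor field is nonzero (not identically zero on `𝒯M`). -/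
def STensor.NonZero {k : ℕ} (T : STensor n M k) : Prop := ∃ u ∈ slit n M, ∃ x, T u x ≠ 0

/-- `A` is a nonzero smooth scalar `k`-form (a multilinear type `(0, k)` `π`-tensor field, not
necessarily alternating) on `𝒯M`, positively homogeneous of degree zero in `y`. -/
structure IsRecurrenceForm {k : ℕ} (A : STensor n M k) : Prop where
  map_add : ∀ u ∈ slit n M, ∀ (x : Fin k → PB n M u) (i : Fin k) (v w : PB n M u),
    A u (Function.update x i (v + w)) =
      A u (Function.update x i v) + A u (Function.update x i w)
  map_smul : ∀ u ∈ slit n M, ∀ (x : Fin k → PB n M u) (i : Fin k) (c : ℝ) (v : PB n M u),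
    A u (Function.update x i (c • v)) = c * A u (Function.update x i v)
  smooth : ∀ U : Set (TangentBundle (𝓡 n) M), IsOpen U → U ⊆ slit n M →
    ∀ X : Fin k → PiField n M, (∀ i, SmoothOn (X i) U) →
      ContMDiffOn (𝓡 n).tangent 𝓘(ℝ, ℝ) ∞ (fun u ↦ A u (fun i ↦ X i u)) U
  homogeneous : ∀ (x : M) (y : TangentSpace (𝓡 n) x), y ≠ 0 → ∀ t : ℝ, 0 < t →
    ∀ v : Fin k → TangentSpace (𝓡 n) x, A ⟨x, t • y⟩ v = A ⟨x, y⟩ v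
  nonZero : A.NonZero

/-! ### Recurrence -/

/-- `(M, L)` is recurrent (`F_n`): `R ≠ 0` and `∇ʰR = A ⊗ R`. -/
def IsRecurrent (D : Conn n M) : Prop :=
  (hCurv D).NonZero ∧ ∃ A : STensor n M 1, IsRecurrenceForm A ∧
    ∀ u ∈ slit n M, ∀ w x y z : PB n M u,
      nablaV D (hCurv D) u ![w, x, y, z] = A u ![w] • hCurv D u ![x, y, z]

/-- `(M, L)` is generalized recurrent (`GF_n`): `R ≠ 0` and `∇ʰR = A ⊗ R + B ⊗ G`. -/
def IsGeneralizedRecurrent (L : TangentBundle (𝓡 n) M → ℝ) (D : Conn n M) : Prop :=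
  (hCurv D).NonZero ∧ ∃ A B : STensor n M 1, IsRecurrenceForm A ∧ IsRecurrenceForm B ∧
    ∀ u ∈ slit n M, ∀ w x y z : PB n M u,
      nablaV D (hCurv D) u ![w, x, y, z] =
        A u ![w] • hCurv D u ![x, y, z] + B u ![w] • gTensor L u ![x, y, z]

/-- `(M, L)` is generalized Ricci recurrent (`GRF_n`): `Ric ≠ 0` and
`∇ʰRic = A ⊗ Ric + B ⊗ g`. -/
def IsGeneralizedRicciRecurrent (L : TangentBundle (𝓡 n) M → ℝ) (D : Conn n M) : Prop :=
  (ricci D).NonZero ∧ ∃ A B : STensor n M 1, IsRecurrenceForm A ∧ IsRecurrenceForm B ∧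
    ∀ u ∈ slit n M, ∀ w x y : PB n M u,
      nablaS D (ricci D) u ![w, x, y] =
        A u ![w] * ricci D u ![x, y] + B u ![w] * metricTensor L u ![x, y]

/-- `(M, L)` is concircularly recurrent (`CF_n`) with recurrence form `A`: `C ≠ 0` and
`∇ʰC = A ⊗ C`. -/
def IsConcircularlyRecurrent (L : TangentBundle (𝓡 n) M → ℝ) (D : Conn n M)
    (A : STensor n M 1) : Prop :=
  (concircular L D).NonZero ∧ IsRecurrenceForm A ∧
    ∀ u ∈ slit n M, ∀ w x y z : PB n M u,
      nablaV D (concircular L D) u ![w, x, y, z] = A u ![w] • concircular L D u ![x, y, z]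

/-- `(M, L)` is 2-concircularly recurrent (`2CF_n`): `C ≠ 0` and `∇ʰ∇ʰC = α ⊗ C`. -/
def IsTwoConcircularlyRecurrent (L : TangentBundle (𝓡 n) M → ℝ) (D : Conn n M) : Prop :=
  (concircular L D).NonZero ∧ ∃ α : STensor n M 2, IsRecurrenceForm α ∧
    ∀ u ∈ slit n M, ∀ v w x y z : PB n M u,
      nablaV D (nablaV D (concircular L D)) u ![v, w, x, y, z] =
        α u ![v, w] • concircular L D u ![x, y, z]

/-- The contracted curvature `R̂(X, Y) = R(X, Y)η`. -/
def hatR (D : Conn n M) : VTensor n M 2 := fun u x ↦ hCurv D u ![x 0, x 1, eta n M u]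

end Finsler

end

/-! The algebra is short. Since `∇g = 0`, the tensor `G` is parallel, so `∇ʰC = ∇ʰR - ∇ʰr/(n(n-1)) ⊗
G` (`nablaV_concircular`), and the assumption becomes `∇ʰR = A ⊗ R + B ⊗ G` with `B = (∇ʰr -
rA)/(n(n-1))` (`nablaV_hCurv_of_concircular`). This is (b) for `R`; contraction turns `∇ʰR` into
`∇ʰRic` (`sum_coord_nablaV_hCurv`) and `G` into `(n-1)g`, which is (b) for `Ric`. Differentiating
`∇ʰC = A ⊗ C` once more gives `∇ʰ∇ʰC = (∇ʰA + A ⊗ A) ⊗ C`, which is (a). For (c), `∇_{βW} η = K(βW)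
= 0`, so `R(X, Y)η = 0` implies `(∇ʰR)(W, X, Y, η) = 0` and then `B(W) G(X, Y)η = 0`. If `B(W) ≠ 0`,
the choice `X = η` makes every `Y` a multiple of `η`, impossible in dimension at least two.

The labour lies in showing that the new forms are recurrence forms, that is, smooth and of degree
zero in `y`. Homogeneity of the connection is not among its axioms; it comes from uniqueness. The
metric has degree zero, so the connection form pulled back by a dilation `(x, y) ↦ (x, ty)`
satisfies the same pointwise conditions, and these have only one solution (`IsCartanForm.unique`,
`cform_dil`). The horizontal lift, the curvature and `r` inherit the invariance.

All this is carried out in charts of `TM`, where `D` becomes `d + Γ` (`tau_cov`) and `g` the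
fibrewise Hessian of `L²/2` (`metric_crd`). The passage back from smooth, dilation invariant
components to recurrence forms is `isRecurrenceForm_of_components`. -/

noncomputable section

namespace Finsler

/-! ### Calculus on the model space -/

section Model

variable {V : Type*} [NormedAddCommGroup V] [NormedSpace ℝ V]

/-- The dilation `(x, y) ↦ (x, t y)` of the fibre variable. -/
def dil (t : ℝ) : V × V →L[ℝ] V × V :=
  (ContinuousLinearMap.fst ℝ V V).prod (t • ContinuousLinearMap.snd ℝ V V)

@[simp] lemma dil_apply (t : ℝ) (p : V × V) : dil t p = (p.1, t • p.2) := rfl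

/-- The derivative of a map `f` with `f (x, t y) = c f (x, y)`. -/
lemma fderiv_dil {G : Type*} [NormedAddCommGroup G] [NormedSpace ℝ G] {f : V × V → G}
    {U : Set (V × V)} (hU : IsOpen U) {t : ℝ} {c : ℝ} (hf : ∀ q ∈ U, f (dil t q) = c • f q)
    {p : V × V} (hp : p ∈ U) (hd : DifferentiableAt ℝ f p)
    (hd' : DifferentiableAt ℝ f (dil t p)) (X : V × V) :
    fderiv ℝ f (dil t p) (dil t X) = c • fderiv ℝ f p X := by
  have h1 : HasFDerivAt (fun q ↦ f (dil t q)) ((fderiv ℝ f (dil t p)).comp (dil t)) p :=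
    hd'.hasFDerivAt.comp p (dil t : V × V →L[ℝ] V × V).hasFDerivAt
  have h2 : HasFDerivAt (fun q ↦ c • f q) (c • fderiv ℝ f p) p := hd.hasFDerivAt.const_smul c
  have h3 := h1.congr_of_eventuallyEq
    (Filter.eventuallyEq_of_mem (hU.mem_nhds hp) (fun q hq ↦ (hf q hq).symm))
  simpa using congrArg (fun T : V × V →L[ℝ] G ↦ T X) (h3.unique h2)

lemma two_le_infty : minSmoothness ℝ 2 ≤ ∞ := by
  rw [minSmoothness_of_isRCLikeNormedField]
  exact WithTop.coe_le_coe.2 (le_top : (2 : ℕ∞) ≤ ⊤)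

/-- The fibrewise Hessian of a function on the model of the tangent bundle. -/
def fibreHessian (F : V × V → ℝ) (p : V × V) : V →L[ℝ] V →L[ℝ] ℝ :=
  ((ContinuousLinearMap.compL ℝ V (V × V) ℝ).flip (ContinuousLinearMap.inr ℝ V V)).comp
    ((fderiv ℝ (fderiv ℝ F) p).comp (ContinuousLinearMap.inr ℝ V V))

lemma fibreHessian_apply (F : V × V → ℝ) (p : V × V) (v w : V) :
    fibreHessian F p v w = fderiv ℝ (fderiv ℝ F) p (0, v) (0, w) := rfl

/-! ### Homogeneity and Euler relations for the fibrewise Hessian -/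

section Hessian

variable {F : V × V → ℝ} {U : Set (V × V)}

lemma contDiffOn_fderiv_fun (hU : IsOpen U) {G : Type*} [NormedAddCommGroup G] [NormedSpace ℝ G]
    {f : V × V → G} (hf : ContDiffOn ℝ ∞ f U) : ContDiffOn ℝ ∞ (fderiv ℝ f) U :=
  hf.fderiv_of_isOpen hU (by simp)

lemma contDiffOn_fibreHessian (hU : IsOpen U) (hF : ContDiffOn ℝ ∞ F U) :
    ContDiffOn ℝ ∞ (fibreHessian F) U := by
  have h := contDiffOn_fderiv_fun hU (contDiffOn_fderiv_fun hU hF)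
  exact contDiffOn_const.clm_comp (h.clm_comp contDiffOn_const)

lemma fibreHessian_symm (hU : IsOpen U) (hF : ContDiffOn ℝ ∞ F U) {p : V × V} (hp : p ∈ U)
    (v w : V) : fibreHessian F p v w = fibreHessian F p w v := by
  have h : ContDiffAt ℝ ∞ F p := hF.contDiffAt (hU.mem_nhds hp)
  exact (h.isSymmSndFDerivAt two_le_infty).eq _ _

/-- Both one-variable derivatives are line derivatives. The inner one equals `fderiv` only for `s`
near 0, where the base point stays in `U`; this suffices for the outer derivative at 0. -/
lemma deriv_deriv_eq_fibreHessian (hU : IsOpen U) (hF : ContDiffOn ℝ ∞ F U) {p : V × V}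
    (hp : p ∈ U) (v w : V) :
    deriv (fun s : ℝ ↦ deriv (fun t : ℝ ↦ F (p + s • ((0 : V), v) + t • ((0 : V), w))) 0) 0 =
      fibreHessian F p v w := by
  have hcont : Continuous fun s : ℝ ↦ p + s • ((0 : V), v) := by fun_prop
  have hev : ∀ᶠ s : ℝ in nhds 0, p + s • ((0 : V), v) ∈ U := by
    refine hcont.continuousAt.eventually_mem (hU.mem_nhds ?_)
    simpa using hp
  have h3 : (fun s : ℝ ↦ deriv (fun t : ℝ ↦ F (p + s • ((0 : V), v) + t • ((0 : V), w))) 0)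
      =ᶠ[nhds 0] fun s ↦ fderiv ℝ F (p + s • ((0 : V), v)) (0, w) := by
    filter_upwards [hev] with s hs
    exact ((hF.contDiffAt (hU.mem_nhds hs)).differentiableAt (by simp)).lineDeriv_eq_fderiv
  have hd : DifferentiableAt ℝ (fderiv ℝ F) p :=
    ((contDiffOn_fderiv_fun hU hF).contDiffAt (hU.mem_nhds hp)).differentiableAt (by simp)
  have h4 : DifferentiableAt ℝ (fun q ↦ fderiv ℝ F q (0, w)) p :=
    hd.clm_apply (differentiableAt_const _)
  have h5 : deriv (fun s : ℝ ↦ fderiv ℝ F (p + s • ((0 : V), v)) (0, w)) 0 =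
      fderiv ℝ (fun q ↦ fderiv ℝ F q (0, w)) p (0, v) := h4.lineDeriv_eq_fderiv
  rw [h3.deriv_eq, h5, fibreHessian_apply, fderiv_clm_apply hd (differentiableAt_const _)]
  simp

variable (hU : IsOpen U) (hF : ContDiffOn ℝ ∞ F U)
  (hdil : ∀ t : ℝ, 0 < t → ∀ q ∈ U, dil t q ∈ U)
  (hhom : ∀ t : ℝ, 0 < t → ∀ q ∈ U, F (dil t q) = t ^ 2 * F q)
include hU hF hdil hhom

/-- `dil t` multiplies vertical directions by `t`, so the chain rule puts a factor `t` against the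
`t ^ 2` of `F`; cancelling one leaves degree one. -/
lemma fderiv_inr_dil {t : ℝ} (ht : 0 < t) {p : V × V} (hp : p ∈ U) (v : V) :
    fderiv ℝ F (dil t p) (0, v) = t * fderiv ℝ F p (0, v) := by
  have hd : ∀ q ∈ U, DifferentiableAt ℝ F q := fun q hq ↦
    (hF.contDiffAt (hU.mem_nhds hq)).differentiableAt (by simp)
  have h := fderiv_dil hU (hhom t ht) hp (hd _ hp) (hd _ (hdil t ht _ hp)) (0, v)
  have h0 : dil t ((0 : V), v) = t • ((0 : V), v) := by simp
  rw [h0, map_smul, smul_eq_mul, smul_eq_mul] at h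
  have : t * (fderiv ℝ F (dil t p) (0, v) - t * fderiv ℝ F p (0, v)) = 0 := by linear_combination h
  rcases mul_eq_zero.1 this with h | h
  · exact absurd h ht.ne'
  · linarith

/-- The same cancellation once more: second vertical derivatives of a function of degree two have
degree zero. -/
lemma fibreHessian_dil {t : ℝ} (ht : 0 < t) {p : V × V} (hp : p ∈ U) :
    fibreHessian F (dil t p) = fibreHessian F p := by
  ext v w
  have hd : ∀ q ∈ U, DifferentiableAt ℝ (fun q ↦ fderiv ℝ F q (0, w)) q := fun q hq ↦
    (((contDiffOn_fderiv_fun hU hF).clm_apply contDiffOn_const).contDiffAt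
      (hU.mem_nhds hq)).differentiableAt (by simp)
  have hd2 : ∀ q ∈ U, DifferentiableAt ℝ (fderiv ℝ F) q := fun q hq ↦
    ((contDiffOn_fderiv_fun hU hF).contDiffAt (hU.mem_nhds hq)).differentiableAt (by simp)
  have h := fderiv_dil hU (f := fun q ↦ fderiv ℝ F q (0, w)) (c := t)
    (fun q hq ↦ fderiv_inr_dil hU hF hdil hhom ht hq w) hp (hd _ hp) (hd _ (hdil t ht _ hp)) (0, v)
  have h0 : dil t ((0 : V), v) = t • ((0 : V), v) := by simp
  rw [h0, map_smul, smul_eq_mul, smul_eq_mul] at h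
  have key : ∀ q ∈ U, fderiv ℝ (fun q ↦ fderiv ℝ F q (0, w)) q (0, v) = fibreHessian F q v w := by
    intro q hq
    rw [fibreHessian_apply, fderiv_clm_apply (hd2 q hq) (differentiableAt_const _)]
    simp
  rw [key _ hp, key _ (hdil t ht _ hp)] at h
  exact mul_left_cancel₀ ht.ne' h

/-- Euler's relation for the fibre derivative. -/
lemma fibreHessian_euler {p : V × V} (hp : p ∈ U) (v : V) :
    fibreHessian F p p.2 v = fderiv ℝ F p (0, v) := by
  have hd2 : DifferentiableAt ℝ (fderiv ℝ F) p :=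
    ((contDiffOn_fderiv_fun hU hF).contDiffAt (hU.mem_nhds hp)).differentiableAt (by simp)
  have hp1 : dil 1 p = p := by simp
  -- Euler's argument: the relation of `fderiv_inr_dil` is differentiated in `t` at `t = 1`.
  have hc : HasDerivAt (fun t : ℝ ↦ dil t p) (0, p.2) 1 := by
    have := (hasDerivAt_const (1 : ℝ) p.1).prodMk ((hasDerivAt_id (1 : ℝ)).smul_const p.2)
    simpa using this
  have h1 : HasDerivAt (fun t : ℝ ↦ fderiv ℝ F (dil t p)) (fderiv ℝ (fderiv ℝ F) p (0, p.2)) 1 := by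
    have h : HasFDerivAt (fderiv ℝ F) (fderiv ℝ (fderiv ℝ F) p) (dil 1 p) := by
      rw [hp1]; exact hd2.hasFDerivAt
    exact h.comp_hasDerivAt (1 : ℝ) hc
  have h2 : HasDerivAt (fun t : ℝ ↦ fderiv ℝ F (dil t p) (0, v))
      (fderiv ℝ (fderiv ℝ F) p (0, p.2) (0, v)) 1 := by
    simpa using h1.clm_apply (hasDerivAt_const (1 : ℝ) ((0 : V), v))
  have h3 : HasDerivAt (fun t : ℝ ↦ t * fderiv ℝ F p (0, v)) (fderiv ℝ F p (0, v)) 1 := by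
    simpa using (hasDerivAt_id (1 : ℝ)).mul_const (fderiv ℝ F p (0, v))
  have h4 := h2.congr_of_eventuallyEq (f₁ := fun t : ℝ ↦ t * fderiv ℝ F p (0, v))
    (Filter.eventuallyEq_of_mem (Ioi_mem_nhds zero_lt_one)
      (fun t ht ↦ (fderiv_inr_dil hU hF hdil hhom ht hp v).symm))
  exact h4.unique h3

/-- The vertical derivative of the fibrewise Hessian vanishes in the radial direction. -/
lemma fderiv_fibreHessian_radial {p : V × V} (hp : p ∈ U) (a v : V) :
    fderiv ℝ (fun q ↦ fibreHessian F q p.2 v) p (0, a) = 0 := by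
  have hg : DifferentiableAt ℝ (fibreHessian F) p :=
    ((contDiffOn_fibreHessian hU hF).contDiffAt (hU.mem_nhds hp)).differentiableAt (by simp)
  have hd2 : DifferentiableAt ℝ (fderiv ℝ F) p :=
    ((contDiffOn_fderiv_fun hU hF).contDiffAt (hU.mem_nhds hp)).differentiableAt (by simp)
  -- Euler's relation is differentiated in the direction `(0, a)`. Besides the wanted term the left
  -- side yields `g(a, v)`, from the moving argument `q.2`, and this is the whole of the right side.
  have h1 : HasFDerivAt (fun q : V × V ↦ fibreHessian F q q.2 v) _ p :=
    (hg.hasFDerivAt.clm_apply hasFDerivAt_snd).clm_apply (hasFDerivAt_const v p)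
  have h2 : HasFDerivAt (fun q : V × V ↦ fderiv ℝ F q (0, v)) _ p :=
    hd2.hasFDerivAt.clm_apply (hasFDerivAt_const ((0 : V), v) p)
  have h3 := h1.congr_of_eventuallyEq (f₁ := fun q : V × V ↦ fderiv ℝ F q (0, v))
    (Filter.eventuallyEq_of_mem (hU.mem_nhds hp)
      (fun q hq ↦ (fibreHessian_euler hU hF hdil hhom hq v).symm))
  have h4 := congrArg (fun T : V × V →L[ℝ] ℝ ↦ T (0, a)) (h3.unique h2)
  have h5 : HasFDerivAt (fun q : V × V ↦ fibreHessian F q p.2 v) _ p :=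
    (hg.hasFDerivAt.clm_apply (hasFDerivAt_const p.2 p)).clm_apply (hasFDerivAt_const v p)
  rw [h5.fderiv]
  simpa [fibreHessian_apply] using h4

end Hessian

/-! ### Pointwise uniqueness of the Cartan connection -/

/-- The algebraic conditions satisfied by the connection form `Γ` of the Cartan connection at a
point with fibre coordinate `y`; `g` is the metric and `T` its derivative. -/
structure IsCartanForm (g : V →L[ℝ] V →L[ℝ] ℝ) (T : V → V → V × V →L[ℝ] ℝ) (y : V)
    (Γ : V →L[ℝ] V × V →L[ℝ] V) : Prop where
  metric : ∀ X v w, T v w X = g (Γ v X) w + g v (Γ w X)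
  horizontal : ∀ v w, Γ w (v, - Γ y (v, 0)) = Γ v (w, - Γ y (w, 0))
  vertical : ∀ a v w, g (Γ v (0, a)) w = g (Γ w (0, a)) v

/-- The horizontal lift determined by a connection form. -/
def horLift (y : V) (Γ : V →L[ℝ] V × V →L[ℝ] V) : V →L[ℝ] V × V :=
  (ContinuousLinearMap.id ℝ V).prod (-(Γ y).comp (ContinuousLinearMap.inl ℝ V V))

@[simp] lemma horLift_apply (y : V) (Γ : V →L[ℝ] V × V →L[ℝ] V) (v : V) :
    horLift y Γ v = (v, - Γ y (v, 0)) := rfl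

/-- For `e = Γ y (0, a)`, metricity at the pair `(y, e)` and `T y = 0` on vertical vectors give `0 =
g(e, e) + g(y, Γ e (0, a))`, and the vertical symmetry makes the second term `g(e, e)` as well. Only
the metric and vertical conditions enter, so the result is available before the horizontal lift is
known in coordinates. -/
lemma vertical_form_radial {g : V →L[ℝ] V →L[ℝ] ℝ} {T : V → V → V × V →L[ℝ] ℝ} {y : V}
    {Γ : V →L[ℝ] V × V →L[ℝ] V} (hpos : ∀ v, v ≠ 0 → 0 < g v v) (hsymm : ∀ v w, g v w = g w v)
    (hT : ∀ a v, T y v (0, a) = 0)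
    (hm : ∀ X v w, T v w X = g (Γ v X) w + g v (Γ w X))
    (hv : ∀ a v w, g (Γ v (0, a)) w = g (Γ w (0, a)) v) (a : V) :
    Γ y (0, a) = 0 := by
  by_contra h
  have h1 := hpos _ h
  have h2 := hm (0, a) y (Γ y (0, a))
  rw [hT, hsymm y, ← hv a y] at h2
  linarith

/-- A Koszul argument, complicated by the fact that the two horizontal spaces might differ. On
vertical vectors, metricity and symmetry give `2 g(Γ v (0, a), w) = T v w (0, a)`. The horizontal
difference `θ` is symmetric, but it is metric only up to the term `T w z (0, θ v y)`. Since `T y`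
vanishes on vertical vectors, evaluation at `y` kills first `θ y y`, then all `θ v y`; after that
the correction is gone and the usual argument applies. -/
lemma IsCartanForm.unique {g : V →L[ℝ] V →L[ℝ] ℝ} {T : V → V → V × V →L[ℝ] ℝ} {y : V}
    {Γ₁ Γ₂ : V →L[ℝ] V × V →L[ℝ] V} (hpos : ∀ v, v ≠ 0 → 0 < g v v)
    (hsymm : ∀ v w, g v w = g w v) (hT : ∀ a v, T y v (0, a) = 0)
    (h₁ : IsCartanForm g T y Γ₁) (h₂ : IsCartanForm g T y Γ₂) : Γ₁ = Γ₂ := by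
  have nondeg : ∀ v, (∀ w, g v w = 0) → v = 0 := fun v hv ↦ by
    by_contra h
    exact (hpos v h).ne' (hv v)
  have hvert : ∀ a v, Γ₁ v (0, a) = Γ₂ v (0, a) := by
    intro a v
    rw [← sub_eq_zero]
    refine nondeg _ fun w ↦ ?_
    have e1 := h₁.metric (0, a) v w
    have e2 := h₂.metric (0, a) v w
    rw [hsymm v, ← h₁.vertical a v] at e1
    rw [hsymm v, ← h₂.vertical a v] at e2
    simp only [map_sub, sub_apply]
    linarith
  have rad₁ := vertical_form_radial hpos hsymm hT h₁.metric h₁.vertical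
  have rad₂ := vertical_form_radial hpos hsymm hT h₂.metric h₂.vertical
  have split : ∀ X : V × V, X = (X.1, 0) + (0, X.2) := fun X ↦ by simp
  -- the difference of the horizontal parts
  set θ : V → V → V := fun v w ↦ Γ₁ w (horLift y Γ₁ v) - Γ₂ w (horLift y Γ₂ v) with hθ
  have θadd : ∀ v v' w, θ (v + v') w = θ v w + θ v' w := fun v v' w ↦ by
    simp only [hθ, map_add]; abel
  have hy : ∀ (v : V), θ v y = Γ₁ y (v, 0) - Γ₂ y (v, 0) := fun v ↦ by
    simp only [hθ, horLift_apply]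
    rw [split (v, -(Γ₁ y) (v, 0)), split (v, -(Γ₂ y) (v, 0))]
    simp only [map_add, rad₁, rad₂, add_zero]
  have θsymm : ∀ v w, θ v w = θ w v := fun v w ↦ by
    simp only [hθ, horLift_apply, h₁.horizontal v w, h₂.horizontal v w]
  have hdiff : ∀ v, horLift y Γ₁ v - horLift y Γ₂ v = (0, - θ v y) := fun v ↦ by
    rw [hy]; simp; abel
  have met : ∀ v w z, - T w z (0, θ v y) = g (θ v w) z + g w (θ v z) := fun v w z ↦ by
    have e1 := h₁.metric (horLift y Γ₁ v) w z
    have e2 := h₂.metric (horLift y Γ₂ v) w z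
    have e3 : T w z (horLift y Γ₁ v) - T w z (horLift y Γ₂ v) = - T w z (0, θ v y) := by
      have : ((0 : V), - θ v y) = - ((0 : V), θ v y) := by simp
      rw [← map_sub, hdiff, this, map_neg]
    simp only [hθ, map_sub, sub_apply] at e3 ⊢
    linarith
  -- The correction term drops out here because an argument of `T` is `y`, and in `a3` because it
  -- contains `θ y y`.
  have a1 : ∀ v w, g (θ v y) w = - g y (θ v w) := fun v w ↦ by
    have := met v y w
    rw [hT] at this
    linarith
  have a2 : θ y y = 0 := nondeg _ fun w ↦ by
    rw [a1, θsymm y w, hsymm y, a1 w y, hsymm y]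
    have := a1 w y
    rw [hsymm y] at this
    linarith
  have a3 : ∀ v w, g (θ v y) w = - g v (θ w y) := fun v w ↦ by
    have := met y v w
    have z : ((0 : V), (0 : V)) = 0 := rfl
    rw [a2, z, map_zero, θsymm y v, θsymm y w] at this
    simp at this
    linarith
  -- `g(θ v y, w)` is symmetric in `v, w` by `a1` and skew by `a3`.
  have a4 : ∀ v, θ v y = 0 := fun v ↦ nondeg _ fun w ↦ by
    have e1 := a1 v w
    have e2 := a1 w v
    rw [θsymm w v] at e2
    have e3 := a3 v w
    rw [hsymm v] at e3
    linarith
  have a5 : ∀ v w z, g (θ v w) z = - g w (θ v z) := fun v w z ↦ by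
    have := met v w z
    have h0 : ((0 : V), (0 : V)) = 0 := rfl
    rw [a4, h0, map_zero] at this
    simp at this
    linarith
  -- `g(θ v w, z)` is symmetric in the first two arguments and skew in the last two, hence zero.
  have a6 : ∀ v w, θ v w = 0 := fun v w ↦ nondeg _ fun z ↦ by
    have e1 := a5 v w z
    have e2 := a5 z v w
    have e3 := a5 w z v
    rw [hsymm w, θsymm v z] at e1
    rw [hsymm v, θsymm z w] at e2
    rw [hsymm z, θsymm w v] at e3
    linarith
  refine ContinuousLinearMap.ext fun w ↦ ContinuousLinearMap.ext fun X ↦ ?_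
  have h0 : horLift y Γ₁ X.1 = horLift y Γ₂ X.1 := by
    rw [← sub_eq_zero, hdiff, a4]; simp
  have h1 : Γ₁ w (horLift y Γ₁ X.1) = Γ₂ w (horLift y Γ₂ X.1) := sub_eq_zero.1 (a6 X.1 w)
  have hX : X = horLift y Γ₁ X.1 + (0, X.2 + Γ₁ y (X.1, 0)) := by simp
  rw [hX, map_add, map_add, hvert, h1, h0]

/-! ### Covariant derivatives in the model space -/

/-- The covariant derivative `d + Γ`. -/
def modelCov (Γ : V × V → V →L[ℝ] V × V →L[ℝ] V) (Z : V × V → V) (X : V × V → V × V)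
    (q : V × V) : V :=
  fderiv ℝ Z q (X q) + Γ q (Z q) (X q)

/-- The curvature form of `d + Γ`. -/
def curvForm (Γ : V × V → V →L[ℝ] V × V →L[ℝ] V) (p : V × V) (X Y : V × V) (z : V) : V :=
  - fderiv ℝ Γ p X z Y + fderiv ℝ Γ p Y z X - Γ p (Γ p z Y) X + Γ p (Γ p z X) Y

/-- The second derivatives of `Z` cancel by symmetry, the terms `Γ(dZ)` cancel in pairs, and the
derivatives of `X` and `Y` cancel against the bracket. What survives is of order zero in `Z`. -/
lemma modelCov_curvature {Γ : V × V → V →L[ℝ] V × V →L[ℝ] V} {p : V × V} {Z : V × V → V}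
    {X Y : V × V → V × V} (hΓ : DifferentiableAt ℝ Γ p) (hZ : ContDiffAt ℝ ∞ Z p)
    (hX : DifferentiableAt ℝ X p) (hY : DifferentiableAt ℝ Y p) :
    - modelCov Γ (modelCov Γ Z Y) X p + modelCov Γ (modelCov Γ Z X) Y p
      + (fderiv ℝ Z p (fderiv ℝ Y p (X p) - fderiv ℝ X p (Y p))
        + Γ p (Z p) (fderiv ℝ Y p (X p) - fderiv ℝ X p (Y p)))
    = curvForm Γ p (X p) (Y p) (Z p) := by
  have hZ1 : DifferentiableAt ℝ Z p := hZ.differentiableAt (by simp)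
  have hZ2 : DifferentiableAt ℝ (fderiv ℝ Z) p :=
    (hZ.fderiv_right (m := ∞) (by simp)).differentiableAt (by simp)
  have hs : fderiv ℝ (fderiv ℝ Z) p (X p) (Y p) = fderiv ℝ (fderiv ℝ Z) p (Y p) (X p) :=
    (hZ.isSymmSndFDerivAt two_le_infty).eq _ _
  have key : ∀ {W : V × V → V × V} (_ : DifferentiableAt ℝ W p) (v : V × V),
      fderiv ℝ (modelCov Γ Z W) p v = fderiv ℝ (fderiv ℝ Z) p v (W p) + fderiv ℝ Z p (fderiv ℝ W p v)
        + (fderiv ℝ Γ p v (Z p) (W p) + Γ p (fderiv ℝ Z p v) (W p) + Γ p (Z p) (fderiv ℝ W p v)) := by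
    intro W hW v
    have h : HasFDerivAt (modelCov Γ Z W) _ p :=
      (hZ2.hasFDerivAt.clm_apply hW.hasFDerivAt).add
        ((hΓ.hasFDerivAt.clm_apply hZ1.hasFDerivAt).clm_apply hW.hasFDerivAt)
    rw [h.fderiv]
    simp
    abel
  have e : ∀ W₁ W₂, modelCov Γ (modelCov Γ Z W₁) W₂ p = fderiv ℝ (modelCov Γ Z W₁) p (W₂ p)
      + Γ p (modelCov Γ Z W₁ p) (W₂ p) := fun _ _ ↦ rfl
  rw [e, e, key hX, key hY]
  simp only [modelCov, curvForm, map_sub, map_add, add_apply, hs]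
  abel

/-- The invariance of `Γ` is differentiated with `z` and the second vector `B` fixed; the chain rule
then dilates the direction of differentiation as well. -/
lemma curvForm_dil {Γ : V × V → V →L[ℝ] V × V →L[ℝ] V} {U : Set (V × V)} (hU : IsOpen U) {t : ℝ}
    (hΓ : ∀ q ∈ U, DifferentiableAt ℝ Γ q) (hdil : ∀ q ∈ U, dil t q ∈ U)
    (h : ∀ q ∈ U, ∀ v X, Γ (dil t q) v (dil t X) = Γ q v X) {p : V × V} (hp : p ∈ U)
    (X Y : V × V) (z : V) :
    curvForm Γ (dil t p) (dil t X) (dil t Y) z = curvForm Γ p X Y z := by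
  have key : ∀ A B : V × V, fderiv ℝ Γ (dil t p) (dil t A) z (dil t B) = fderiv ℝ Γ p A z B := by
    intro A B
    have hd : ∀ q ∈ U, ∀ B, HasFDerivAt (fun q ↦ Γ q z B)
        (((fderiv ℝ Γ q).flip z).flip B) q := fun q hq B ↦ by
      have := ((hΓ q hq).hasFDerivAt.clm_apply (hasFDerivAt_const z q)).clm_apply
        (hasFDerivAt_const B q)
      rwa [ContinuousLinearMap.comp_zero, ContinuousLinearMap.comp_zero, zero_add, zero_add] at this
    have h1 := (hd _ (hdil p hp) (dil t B)).comp p (dil t : V × V →L[ℝ] V × V).hasFDerivAt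
    have h2 := h1.congr_of_eventuallyEq (f₁ := fun q ↦ Γ q z B)
      (Filter.eventuallyEq_of_mem (hU.mem_nhds hp) (fun q hq ↦ (h q hq z B).symm))
    have h3 := congrArg (fun T : V × V →L[ℝ] V ↦ T A) (h2.unique (hd p hp B))
    simpa using h3
  simp only [curvForm, key, h p hp]

end Model

variable {n : ℕ} {M : Type*} [TopologicalSpace M] [ChartedSpace (EuclideanSpace ℝ (Fin n)) M]
  [IsManifold (𝓡 n) ∞ M]

/-! ### Coordinates on the tangent bundle -/

/-- The coordinates `(x, y)` on `TM` given by the preferred chart at `c`. -/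
def crd (c : TangentBundle (𝓡 n) M) : TangentBundle (𝓡 n) M →
    EuclideanSpace ℝ (Fin n) × EuclideanSpace ℝ (Fin n) :=
  extChartAt (𝓡 n).tangent c

/-- The inverse of `crd`. -/
def crdInv (c : TangentBundle (𝓡 n) M) :
    EuclideanSpace ℝ (Fin n) × EuclideanSpace ℝ (Fin n) → TangentBundle (𝓡 n) M :=
  (extChartAt (𝓡 n).tangent c).symm

/-- The domain of `crd`. -/
def dom (c : TangentBundle (𝓡 n) M) : Set (TangentBundle (𝓡 n) M) :=
  (extChartAt (𝓡 n).tangent c).source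

/-- The components of an element of the fibre of `π⁻¹(TM)` over `u` in the chart at `c`. -/
def tau (c u : TangentBundle (𝓡 n) M) : PB n M u →L[ℝ] EuclideanSpace ℝ (Fin n) :=
  (trivializationAt (EuclideanSpace ℝ (Fin n)) (PB n M) c).continuousLinearMapAt ℝ u

/-- The inverse of `tau`. -/
def tauInv (c u : TangentBundle (𝓡 n) M) : EuclideanSpace ℝ (Fin n) →L[ℝ] PB n M u :=
  (trivializationAt (EuclideanSpace ℝ (Fin n)) (PB n M) c).symmL ℝ u

/-- The components of a tangent vector of `TM` at `u` in the chart at `c`. -/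
def dcrd (c u : TangentBundle (𝓡 n) M) : TangentSpace (𝓡 n).tangent u →L[ℝ]
    EuclideanSpace ℝ (Fin n) × EuclideanSpace ℝ (Fin n) :=
  (trivializationAt (EuclideanSpace ℝ (Fin n) × EuclideanSpace ℝ (Fin n))
    (TangentSpace (𝓡 n).tangent) c).continuousLinearMapAt ℝ u

/-- The inverse of `dcrd`. -/
def dcrdInv (c u : TangentBundle (𝓡 n) M) :
    EuclideanSpace ℝ (Fin n) × EuclideanSpace ℝ (Fin n) →L[ℝ] TangentSpace (𝓡 n).tangent u :=
  (trivializationAt (EuclideanSpace ℝ (Fin n) × EuclideanSpace ℝ (Fin n))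
    (TangentSpace (𝓡 n).tangent) c).symmL ℝ u

lemma mem_dom_self (c : TangentBundle (𝓡 n) M) : c ∈ dom c := mem_extChartAt_source c

lemma isOpen_dom (c : TangentBundle (𝓡 n) M) : IsOpen (dom c) := isOpen_extChartAt_source c

/-- A preferred chart of `TM` lives over a whole chart domain of `M`, so `dom c` contains complete
fibres: dilations and vertical displacements never leave it. -/
lemma mem_dom_iff {c u : TangentBundle (𝓡 n) M} :
    u ∈ dom c ↔ u.proj ∈ (chartAt (EuclideanSpace ℝ (Fin n)) c.proj).source := by
  rw [dom, extChartAt_source]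
  exact TangentBundle.mem_chart_source_iff u c

lemma mem_dom_chart {c u : TangentBundle (𝓡 n) M} (hu : u ∈ dom c) :
    u ∈ (chartAt (ModelProd (EuclideanSpace ℝ (Fin n)) (EuclideanSpace ℝ (Fin n))) c).source := by
  rwa [dom, extChartAt_source] at hu

lemma mem_baseSet_PB {c u : TangentBundle (𝓡 n) M} (hu : u ∈ dom c) :
    u ∈ (trivializationAt (EuclideanSpace ℝ (Fin n)) (PB n M) c).baseSet := mem_dom_iff.1 hu

lemma mem_baseSet_TTM {c u : TangentBundle (𝓡 n) M} (hu : u ∈ dom c) :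
    u ∈ (trivializationAt (EuclideanSpace ℝ (Fin n) × EuclideanSpace ℝ (Fin n))
      (TangentSpace (𝓡 n).tangent) c).baseSet := mem_dom_chart hu

/-- The frame of `π⁻¹(TM)` and the fibre coordinates of `TM` come from the same trivialization over
`M`. In particular the components of `η` are the fibre coordinates (`crd_snd`). -/
lemma tau_apply {c u : TangentBundle (𝓡 n) M} (hu : u ∈ dom c) (v : PB n M u) :
    tau c u v = (crd c (⟨u.proj, v⟩ : TangentBundle (𝓡 n) M)).2 := by
  rw [tau, Trivialization.continuousLinearMapAt_apply, Trivialization.coe_linearMapAt_of_mem _ (mem_baseSet_PB hu)]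
  rw [crd, FiberBundle.extChartAt]
  rfl

lemma crd_fst (c u : TangentBundle (𝓡 n) M) :
    (crd c u).1 = extChartAt (𝓡 n) c.proj u.proj := by
  rw [crd, FiberBundle.extChartAt]
  rfl

lemma crd_snd {c u : TangentBundle (𝓡 n) M} (hu : u ∈ dom c) :
    (crd c u).2 = tau c u (eta n M u) := (tau_apply hu _).symm

@[simp] lemma tau_tauInv {c u : TangentBundle (𝓡 n) M} (hu : u ∈ dom c) (v) :
    tau c u (tauInv c u v) = v :=
  Trivialization.continuousLinearMapAt_symmL _ (mem_baseSet_PB hu) v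

@[simp] lemma tauInv_tau {c u : TangentBundle (𝓡 n) M} (hu : u ∈ dom c) (v) :
    tauInv c u (tau c u v) = v :=
  Trivialization.symmL_continuousLinearMapAt _ (mem_baseSet_PB hu) v

@[simp] lemma dcrd_dcrdInv {c u : TangentBundle (𝓡 n) M} (hu : u ∈ dom c) (v) :
    dcrd c u (dcrdInv c u v) = v :=
  Trivialization.continuousLinearMapAt_symmL _ (mem_baseSet_TTM hu) v

@[simp] lemma dcrdInv_dcrd {c u : TangentBundle (𝓡 n) M} (hu : u ∈ dom c) (v) :
    dcrdInv c u (dcrd c u v) = v :=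
  Trivialization.symmL_continuousLinearMapAt _ (mem_baseSet_TTM hu) v

lemma tau_injective {c u : TangentBundle (𝓡 n) M} (hu : u ∈ dom c) :
    Function.Injective (tau c u) := Function.LeftInverse.injective (tauInv_tau hu)

lemma dcrd_injective {c u : TangentBundle (𝓡 n) M} (hu : u ∈ dom c) :
    Function.Injective (dcrd c u) := Function.LeftInverse.injective (dcrdInv_dcrd hu)

@[simp] lemma crdInv_crd {c u : TangentBundle (𝓡 n) M} (hu : u ∈ dom c) :
    crdInv c (crd c u) = u := (extChartAt (𝓡 n).tangent c).left_inv hu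

lemma dcrd_eq_mfderiv {c u : TangentBundle (𝓡 n) M} (hu : u ∈ dom c) :
    dcrd c u = mfderiv (𝓡 n).tangent 𝓘(ℝ, EuclideanSpace ℝ (Fin n) × EuclideanSpace ℝ (Fin n))
      (crd c) u :=
  TangentBundle.continuousLinearMapAt_trivializationAt (mem_dom_chart hu)

lemma mdifferentiableAt_crd {c u : TangentBundle (𝓡 n) M} (hu : u ∈ dom c) :
    MDifferentiableAt (𝓡 n).tangent 𝓘(ℝ, EuclideanSpace ℝ (Fin n) × EuclideanSpace ℝ (Fin n))
      (crd c) u := mdifferentiableAt_extChartAt (mem_dom_chart hu)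

lemma tau_eq_mfderiv {c u : TangentBundle (𝓡 n) M} (hu : u ∈ dom c) (v : PB n M u) :
    tau c u v = mfderiv (𝓡 n) 𝓘(ℝ, EuclideanSpace ℝ (Fin n)) (extChartAt (𝓡 n) c.proj) u.proj v := by
  have h1 : Trivialization.continuousLinearMapAt ℝ
      (trivializationAt (EuclideanSpace ℝ (Fin n)) (TangentSpace (𝓡 n) (M := M)) c.proj) u.proj v =
      (trivializationAt (EuclideanSpace ℝ (Fin n)) (TangentSpace (𝓡 n) (M := M)) c.proj
        ⟨u.proj, v⟩).2 := by
    rw [Trivialization.continuousLinearMapAt_apply,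
      Trivialization.coe_linearMapAt_of_mem _ (mem_dom_iff.1 hu)]
  have h2 : tau c u v = (trivializationAt (EuclideanSpace ℝ (Fin n))
      (TangentSpace (𝓡 n) (M := M)) c.proj ⟨u.proj, v⟩).2 := by
    rw [tau, Trivialization.continuousLinearMapAt_apply,
      Trivialization.coe_linearMapAt_of_mem _ (mem_baseSet_PB hu)]
    rfl
  exact h2.trans (h1.symm.trans (congrArg (fun T : TangentSpace (𝓡 n) u.proj →L[ℝ]
    EuclideanSpace ℝ (Fin n) ↦ T v)
    (TangentBundle.continuousLinearMapAt_trivializationAt (mem_dom_iff.1 hu))))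

/-- In coordinates `π` is the first projection, and so is its differential. -/
lemma tau_rho {c u : TangentBundle (𝓡 n) M} (hu : u ∈ dom c) (X : TangentSpace (𝓡 n).tangent u) :
    tau c u (rho u X) = (dcrd c u X).1 := by
  have hπ : MDifferentiableAt (𝓡 n).tangent (𝓡 n)
      (TotalSpace.proj : TangentBundle (𝓡 n) M → M) u :=
    (contMDiff_proj (TangentSpace (𝓡 n)) (n := ∞) u).mdifferentiableAt (by simp)
  have hx : MDifferentiableAt (𝓡 n) 𝓘(ℝ, EuclideanSpace ℝ (Fin n)) (extChartAt (𝓡 n) c.proj) u.proj :=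
    mdifferentiableAt_extChartAt (mem_dom_iff.1 hu)
  have h2 := mfderiv_comp u hx hπ
  have h3 : (extChartAt (𝓡 n) c.proj) ∘ (TotalSpace.proj : TangentBundle (𝓡 n) M → M) =
      ContinuousLinearMap.fst ℝ (EuclideanSpace ℝ (Fin n)) (EuclideanSpace ℝ (Fin n)) ∘ crd c := by
    ext1 u'; exact (crd_fst c u').symm
  rw [h3, mfderiv_comp u (ContinuousLinearMap.mdifferentiableAt _) (mdifferentiableAt_crd hu),
    ContinuousLinearMap.mfderiv_eq] at h2
  have h4 := congrArg (fun T : TangentSpace (𝓡 n).tangent u →L[ℝ] EuclideanSpace ℝ (Fin n) ↦ T X) h2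
  rw [tau_eq_mfderiv hu, dcrd_eq_mfderiv hu]
  exact h4.symm

/-- In the chart the inclusion of a fibre is `w ↦ (const, τ w)` with `τ` linear; its
differentiability is read off by composing this with `crdInv`. -/
lemma dcrd_gam {c u : TangentBundle (𝓡 n) M} (hu : u ∈ dom c) (v : PB n M u) :
    dcrd c u (gam u v) = (0, tau c u v) := by
  set f : EuclideanSpace ℝ (Fin n) → TangentBundle (𝓡 n) M := fun w ↦ ⟨u.proj, w⟩ with hf
  have hfd : ∀ w, f w ∈ dom c := fun w ↦ mem_dom_iff.2 (mem_dom_iff.1 hu)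
  let τ : EuclideanSpace ℝ (Fin n) →L[ℝ] EuclideanSpace ℝ (Fin n) := tau c u
  have h1 : ∀ w, crd c (f w) = (extChartAt (𝓡 n) c.proj u.proj, τ w) := fun w ↦
    Prod.ext (crd_fst c (f w)) (tau_apply hu w).symm
  obtain ⟨y, hy⟩ : ∃ y : EuclideanSpace ℝ (Fin n), y = u.snd := ⟨_, rfl⟩
  have hfs : MDifferentiableAt 𝓘(ℝ, EuclideanSpace ℝ (Fin n)) (𝓡 n).tangent f y := by
    have hs : ∀ w, f w = crdInv c (extChartAt (𝓡 n) c.proj u.proj, τ w) := fun w ↦ by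
      rw [← h1, crdInv_crd (hfd w)]
    have h2 : MDifferentiableAt 𝓘(ℝ, EuclideanSpace ℝ (Fin n) × EuclideanSpace ℝ (Fin n))
        (𝓡 n).tangent (crdInv c) (extChartAt (𝓡 n) c.proj u.proj, τ y) := by
      rw [← h1]
      exact ((contMDiffOn_extChartAt_symm (n := ∞) c).contMDiffAt
        ((isOpen_extChartAt_target c).mem_nhds
          ((extChartAt (𝓡 n).tangent c).map_source (hfd _)))).mdifferentiableAt (by simp)
    have h3 : DifferentiableAt ℝ (fun w ↦ (extChartAt (𝓡 n) c.proj u.proj, τ w)) y :=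
      (differentiableAt_const _).prodMk τ.differentiableAt
    rw [funext hs]
    exact h2.comp y h3.mdifferentiableAt
  have h4 := mfderiv_comp y (mdifferentiableAt_crd (hfd y)) hfs
  have h5 : crd c ∘ f = fun w ↦ (extChartAt (𝓡 n) c.proj u.proj, τ w) := funext h1
  rw [h5, mfderiv_eq_fderiv] at h4
  have h6 : HasFDerivAt (fun w ↦ (extChartAt (𝓡 n) c.proj u.proj, τ w))
      ((0 : EuclideanSpace ℝ (Fin n) →L[ℝ] EuclideanSpace ℝ (Fin n)).prod τ) y :=
    (hasFDerivAt_const _ _).prodMk τ.hasFDerivAt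
  rw [h6.fderiv] at h4
  rw [dcrd_eq_mfderiv hu]
  subst hy
  exact (congrArg (fun T : EuclideanSpace ℝ (Fin n) →L[ℝ]
    EuclideanSpace ℝ (Fin n) × EuclideanSpace ℝ (Fin n) ↦ T v) h4).symm

lemma isOpen_slit : IsOpen (slit n M) := by
  rw [isOpen_iff_mem_nhds]
  intro c hc
  have h1 : ContinuousAt (fun u ↦ (crd c u).2) c :=
    (mdifferentiableAt_crd (mem_dom_self c)).continuousAt.snd
  have h2 : (crd c c).2 ≠ 0 := by
    rw [crd_snd (mem_dom_self c)]
    exact fun h ↦ hc (tau_injective (mem_dom_self c) (h.trans (map_zero _).symm))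
  filter_upwards [h1.eventually_ne h2, (isOpen_dom c).mem_nhds (mem_dom_self c)] with u hu hd h3
  refine hu ?_
  rw [crd_snd hd]
  exact (congrArg (tau c u) h3).trans (map_zero _)

/-- The coordinate domain of the slit tangent bundle in the chart at `c`. -/
def cdom (c : TangentBundle (𝓡 n) M) : Set (EuclideanSpace ℝ (Fin n) × EuclideanSpace ℝ (Fin n)) :=
  (extChartAt (𝓡 n).tangent c).target ∩ {p | p.2 ≠ 0}

lemma isOpen_cdom (c : TangentBundle (𝓡 n) M) : IsOpen (cdom c) :=
  (isOpen_extChartAt_target c).inter (isOpen_ne_fun continuous_snd continuous_const)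

lemma crdInv_mem_dom {c : TangentBundle (𝓡 n) M} {p} (hp : p ∈ cdom c) : crdInv c p ∈ dom c :=
  (extChartAt (𝓡 n).tangent c).map_target hp.1

@[simp] lemma crd_crdInv {c : TangentBundle (𝓡 n) M} {p} (hp : p ∈ cdom c) :
    crd c (crdInv c p) = p := (extChartAt (𝓡 n).tangent c).right_inv hp.1

lemma crd_snd_ne_zero {c u : TangentBundle (𝓡 n) M} (hu : u ∈ dom c) :
    (crd c u).2 ≠ 0 ↔ u ∈ slit n M := by
  rw [crd_snd hu, Ne, map_eq_zero_iff _ (tau_injective hu)]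
  rfl

lemma crd_mem_cdom {c u : TangentBundle (𝓡 n) M} (hu : u ∈ dom c) (hs : u ∈ slit n M) :
    crd c u ∈ cdom c :=
  ⟨(extChartAt (𝓡 n).tangent c).map_source hu, (crd_snd_ne_zero hu).2 hs⟩

lemma crdInv_mem_slit {c : TangentBundle (𝓡 n) M} {p} (hp : p ∈ cdom c) :
    crdInv c p ∈ slit n M := by
  rw [← crd_snd_ne_zero (crdInv_mem_dom hp), crd_crdInv hp]
  exact hp.2

lemma contMDiffAt_crdInv {c : TangentBundle (𝓡 n) M} {p} (hp : p ∈ cdom c) :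
    ContMDiffAt 𝓘(ℝ, EuclideanSpace ℝ (Fin n) × EuclideanSpace ℝ (Fin n)) (𝓡 n).tangent ∞
      (crdInv c) p :=
  (contMDiffOn_extChartAt_symm (n := ∞) c).contMDiffAt
    ((isOpen_extChartAt_target c).mem_nhds hp.1)

lemma contMDiffAt_crd {c u : TangentBundle (𝓡 n) M} (hu : u ∈ dom c) :
    ContMDiffAt (𝓡 n).tangent 𝓘(ℝ, EuclideanSpace ℝ (Fin n) × EuclideanSpace ℝ (Fin n)) ∞
      (crd c) u := contMDiffAt_extChartAt' (mem_dom_chart hu)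

/-! ### Functions and sections in coordinates -/

/-- A function near `u` in coordinates is smooth iff it is. -/
lemma contMDiffAt_iff_crd {G : Type*} [NormedAddCommGroup G] [NormedSpace ℝ G]
    {c u : TangentBundle (𝓡 n) M} (hu : u ∈ dom c) (hs : u ∈ slit n M)
    (f : TangentBundle (𝓡 n) M → G) :
    ContMDiffAt (𝓡 n).tangent 𝓘(ℝ, G) ∞ f u ↔
      ContDiffAt ℝ ∞ (fun p ↦ f (crdInv c p)) (crd c u) := by
  have hp := crd_mem_cdom hu hs
  constructor
  · intro h
    rw [← contMDiffAt_iff_contDiffAt]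
    have h' : ContMDiffAt (𝓡 n).tangent 𝓘(ℝ, G) ∞ f (crdInv c (crd c u)) := by rwa [crdInv_crd hu]
    exact h'.comp _ (contMDiffAt_crdInv hp)
  · intro h
    rw [← contMDiffAt_iff_contDiffAt] at h
    refine (h.comp u (contMDiffAt_crd hu)).congr_of_eventuallyEq ?_
    filter_upwards [(isOpen_dom c).mem_nhds hu] with u' hu'
    simp [crdInv_crd hu']

lemma mdifferentiableAt_iff_crd {G : Type*} [NormedAddCommGroup G] [NormedSpace ℝ G]
    {c u : TangentBundle (𝓡 n) M} (hu : u ∈ dom c) (hs : u ∈ slit n M)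
    (f : TangentBundle (𝓡 n) M → G) :
    MDifferentiableAt (𝓡 n).tangent 𝓘(ℝ, G) f u ↔
      DifferentiableAt ℝ (fun p ↦ f (crdInv c p)) (crd c u) := by
  have hp := crd_mem_cdom hu hs
  constructor
  · intro h
    rw [← mdifferentiableAt_iff_differentiableAt]
    have h' : MDifferentiableAt (𝓡 n).tangent 𝓘(ℝ, G) f (crdInv c (crd c u)) := by
      rwa [crdInv_crd hu]
    exact h'.comp _ ((contMDiffAt_crdInv hp).mdifferentiableAt (by simp))
  · intro h
    rw [← mdifferentiableAt_iff_differentiableAt] at h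
    refine (h.comp u (mdifferentiableAt_crd hu)).congr_of_eventuallyEq ?_
    filter_upwards [(isOpen_dom c).mem_nhds hu] with u' hu'
    simp [crdInv_crd hu']

lemma mvfderiv_crd {G : Type*} [NormedAddCommGroup G] [NormedSpace ℝ G]
    {c u : TangentBundle (𝓡 n) M} (hu : u ∈ dom c) (hs : u ∈ slit n M)
    {f : TangentBundle (𝓡 n) M → G} (hf : MDifferentiableAt (𝓡 n).tangent 𝓘(ℝ, G) f u)
    (X : TangentSpace (𝓡 n).tangent u) :
    mvfderiv (𝓡 n).tangent f u X = fderiv ℝ (fun p ↦ f (crdInv c p)) (crd c u) (dcrd c u X) := by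
  have h1 := (mdifferentiableAt_iff_crd hu hs f).1 hf
  have h2 := mfderiv_comp u h1.mdifferentiableAt (mdifferentiableAt_crd hu)
  have h3 : (fun p ↦ f (crdInv c p)) ∘ crd c =ᶠ[nhds u] f := by
    filter_upwards [(isOpen_dom c).mem_nhds hu] with u' hu'
    simp [crdInv_crd hu']
  rw [h3.mfderiv_eq, mfderiv_eq_fderiv, ← dcrd_eq_mfderiv hu] at h2
  exact congrArg (fun T : TangentSpace (𝓡 n).tangent u →L[ℝ] G ↦ T X) h2

/-- The components of a `π`-vector field in the chart at `c`. -/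
def rep (c : TangentBundle (𝓡 n) M) (σ : PiField n M)
    (p : EuclideanSpace ℝ (Fin n) × EuclideanSpace ℝ (Fin n)) : EuclideanSpace ℝ (Fin n) :=
  tau c (crdInv c p) (σ (crdInv c p))

/-- The components of a vector field on `TM` in the chart at `c`. -/
def vrep (c : TangentBundle (𝓡 n) M) (X : VField n M)
    (p : EuclideanSpace ℝ (Fin n) × EuclideanSpace ℝ (Fin n)) :
    EuclideanSpace ℝ (Fin n) × EuclideanSpace ℝ (Fin n) :=
  dcrd c (crdInv c p) (X (crdInv c p))

lemma rep_crd {c u : TangentBundle (𝓡 n) M} (hu : u ∈ dom c) (σ : PiField n M) :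
    rep c σ (crd c u) = tau c u (σ u) := by
  rw [rep, crdInv_crd hu]

lemma vrep_crd {c u : TangentBundle (𝓡 n) M} (hu : u ∈ dom c) (X : VField n M) :
    vrep c X (crd c u) = dcrd c u (X u) := by
  rw [vrep, crdInv_crd hu]

/-- Smoothness of a `π`-vector field at a point. -/
abbrev SmoothAt (σ : PiField n M) (u : TangentBundle (𝓡 n) M) : Prop :=
  ContMDiffAt (𝓡 n).tangent ((𝓡 n).tangent.prod 𝓘(ℝ, EuclideanSpace ℝ (Fin n))) ∞
    (fun u ↦ (TotalSpace.mk' (EuclideanSpace ℝ (Fin n)) u (σ u) :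
      TotalSpace (EuclideanSpace ℝ (Fin n)) (PB n M))) u

/-- Differentiability of a `π`-vector field at a point. -/
abbrev DiffAt (σ : PiField n M) (u : TangentBundle (𝓡 n) M) : Prop :=
  MDifferentiableAt (𝓡 n).tangent ((𝓡 n).tangent.prod 𝓘(ℝ, EuclideanSpace ℝ (Fin n)))
    (fun u ↦ (TotalSpace.mk' (EuclideanSpace ℝ (Fin n)) u (σ u) :
      TotalSpace (EuclideanSpace ℝ (Fin n)) (PB n M))) u

lemma eventually_tau {c u : TangentBundle (𝓡 n) M} (hu : u ∈ dom c) (σ : PiField n M) :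
    (fun u' ↦ (trivializationAt (EuclideanSpace ℝ (Fin n)) (PB n M) c
      (TotalSpace.mk' (EuclideanSpace ℝ (Fin n)) u' (σ u'))).2) =ᶠ[nhds u]
      fun u' ↦ tau c u' (σ u') := by
  filter_upwards [(isOpen_dom c).mem_nhds hu] with u' hu'
  rw [tau, Trivialization.continuousLinearMapAt_apply,
    Trivialization.coe_linearMapAt_of_mem _ (mem_baseSet_PB hu')]

lemma smoothAt_iff {c u : TangentBundle (𝓡 n) M} (hu : u ∈ dom c) (hs : u ∈ slit n M)
    (σ : PiField n M) : SmoothAt σ u ↔ ContDiffAt ℝ ∞ (rep c σ) (crd c u) := by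
  refine ((trivializationAt (EuclideanSpace ℝ (Fin n)) (PB n M) c).contMDiffAt_section_iff
    (mem_baseSet_PB hu)).trans ?_
  rw [(eventually_tau hu σ).contMDiffAt_iff, contMDiffAt_iff_crd hu hs]
  rfl

lemma diffAt_iff {c u : TangentBundle (𝓡 n) M} (hu : u ∈ dom c) (hs : u ∈ slit n M)
    (σ : PiField n M) : DiffAt σ u ↔ DifferentiableAt ℝ (rep c σ) (crd c u) := by
  refine ((trivializationAt (EuclideanSpace ℝ (Fin n)) (PB n M) c).mdifferentiableAt_section_iff
    (𝓡 n).tangent σ (mem_baseSet_PB hu)).trans ?_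
  rw [(eventually_tau hu σ).mdifferentiableAt_iff, mdifferentiableAt_iff_crd hu hs]
  rfl

/-! ### Lie brackets in coordinates -/

/-- Differentiability of a vector field on `TM` at a point. -/
abbrev VDiffAt (X : VField n M) (u : TangentBundle (𝓡 n) M) : Prop :=
  MDifferentiableAt (𝓡 n).tangent (𝓡 n).tangent.tangent
    (fun u ↦ (TotalSpace.mk' (EuclideanSpace ℝ (Fin n) × EuclideanSpace ℝ (Fin n)) u (X u) :
      TangentBundle (𝓡 n).tangent (TangentBundle (𝓡 n) M))) u

lemma eventually_dcrd {c u : TangentBundle (𝓡 n) M} (hu : u ∈ dom c) (X : VField n M) :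
    (fun u' ↦ (trivializationAt (EuclideanSpace ℝ (Fin n) × EuclideanSpace ℝ (Fin n))
      (TangentSpace (𝓡 n).tangent) c (TotalSpace.mk'
        (EuclideanSpace ℝ (Fin n) × EuclideanSpace ℝ (Fin n)) u' (X u'))).2) =ᶠ[nhds u]
      fun u' ↦ dcrd c u' (X u') := by
  filter_upwards [(isOpen_dom c).mem_nhds hu] with u' hu'
  rw [dcrd, Trivialization.continuousLinearMapAt_apply,
    Trivialization.coe_linearMapAt_of_mem _ (mem_baseSet_TTM hu')]

lemma vDiffAt_iff {c u : TangentBundle (𝓡 n) M} (hu : u ∈ dom c) (hs : u ∈ slit n M)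
    (X : VField n M) : VDiffAt X u ↔ DifferentiableAt ℝ (vrep c X) (crd c u) := by
  refine ((trivializationAt (EuclideanSpace ℝ (Fin n) × EuclideanSpace ℝ (Fin n))
    (TangentSpace (𝓡 n).tangent) c).mdifferentiableAt_section_iff
    (𝓡 n).tangent X (mem_baseSet_TTM hu)).trans ?_
  rw [(eventually_dcrd hu X).mdifferentiableAt_iff, mdifferentiableAt_iff_crd hu hs]
  rfl

/-- Serves to identify the pullback of a vector field along `crdInv`, which is formed with the
inverse differential, with the component function `vrep`. -/
lemma inverse_mfderiv_crdInv {c : TangentBundle (𝓡 n) M} {p} (hp : p ∈ cdom c) :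
    (mfderiv 𝓘(ℝ, EuclideanSpace ℝ (Fin n) × EuclideanSpace ℝ (Fin n)) (𝓡 n).tangent
      (crdInv c) p).inverse = dcrd c (crdInv c p) := by
  have hd := (contMDiffAt_crdInv hp).mdifferentiableAt (n := ∞) (by simp)
  have hcd := mdifferentiableAt_crd (crdInv_mem_dom hp)
  have h1 := mfderiv_comp p hcd hd
  have h2 : crd c ∘ crdInv c =ᶠ[nhds p] id := by
    filter_upwards [(isOpen_cdom c).mem_nhds hp] with q hq
    exact crd_crdInv hq
  rw [h2.mfderiv_eq, mfderiv_id, ← dcrd_eq_mfderiv (crdInv_mem_dom hp)] at h1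
  refine ContinuousLinearMap.inverse_eq ?_ h1.symm
  ext X
  apply dcrd_injective (crdInv_mem_dom hp)
  exact congrArg (fun T : EuclideanSpace ℝ (Fin n) × EuclideanSpace ℝ (Fin n) →L[ℝ]
    EuclideanSpace ℝ (Fin n) × EuclideanSpace ℝ (Fin n) ↦ T (dcrd c (crdInv c p) X)) h1.symm

/-- The bracket is natural under pullback by the inverse chart, and on the model space it is the
bracket of the component functions. -/
lemma dcrd_mlieBracket {c u : TangentBundle (𝓡 n) M} (hu : u ∈ dom c) (hs : u ∈ slit n M)
    {X Y : VField n M} (hX : VDiffAt X u) (hY : VDiffAt Y u) :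
    dcrd c u (VectorField.mlieBracket (𝓡 n).tangent X Y u) =
      fderiv ℝ (vrep c Y) (crd c u) (vrep c X (crd c u)) -
        fderiv ℝ (vrep c X) (crd c u) (vrep c Y (crd c u)) := by
  have hp := crd_mem_cdom hu hs
  have e0 := crdInv_crd hu
  have h0 : IsManifold (𝓡 n).tangent ∞ (TangentBundle (𝓡 n) M) := inferInstance
  have : IsManifold (𝓡 n).tangent (minSmoothness ℝ 2) (TangentBundle (𝓡 n) M) :=
    IsManifold.of_le two_le_infty
  have h := VectorField.mpullback_mlieBracket (𝕜 := ℝ) (V := X) (W := Y)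
    (I := 𝓘(ℝ, EuclideanSpace ℝ (Fin n) × EuclideanSpace ℝ (Fin n))) (I' := (𝓡 n).tangent)
    (f := crdInv c) (x₀ := crd c u) (n := ∞) (by rwa [e0]) (by rwa [e0])
    (contMDiffAt_crdInv hp) two_le_infty
  have hpb : ∀ Z : VField n M, VectorField.mpullback
      𝓘(ℝ, EuclideanSpace ℝ (Fin n) × EuclideanSpace ℝ (Fin n)) (𝓡 n).tangent (crdInv c) Z
      =ᶠ[nhds (crd c u)] vrep c Z := fun Z ↦ by
    filter_upwards [(isOpen_cdom c).mem_nhds hp] with q hq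
    rw [VectorField.mpullback, inverse_mfderiv_crdInv hq]
    rfl
  have h' : ∀ V W : (x : EuclideanSpace ℝ (Fin n) × EuclideanSpace ℝ (Fin n)) →
      TangentSpace 𝓘(ℝ, EuclideanSpace ℝ (Fin n) × EuclideanSpace ℝ (Fin n)) x,
      VectorField.mlieBracket 𝓘(ℝ, EuclideanSpace ℝ (Fin n) × EuclideanSpace ℝ (Fin n)) V W =
        VectorField.lieBracket ℝ V W := fun V W ↦ by
    rw [← VectorField.mlieBracketWithin_univ, VectorField.mlieBracketWithin_eq_lieBracketWithin]
    exact VectorField.lieBracketWithin_univ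
  rw [VectorField.mpullback, inverse_mfderiv_crdInv hp,
    (hpb X).mlieBracket_vectorField_eq (hpb Y)] at h
  rw [e0] at h
  exact h.trans (congrFun (h' (vrep c X) (vrep c Y)) (crd c u))

/-! ### The connection form -/

/-- The `π`-vector field with constant components in the chart at `c`. -/
def cst (c : TangentBundle (𝓡 n) M) (v : EuclideanSpace ℝ (Fin n)) : PiField n M :=
  fun u ↦ tauInv c u v

lemma rep_cst {c : TangentBundle (𝓡 n) M} {p} (hp : p ∈ cdom c) (v : EuclideanSpace ℝ (Fin n)) :
    rep c (cst c v) p = v := tau_tauInv (crdInv_mem_dom hp) v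

/-- `ext v` has constant components in the chart centred at its own base point; in other charts the
components may vary. -/
lemma ext_eq_cst {c u : TangentBundle (𝓡 n) M} (hu : u ∈ dom c) (v : PB n M c) :
    ext v u = cst c (tau c c v) u := by
  rw [cst, tauInv, Trivialization.symmL_apply _ (mem_baseSet_PB hu), tau,
    Trivialization.continuousLinearMapAt_apply,
    Trivialization.coe_linearMapAt_of_mem _ (mem_baseSet_PB (mem_dom_self c))]
  rfl

lemma rep_ext {c : TangentBundle (𝓡 n) M} (v : PB n M c) {p} (hp : p ∈ cdom c) :
    rep c (ext v) p = tau c c v := by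
  rw [rep, ext_eq_cst (crdInv_mem_dom hp)]
  exact tau_tauInv (crdInv_mem_dom hp) _

lemma smoothAt_ext {c : TangentBundle (𝓡 n) M} (v : PB n M c) : SmoothAt (ext v) c :=
  FiberBundle.contMDiffAt_extend (𝓡 n).tangent _ v

lemma smoothAt_cst {c u : TangentBundle (𝓡 n) M} (hu : u ∈ dom c) (hs : u ∈ slit n M)
    (v : EuclideanSpace ℝ (Fin n)) : SmoothAt (cst c v) u := by
  rw [smoothAt_iff hu hs]
  refine (contDiffAt_const (c := v)).congr_of_eventuallyEq ?_
  filter_upwards [(isOpen_cdom c).mem_nhds (crd_mem_cdom hu hs)] with q hq using rep_cst hq v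

lemma SmoothAt.diffAt {σ : PiField n M} {u : TangentBundle (𝓡 n) M} (h : SmoothAt σ u) :
    DiffAt σ u := h.mdifferentiableAt (by simp)

lemma SmoothOn.smoothAt {σ : PiField n M} {U : Set (TangentBundle (𝓡 n) M)} (h : SmoothOn σ U)
    (hU : IsOpen U) {u} (hu : u ∈ U) : SmoothAt σ u := (h u hu).contMDiffAt (hU.mem_nhds hu)

lemma ext_self {c : TangentBundle (𝓡 n) M} (v : PB n M c) : ext v c = v :=
  FiberBundle.extend_apply_self _ _

lemma smoothOn_cst (c : TangentBundle (𝓡 n) M) (v : EuclideanSpace ℝ (Fin n)) :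
    SmoothOn (cst c v) (dom c ∩ slit n M) :=
  fun _ hu ↦ (smoothAt_cst hu.1 hu.2 v).contMDiffWithinAt

/-- The coordinate derivative on the chart at `c`. -/
def flatConn (c : TangentBundle (𝓡 n) M) : Conn n M := fun σ u ↦
  (tauInv c u).comp ((fderiv ℝ (rep c σ) (crd c u)).comp (dcrd c u))

lemma flatConn_isCovariantDerivativeOn (c : TangentBundle (𝓡 n) M) :
    IsCovariantDerivativeOn (I := (𝓡 n).tangent) (EuclideanSpace ℝ (Fin n)) (flatConn c)
      (dom c ∩ slit n M) where
  add {σ σ' u} hσ hσ' hu := by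
    have h1 := (diffAt_iff hu.1 hu.2 σ).1 hσ
    have h2 := (diffAt_iff hu.1 hu.2 σ').1 hσ'
    have h3 : rep c (σ + σ') = rep c σ + rep c σ' := by
      funext p; exact map_add (tau c _) _ _
    ext X
    simp only [flatConn, h3, fderiv_add h1 h2, ContinuousLinearMap.comp_apply, add_apply, map_add]
  leibniz {σ g u} hσ hg hu := by
    have h1 := (diffAt_iff hu.1 hu.2 σ).1 hσ
    have h2 := (mdifferentiableAt_iff_crd hu.1 hu.2 g).1 hg
    have h3 : rep c (g • σ) = fun p ↦ g (crdInv c p) • rep c σ p := by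
      funext p; exact map_smul (tau c _) _ _
    ext X
    simp only [flatConn, h3, fderiv_fun_smul h2 h1, ContinuousLinearMap.comp_apply, add_apply,
      map_add, smul_apply, map_smul, crdInv_crd hu.1, ContinuousLinearMap.smulRight_apply,
      mvfderiv_crd hu.1 hu.2 hg, rep_crd hu.1, tauInv_tau hu.1]

/-- The coordinate components of `D s` for a frame field `s` of the chart at `c`. -/
def cformAux (c : TangentBundle (𝓡 n) M) (D : Conn n M) (i : Fin n)
    (p : EuclideanSpace ℝ (Fin n) × EuclideanSpace ℝ (Fin n)) :
    EuclideanSpace ℝ (Fin n) × EuclideanSpace ℝ (Fin n) →L[ℝ] EuclideanSpace ℝ (Fin n) :=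
  (tau c (crdInv c p)).comp ((D (cst c (EuclideanSpace.single i 1)) (crdInv c p)).comp
    (dcrdInv c (crdInv c p)))

lemma cformAux_crd {c u : TangentBundle (𝓡 n) M} (hu : u ∈ dom c) (D : Conn n M) (i : Fin n)
    (X : TangentSpace (𝓡 n).tangent u) : cformAux c D i (crd c u) (dcrd c u X) =
      tau c u (D (cst c (EuclideanSpace.single i 1)) u X) := by
  rw [cformAux, crdInv_crd hu, ContinuousLinearMap.comp_apply, ContinuousLinearMap.comp_apply,
    dcrdInv_dcrd hu]

/-- The connection form of `D` in the chart at `c`. -/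
def cform (c : TangentBundle (𝓡 n) M) (D : Conn n M)
    (p : EuclideanSpace ℝ (Fin n) × EuclideanSpace ℝ (Fin n)) :
    EuclideanSpace ℝ (Fin n) →L[ℝ]
      EuclideanSpace ℝ (Fin n) × EuclideanSpace ℝ (Fin n) →L[ℝ] EuclideanSpace ℝ (Fin n) :=
  ∑ i, (EuclideanSpace.proj i : EuclideanSpace ℝ (Fin n) →L[ℝ] ℝ).smulRight (cformAux c D i p)

lemma cform_apply (c : TangentBundle (𝓡 n) M) (D : Conn n M)
    (p : EuclideanSpace ℝ (Fin n) × EuclideanSpace ℝ (Fin n)) (v : EuclideanSpace ℝ (Fin n)) (X) :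
    cform c D p v X = ∑ i, v i • cformAux c D i p X := by
  simp [cform]

lemma sum_single (v : EuclideanSpace ℝ (Fin n)) :
    ∑ i, v i • (EuclideanSpace.single i (1 : ℝ) : EuclideanSpace ℝ (Fin n)) = v := by
  ext j
  simp [Pi.single_apply]

/-- The difference of two covariant derivatives is tensorial. Comparing `D` with the coordinate
derivative `flatConn c` gives `D = d + Γ`, with `Γ` read off from the frame fields. The coordinate
computations below rest on this formula. -/
lemma tau_cov {D : Conn n M} (hD : IsCovariantDerivativeOn (I := (𝓡 n).tangent)
    (EuclideanSpace ℝ (Fin n)) D (slit n M))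
    {c u : TangentBundle (𝓡 n) M} (hu : u ∈ dom c) (hs : u ∈ slit n M)
    {σ : PiField n M} (hσ : DiffAt σ u) (X : TangentSpace (𝓡 n).tangent u) :
    tau c u (D σ u X) = fderiv ℝ (rep c σ) (crd c u) (dcrd c u X) +
      cform c D (crd c u) (tau c u (σ u)) (dcrd c u X) := by
  have hcov := hD.mono (Set.inter_subset_right : dom c ∩ slit n M ⊆ _)
  have hflat := flatConn_isCovariantDerivativeOn c
  have hmem : u ∈ dom c ∩ slit n M := ⟨hu, hs⟩
  set Δ := IsCovariantDerivativeOn.difference hcov hflat u with hΔ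
  have h1 := IsCovariantDerivativeOn.difference_apply hcov hflat hmem hσ
  -- `flatConn c` kills fields with constant components, so on them the difference is `D` itself.
  have h2 : ∀ v, Δ (tauInv c u v) = D (cst c v) u := fun v ↦ by
    refine (IsCovariantDerivativeOn.difference_apply hcov hflat hmem
      (smoothAt_cst hu hs v).diffAt).trans ?_
    have h3 : rep c (cst c v) =ᶠ[nhds (crd c u)] fun _ ↦ v := by
      filter_upwards [(isOpen_cdom c).mem_nhds (crd_mem_cdom hu hs)] with q hq using rep_cst hq v
    have h4 : flatConn c (cst c v) u = 0 := by
      rw [flatConn, h3.fderiv_eq, fderiv_const_apply, ContinuousLinearMap.zero_comp,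
        ContinuousLinearMap.comp_zero]
    rw [h4, sub_zero]
  have h5 : D σ u = Δ (σ u) + flatConn c σ u := by rw [hΔ, h1]; abel
  have h6 : Δ (σ u) = ∑ i, (tau c u (σ u)) i • D (cst c (EuclideanSpace.single i 1)) u := by
    conv_lhs => rw [← tauInv_tau hu (σ u), ← sum_single (tau c u (σ u))]
    simp only [map_sum, map_smul, h2]
  rw [h5, h6, cform_apply]
  simp only [add_apply, map_add, sum_apply, smul_apply, map_sum, map_smul, flatConn,
    ContinuousLinearMap.comp_apply, tau_tauInv hu, cformAux_crd hu]
  rw [add_comm]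

/-- For a frame field `s`, `D s` is a smooth section of the bundle of homomorphisms from `T(TM)` to
`π⁻¹(TM)`; the induced trivialization conjugates it by `tau` and `dcrdInv`. -/
lemma contDiffOn_cformAux {D : Conn n M} (hD : ∀ U : Set (TangentBundle (𝓡 n) M), IsOpen U →
      U ⊆ slit n M →
      ContMDiffCovariantDerivativeOn (I := (𝓡 n).tangent) (EuclideanSpace ℝ (Fin n)) ∞ D U)
    (c : TangentBundle (𝓡 n) M) (i : Fin n) : ContDiffOn ℝ ∞ (cformAux c D i) (cdom c) := by
  intro p hp
  have hu := crdInv_mem_dom hp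
  have hs := crdInv_mem_slit hp
  have hU : IsOpen (dom c ∩ slit n M) := (isOpen_dom c).inter isOpen_slit
  have h1 := (hD _ hU Set.inter_subset_right).contMDiff
    (σ := cst c (EuclideanSpace.single i 1)) (by exact smoothOn_cst c _)
  have h2 := (h1 _ ⟨hu, hs⟩).contMDiffAt (hU.mem_nhds ⟨hu, hs⟩)
  have h3 := ((trivializationAt (EuclideanSpace ℝ (Fin n) × EuclideanSpace ℝ (Fin n) →L[ℝ]
    EuclideanSpace ℝ (Fin n)) (fun u : TangentBundle (𝓡 n) M ↦
      TangentSpace (𝓡 n).tangent u →L[ℝ] PB n M u) c).contMDiffAt_section_iff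
    (IB := (𝓡 n).tangent) (n := ∞) (s := D (cst c (EuclideanSpace.single i 1)))
    (x₀ := crdInv c p) (by
      rw [hom_trivializationAt_baseSet]
      exact ⟨mem_baseSet_TTM hu, mem_baseSet_PB hu⟩)).1 h2
  have h4 := (contMDiffAt_iff_crd hu hs _).1 h3
  rw [crd_crdInv hp] at h4
  exact h4.contDiffWithinAt

lemma contDiffOn_cform {D : Conn n M} (hD : ∀ U : Set (TangentBundle (𝓡 n) M), IsOpen U →
      U ⊆ slit n M →
      ContMDiffCovariantDerivativeOn (I := (𝓡 n).tangent) (EuclideanSpace ℝ (Fin n)) ∞ D U)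
    (c : TangentBundle (𝓡 n) M) : ContDiffOn ℝ ∞ (cform c D) (cdom c) := by
  refine ContDiffOn.sum fun i _ ↦ ?_
  exact contDiffOn_const.smulRight (contDiffOn_cformAux hD c i)

/-! ### The metric in coordinates -/

/-- Dilation of tangent vectors. -/
def dilT (t : ℝ) (u : TangentBundle (𝓡 n) M) : TangentBundle (𝓡 n) M := ⟨u.proj, t • u.snd⟩

lemma dilT_mem_dom {c u : TangentBundle (𝓡 n) M} (hu : u ∈ dom c) (t : ℝ) : dilT t u ∈ dom c :=
  mem_dom_iff.2 (mem_dom_iff.1 hu)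

lemma crd_mk {c u : TangentBundle (𝓡 n) M} (hu : u ∈ dom c) (v : PB n M u) :
    crd c (⟨u.proj, v⟩ : TangentBundle (𝓡 n) M) = ((crd c u).1, tau c u v) :=
  Prod.ext ((crd_fst c _).trans (crd_fst c u).symm) (tau_apply hu v).symm

lemma crd_dilT {c u : TangentBundle (𝓡 n) M} (hu : u ∈ dom c) (t : ℝ) :
    crd c (dilT t u) = dil t (crd c u) := by
  have h := crd_mk hu (t • eta n M u)
  rw [map_smul, ← crd_snd hu] at h
  exact h

lemma dil_mem_cdom {c : TangentBundle (𝓡 n) M} {t : ℝ} (ht : t ≠ 0) {p} (hp : p ∈ cdom c) :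
    dil t p ∈ cdom c := by
  refine ⟨?_, smul_ne_zero ht hp.2⟩
  have h := crd_dilT (crdInv_mem_dom hp) t
  rw [crd_crdInv hp] at h
  rw [← h]
  exact (extChartAt (𝓡 n).tangent c).map_source (dilT_mem_dom (crdInv_mem_dom hp) t)

lemma crdInv_dil {c : TangentBundle (𝓡 n) M} (t : ℝ) {p} (hp : p ∈ cdom c) :
    crdInv c (dil t p) = dilT t (crdInv c p) := by
  have h := crd_dilT (crdInv_mem_dom hp) t
  rw [crd_crdInv hp] at h
  rw [← h, crdInv_crd (dilT_mem_dom (crdInv_mem_dom hp) t)]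

omit [IsManifold (𝓡 n) ∞ M] in
lemma dilT_mem_slit {u : TangentBundle (𝓡 n) M} (hs : u ∈ slit n M) {t : ℝ} (ht : t ≠ 0) :
    dilT t u ∈ slit n M := smul_ne_zero ht hs

lemma tau_dilT {c u : TangentBundle (𝓡 n) M} (hu : u ∈ dom c) (t : ℝ) (v : PB n M u) :
    tau c (dilT t u) v = tau c u v := by
  rw [tau_apply hu]
  exact tau_apply (dilT_mem_dom hu t) v

/-- A vector of the fibre of `π⁻¹(TM)` over `u`, as a point of `TM`. -/
def mkT (u : TangentBundle (𝓡 n) M) (v : PB n M u) : TangentBundle (𝓡 n) M := ⟨u.proj, v⟩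

/-- The energy in the chart at `c`. -/
def energy (c : TangentBundle (𝓡 n) M) (L : TangentBundle (𝓡 n) M → ℝ)
    (p : EuclideanSpace ℝ (Fin n) × EuclideanSpace ℝ (Fin n)) : ℝ :=
  (1 / 2 : ℝ) * L (crdInv c p) ^ 2

/-- The metric in the chart at `c`. -/
def gform (c : TangentBundle (𝓡 n) M) (L : TangentBundle (𝓡 n) M → ℝ) :
    EuclideanSpace ℝ (Fin n) × EuclideanSpace ℝ (Fin n) →
    EuclideanSpace ℝ (Fin n) →L[ℝ] EuclideanSpace ℝ (Fin n) →L[ℝ] ℝ :=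
  fibreHessian (energy c L)

section

variable {L : TangentBundle (𝓡 n) M → ℝ} (hL : IsFinsler L) (c : TangentBundle (𝓡 n) M)
include hL

lemma contDiffOn_energy : ContDiffOn ℝ ∞ (energy c L) (cdom c) := by
  intro p hp
  have h := (hL.smooth _ (crdInv_mem_slit hp)).contMDiffAt
    (isOpen_slit.mem_nhds (crdInv_mem_slit hp))
  have h1 := (contMDiffAt_iff_crd (crdInv_mem_dom hp) (crdInv_mem_slit hp) L).1 h
  rw [crd_crdInv hp] at h1
  exact (contDiffAt_const.mul (h1.pow 2)).contDiffWithinAt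

lemma energy_dil (t : ℝ) (ht : 0 < t) (p) (hp : p ∈ cdom c) :
    energy c L (dil t p) = t ^ 2 * energy c L p := by
  have h := hL.homogeneous (crdInv c p).proj (crdInv c p).snd t ht
  have h2 : L (dilT t (crdInv c p)) = t * L (crdInv c p) := h
  rw [energy, energy, crdInv_dil t hp, h2]
  ring

/-- Fibre translations are affine in the chart, so the iterated derivative defining the metric is
that of `energy` along vertical lines. -/
lemma metric_crd {u : TangentBundle (𝓡 n) M} {c : TangentBundle (𝓡 n) M} (hu : u ∈ dom c)
    (hs : u ∈ slit n M) (v w : PB n M u) :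
    metric L u v w = gform c L (crd c u) (tau c u v) (tau c u w) := by
  refine Eq.trans ?_ (deriv_deriv_eq_fibreHessian (isOpen_cdom c) (contDiffOn_energy hL c)
    (crd_mem_cdom hu hs) _ _)
  have h1 : ∀ s t : ℝ, (1 / 2 : ℝ) * L (mkT u (eta n M u + s • v + t • w)) ^ 2 =
      energy c L (crd c u + s • ((0 : EuclideanSpace ℝ (Fin n)), tau c u v) +
        t • ((0 : EuclideanSpace ℝ (Fin n)), tau c u w)) := by
    intro s t
    have h2 := crd_mk hu (eta n M u + s • v + t • w)
    rw [map_add, map_add, map_smul, map_smul, ← crd_snd hu] at h2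
    have h3 : crd c u + s • ((0 : EuclideanSpace ℝ (Fin n)), tau c u v) +
        t • ((0 : EuclideanSpace ℝ (Fin n)), tau c u w) =
        crd c (mkT u (eta n M u + s • v + t • w)) := by
      refine Eq.trans ?_ h2.symm
      ext <;> simp
    have h4 : mkT u (eta n M u + s • v + t • w) ∈ dom c := mem_dom_iff.2 (mem_dom_iff.1 hu)
    rw [energy, h3, crdInv_crd h4]
  exact congrArg (fun f : ℝ → ℝ → ℝ ↦ deriv (fun s ↦ deriv (f s) 0) 0)
    (funext fun s ↦ funext fun t ↦ h1 s t)

lemma contDiffOn_gform : ContDiffOn ℝ ∞ (gform c L) (cdom c) :=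
  contDiffOn_fibreHessian (isOpen_cdom c) (contDiffOn_energy hL c)

lemma gform_dil {t : ℝ} (ht : 0 < t) {p} (hp : p ∈ cdom c) :
    gform c L (dil t p) = gform c L p :=
  fibreHessian_dil (isOpen_cdom c) (contDiffOn_energy hL c)
    (fun _ ht _ hq ↦ dil_mem_cdom ht.ne' hq) (energy_dil hL c) ht hp

lemma gform_symm {p} (hp : p ∈ cdom c) (v w) : gform c L p v w = gform c L p w v :=
  fibreHessian_symm (isOpen_cdom c) (contDiffOn_energy hL c) hp v w

lemma gform_pos {p} (hp : p ∈ cdom c) (v) (hv : v ≠ 0) : 0 < gform c L p v v := by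
  have hu := crdInv_mem_dom hp
  have h := hL.posDef _ (crdInv_mem_slit hp) (tauInv c _ v) (fun h0 ↦ hv (by
    rw [← tau_tauInv hu v, h0, map_zero]))
  rwa [metric_crd hL hu (crdInv_mem_slit hp), tau_tauInv hu, crd_crdInv hp] at h

lemma fderiv_gform_radial {p} (hp : p ∈ cdom c) (a v) :
    fderiv ℝ (fun q ↦ gform c L q p.2 v) p (0, a) = 0 :=
  fderiv_fibreHessian_radial (isOpen_cdom c) (contDiffOn_energy hL c)
    (fun _ ht _ hq ↦ dil_mem_cdom ht.ne' hq) (energy_dil hL c) hp a v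

end

/-! ### The horizontal lift -/

lemma rep_eta {c : TangentBundle (𝓡 n) M} {p} (hp : p ∈ cdom c) : rep c (eta n M) p = p.2 := by
  rw [rep, ← crd_snd (crdInv_mem_dom hp), crd_crdInv hp]

lemma smoothAt_eta {u : TangentBundle (𝓡 n) M} (hs : u ∈ slit n M) : SmoothAt (eta n M) u := by
  rw [smoothAt_iff (mem_dom_self u) hs]
  refine contDiffAt_snd.congr_of_eventuallyEq ?_
  filter_upwards [(isOpen_cdom u).mem_nhds (crd_mem_cdom (mem_dom_self u) hs)] with q hq
  exact rep_eta hq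

section Cartan

variable {L : TangentBundle (𝓡 n) M → ℝ} {D : Conn n M} (hD : IsCartan L D)
include hD

/-- `η` has components `y`, so `K = dy + Γ(y)`. -/
lemma tau_connMap {c u : TangentBundle (𝓡 n) M} (hu : u ∈ dom c) (hs : u ∈ slit n M)
    (X : TangentSpace (𝓡 n).tangent u) :
    tau c u (connMap D u X) = (dcrd c u X).2 + cform c D (crd c u) (crd c u).2 (dcrd c u X) := by
  rw [connMap, tau_cov hD.isCovariantDerivative hu hs (smoothAt_eta hs).diffAt, ← crd_snd hu]
  have h : rep c (eta n M) =ᶠ[nhds (crd c u)] Prod.snd := by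
    filter_upwards [(isOpen_cdom c).mem_nhds (crd_mem_cdom hu hs)] with q hq using rep_eta hq
  rw [h.fderiv_eq, fderiv_snd]
  rfl

/-- Regularity splits any vector lying over `v` into a vertical and a horizontal part, and `ρ` does
not see the former. This makes the `Function.invFunOn` in `beta` a true right inverse of `ρ`. -/
lemma exists_horizontal {u : TangentBundle (𝓡 n) M} (hs : u ∈ slit n M) (v : PB n M u) :
    ∃ X ∈ (horizontal D u : Set (TangentSpace (𝓡 n).tangent u)), rho u X = v := by
  have hu := mem_dom_self u
  set X := dcrdInv u u (tau u u v, 0) with hX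
  have hrX : rho u X = v := tau_injective hu (by rw [tau_rho hu, hX, dcrd_dcrdInv hu])
  obtain ⟨a, ha, b, hb, hab⟩ := Submodule.mem_sup.1
    ((hD.regular u hs).sup_eq_top ▸ Submodule.mem_top (x := X))
  refine ⟨b, hb, ?_⟩
  have ha' : rho u a = 0 := ha
  rw [← hrX, ← hab, map_add, ha', zero_add]

lemma rho_beta {u : TangentBundle (𝓡 n) M} (hs : u ∈ slit n M) (v : PB n M u) :
    rho u (beta D u v) = v := (Function.invFunOn_pos (exists_horizontal hD hs v)).2

lemma connMap_beta {u : TangentBundle (𝓡 n) M} (hs : u ∈ slit n M) (v : PB n M u) :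
    connMap D u (beta D u v) = 0 := (Function.invFunOn_pos (exists_horizontal hD hs v)).1

/-- The restriction of the connection map to vertical vectors, in coordinates. -/
def vertConn (c : TangentBundle (𝓡 n) M) (D : Conn n M)
    (p : EuclideanSpace ℝ (Fin n) × EuclideanSpace ℝ (Fin n)) :
    EuclideanSpace ℝ (Fin n) →L[ℝ] EuclideanSpace ℝ (Fin n) :=
  ContinuousLinearMap.id ℝ _ + (cform c D p p.2).comp (ContinuousLinearMap.inr ℝ _ _)

/-- A kernel vector would be both vertical and horizontal; finite dimension does the rest. By
`cform_radial` the map `vertConn` turns out to be the identity, but that uses the torsion of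
horizontal lifts, whose differentiability has to be settled first. -/
lemma exists_vertConn_equiv {c : TangentBundle (𝓡 n) M} {p} (hp : p ∈ cdom c) :
    ∃ e : EuclideanSpace ℝ (Fin n) ≃L[ℝ] EuclideanSpace ℝ (Fin n),
      (e : EuclideanSpace ℝ (Fin n) →L[ℝ] EuclideanSpace ℝ (Fin n)) = vertConn c D p := by
  have hu := crdInv_mem_dom hp
  have hs := crdInv_mem_slit hp
  have hinj : Function.Injective (vertConn c D p) := by
    rw [injective_iff_map_eq_zero]
    intro a ha
    set X := dcrdInv c (crdInv c p) (0, a) with hX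
    have h1 : rho (crdInv c p) X = 0 := tau_injective hu (by
      rw [tau_rho hu, hX, dcrd_dcrdInv hu, map_zero])
    have h2 : connMap D (crdInv c p) X = 0 := tau_injective hu (by
      rw [tau_connMap hD hu hs, hX, dcrd_dcrdInv hu, map_zero, crd_crdInv hp]
      exact ha)
    have h3 : X ∈ vertical (crdInv c p) ⊓ horizontal D (crdInv c p) := ⟨h1, h2⟩
    rw [(hD.regular _ hs).inf_eq_bot] at h3
    have h4 : X = 0 := h3
    have h5 : dcrd c (crdInv c p) X = (0, a) := dcrd_dcrdInv hu _
    rw [h4, map_zero] at h5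
    exact (congrArg Prod.snd h5).symm
  refine ⟨(LinearEquiv.ofInjectiveEndo (vertConn c D p).toLinearMap hinj).toContinuousLinearEquiv,
    ?_⟩
  ext v
  rfl

lemma dcrd_beta_aux {c u : TangentBundle (𝓡 n) M} (hu : u ∈ dom c) (hs : u ∈ slit n M)
    (v : PB n M u) : dcrd c u (beta D u v) = (tau c u v,
      - (vertConn c D (crd c u)).inverse (cform c D (crd c u) (crd c u).2 (tau c u v, 0))) := by
  have h1 : (dcrd c u (beta D u v)).1 = tau c u v := by rw [← tau_rho hu, rho_beta hD hs]
  have h2 := tau_connMap hD hu hs (beta D u v)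
  rw [connMap_beta hD hs, map_zero] at h2
  obtain ⟨e, he⟩ := exists_vertConn_equiv hD (crd_mem_cdom hu hs)
  refine Prod.ext h1 ?_
  rw [← he, ContinuousLinearMap.inverse_equiv]
  change _ = - e.symm _
  rw [← map_neg, ContinuousLinearEquiv.eq_symm_apply, ← ContinuousLinearEquiv.coe_coe, he]
  set Y := dcrd c u (beta D u v) with hY
  have hsplit : Y = (tau c u v, 0) + (0, Y.2) := by
    rw [← h1]; simp
  have h3 : cform c D (crd c u) (crd c u).2 Y = cform c D (crd c u) (crd c u).2 (tau c u v, 0) +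
      cform c D (crd c u) (crd c u).2 (0, Y.2) := by
    conv_lhs => rw [hsplit, map_add]
  rw [h3] at h2
  change Y.2 + cform c D (crd c u) (crd c u).2 (0, Y.2) = _
  rw [eq_neg_iff_add_eq_zero]
  refine Eq.trans ?_ h2.symm
  abel

/-- The only delicate ingredient of the lift is the inverse of `vertConn`, and inversion is smooth
at invertible maps. -/
lemma vDiffAt_hLift {u : TangentBundle (𝓡 n) M} (hs : u ∈ slit n M) {X : PiField n M}
    (hX : DiffAt X u) : VDiffAt (hLift D X) u := by
  have hu := mem_dom_self u
  have hp := crd_mem_cdom hu hs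
  rw [vDiffAt_iff hu hs]
  rw [diffAt_iff hu hs] at hX
  have hev : vrep u (hLift D X) =ᶠ[nhds (crd u u)] fun p ↦ (rep u X p,
      - (vertConn u D p).inverse (cform u D p p.2 (rep u X p, 0))) := by
    filter_upwards [(isOpen_cdom u).mem_nhds hp] with q hq
    have := dcrd_beta_aux hD (crdInv_mem_dom hq) (crdInv_mem_slit hq) (X (crdInv u q))
    rw [crd_crdInv hq] at this
    exact this
  refine DifferentiableAt.congr_of_eventuallyEq ?_ hev
  have hΓ : DifferentiableAt ℝ (cform u D) (crd u u) :=
    ((contDiffOn_cform hD.smooth u).contDiffAt ((isOpen_cdom u).mem_nhds hp)).differentiableAt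
      (by simp)
  have hΓy : DifferentiableAt ℝ (fun p ↦ cform u D p p.2) (crd u u) :=
    hΓ.clm_apply differentiableAt_snd
  have hM : DifferentiableAt ℝ (vertConn u D) (crd u u) :=
    (differentiableAt_const _).add (hΓy.clm_comp (differentiableAt_const _))
  obtain ⟨e, he⟩ := exists_vertConn_equiv hD hp
  have hinv : DifferentiableAt ℝ ContinuousLinearMap.inverse (vertConn u D (crd u u)) := by
    rw [← he]
    exact (contDiffAt_map_inverse (n := ∞) e).differentiableAt (by simp)
  have hMi : DifferentiableAt ℝ (fun p ↦ (vertConn u D p).inverse) (crd u u) :=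
    DifferentiableAt.comp (crd u u) hinv hM
  exact hX.prodMk (hMi.clm_apply (hΓy.clm_apply (hX.prodMk (differentiableAt_const _)))).neg

end Cartan

/-! ### The Cartan connection in coordinates -/

section Cartan

variable {L : TangentBundle (𝓡 n) M → ℝ} {D : Conn n M} (hD : IsCartan L D)

lemma vrep_vLift {c : TangentBundle (𝓡 n) M} (X : PiField n M) {p} (hp : p ∈ cdom c) :
    vrep c (vLift X) p = (0, rep c X p) := dcrd_gam (crdInv_mem_dom hp) _

lemma vDiffAt_vLift {u : TangentBundle (𝓡 n) M} (hs : u ∈ slit n M) {X : PiField n M}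
    (hX : DiffAt X u) : VDiffAt (vLift X) u := by
  have hu := mem_dom_self u
  rw [vDiffAt_iff hu hs]
  rw [diffAt_iff hu hs] at hX
  refine DifferentiableAt.congr_of_eventuallyEq
    ((differentiableAt_const (0 : EuclideanSpace ℝ (Fin n))).prodMk hX) ?_
  filter_upwards [(isOpen_cdom u).mem_nhds (crd_mem_cdom hu hs)] with q hq using vrep_vLift X hq

lemma rep_rho {c : TangentBundle (𝓡 n) M} (X : VField n M) {p} (hp : p ∈ cdom c) :
    rep c (fun u ↦ rho u (X u)) p = (vrep c X p).1 := tau_rho (crdInv_mem_dom hp) _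

lemma diffAt_rho {u : TangentBundle (𝓡 n) M} (hs : u ∈ slit n M) {X : VField n M}
    (hX : VDiffAt X u) : DiffAt (fun u ↦ rho u (X u)) u := by
  have hu := mem_dom_self u
  rw [vDiffAt_iff hu hs] at hX
  rw [diffAt_iff hu hs]
  refine DifferentiableAt.congr_of_eventuallyEq hX.fst ?_
  filter_upwards [(isOpen_cdom u).mem_nhds (crd_mem_cdom hu hs)] with q hq using rep_rho X hq

include hD

/-- The derivatives of the base components cancel against those in `ρ[X, Y]`, leaving terms in `Γ`
only. -/
lemma tau_torsion {c u : TangentBundle (𝓡 n) M} (hu : u ∈ dom c) (hs : u ∈ slit n M)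
    {X Y : VField n M} (hX : VDiffAt X u) (hY : VDiffAt Y u) :
    tau c u (torsion D X Y u) =
      cform c D (crd c u) (dcrd c u (Y u)).1 (dcrd c u (X u)) -
        cform c D (crd c u) (dcrd c u (X u)).1 (dcrd c u (Y u)) := by
  have hp := crd_mem_cdom hu hs
  have hev : ∀ Z : VField n M, rep c (fun u ↦ rho u (Z u)) =ᶠ[nhds (crd c u)]
      fun p ↦ (vrep c Z p).1 := fun Z ↦ by
    filter_upwards [(isOpen_cdom c).mem_nhds hp] with q hq using rep_rho Z hq
  have hfst : ∀ {Z : VField n M}, VDiffAt Z u → ∀ W, fderiv ℝ (fun p ↦ (vrep c Z p).1) (crd c u) W =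
      (fderiv ℝ (vrep c Z) (crd c u) W).1 := fun {Z} hZ W ↦ by
    rw [fderiv.fst ((vDiffAt_iff hu hs Z).1 hZ)]
    rfl
  rw [torsion, map_sub, map_sub, tau_cov hD.isCovariantDerivative hu hs (diffAt_rho hs hY),
    tau_cov hD.isCovariantDerivative hu hs (diffAt_rho hs hX), tau_rho hu, tau_rho hu, tau_rho hu,
    dcrd_mlieBracket hu hs hX hY, (hev X).fderiv_eq, (hev Y).fderiv_eq, hfst hX, hfst hY,
    vrep_crd hu, vrep_crd hu, Prod.fst_sub]
  abel

variable (hL : IsFinsler L)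
include hL

lemma gform_metric {c : TangentBundle (𝓡 n) M} {p} (hp : p ∈ cdom c)
    (X : EuclideanSpace ℝ (Fin n) × EuclideanSpace ℝ (Fin n)) (v w : EuclideanSpace ℝ (Fin n)) :
    fderiv ℝ (fun q ↦ gform c L q v w) p X =
      gform c L p (cform c D p v X) w + gform c L p v (cform c D p w X) := by
  have hu := crdInv_mem_dom hp
  have hs := crdInv_mem_slit hp
  have hU : IsOpen (dom c ∩ slit n M) := (isOpen_dom c).inter isOpen_slit
  have h := hD.metric _ hU Set.inter_subset_right (cst c v) (cst c w) (smoothOn_cst c v)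
    (smoothOn_cst c w) _ ⟨hu, hs⟩ (dcrdInv c _ X)
  have hev : (fun q ↦ metric L (crdInv c q) (cst c v (crdInv c q)) (cst c w (crdInv c q)))
      =ᶠ[nhds p] fun q ↦ gform c L q v w := by
    filter_upwards [(isOpen_cdom c).mem_nhds hp] with q hq
    rw [metric_crd hL (crdInv_mem_dom hq) (crdInv_mem_slit hq), crd_crdInv hq]
    rw [cst, cst, tau_tauInv (crdInv_mem_dom hq), tau_tauInv (crdInv_mem_dom hq)]
  have hd : DifferentiableAt ℝ (fun q ↦ gform c L q v w) p :=
    ((((contDiffOn_gform hL c).contDiffAt ((isOpen_cdom c).mem_nhds hp)).differentiableAt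
      (by simp)).clm_apply (differentiableAt_const _)).clm_apply (differentiableAt_const _)
  have hd' : MDifferentiableAt (𝓡 n).tangent 𝓘(ℝ, ℝ)
      (fun u ↦ metric L u (cst c v u) (cst c w u)) (crdInv c p) := by
    rw [mdifferentiableAt_iff_crd hu hs, crd_crdInv hp]
    exact hd.congr_of_eventuallyEq hev
  have hcov : ∀ v, tau c (crdInv c p) (D (cst c v) (crdInv c p) (dcrdInv c _ X)) =
      cform c D p v X := fun v ↦ by
    rw [tau_cov hD.isCovariantDerivative hu hs (smoothAt_cst hu hs v).diffAt, dcrd_dcrdInv hu,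
      crd_crdInv hp]
    have h3 : rep c (cst c v) =ᶠ[nhds p] fun _ ↦ v := by
      filter_upwards [(isOpen_cdom c).mem_nhds hp] with q hq using rep_cst hq v
    rw [h3.fderiv_eq, fderiv_const_apply, cst, tau_tauInv hu]
    simp
  rw [mvfderiv_crd hu hs hd', crd_crdInv hp, hev.fderiv_eq, dcrd_dcrdInv hu,
    metric_crd hL hu hs, metric_crd hL hu hs, hcov, hcov, crd_crdInv hp, cst, cst,
    tau_tauInv hu, tau_tauInv hu] at h
  exact h

/-- A vertical lift has no base component, so `𝐓(γa, βv)` reduces to `Γ v (0, a)`. -/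
lemma gform_vertical {c : TangentBundle (𝓡 n) M} {p} (hp : p ∈ cdom c)
    (a v w : EuclideanSpace ℝ (Fin n)) :
    gform c L p (cform c D p v (0, a)) w = gform c L p (cform c D p w (0, a)) v := by
  have hu := crdInv_mem_dom hp
  have hs := crdInv_mem_slit hp
  have hU : IsOpen (dom c ∩ slit n M) := (isOpen_dom c).inter isOpen_slit
  have h := hD.hhv_torsion _ hU Set.inter_subset_right (cst c a) (cst c v) (cst c w)
    (smoothOn_cst c a) (smoothOn_cst c v) (smoothOn_cst c w) _ ⟨hu, hs⟩
  have hT : ∀ v, tau c (crdInv c p) (torsion D (vLift (cst c a)) (hLift D (cst c v)) (crdInv c p)) =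
      cform c D p v (0, a) := fun v ↦ by
    rw [tau_torsion hD hu hs (vDiffAt_vLift hs (smoothAt_cst hu hs a).diffAt)
      (vDiffAt_hLift hD hs (smoothAt_cst hu hs v).diffAt), vLift, hLift, dcrd_gam hu,
      ← tau_rho hu, rho_beta hD hs, cst, cst, tau_tauInv hu, tau_tauInv hu, map_zero, crd_crdInv hp]
    simp
  rw [metric_crd hL hu hs, metric_crd hL hu hs, hT, hT, cst, cst, tau_tauInv hu, tau_tauInv hu,
    crd_crdInv hp] at h
  exact h

lemma cform_radial {c : TangentBundle (𝓡 n) M} {p} (hp : p ∈ cdom c)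
    (a : EuclideanSpace ℝ (Fin n)) : cform c D p p.2 (0, a) = 0 :=
  vertical_form_radial (g := gform c L p) (T := fun v w ↦ fderiv ℝ (fun q ↦ gform c L q v w) p)
    (gform_pos hL c hp) (gform_symm hL c hp) (fderiv_gform_radial hL c hp)
    (gform_metric hD hL hp) (gform_vertical hD hL hp) a

/-- With `cform_radial` the equation `K(βv) = 0` is solved without inverting anything: the vertical
component is `-Γ y (v, 0)`. -/
lemma dcrd_beta {c u : TangentBundle (𝓡 n) M} (hu : u ∈ dom c) (hs : u ∈ slit n M)
    (v : PB n M u) :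
    dcrd c u (beta D u v) = horLift (crd c u).2 (cform c D (crd c u)) (tau c u v) := by
  have h1 : (dcrd c u (beta D u v)).1 = tau c u v := by rw [← tau_rho hu, rho_beta hD hs]
  have h2 := tau_connMap hD hu hs (beta D u v)
  rw [connMap_beta hD hs, map_zero] at h2
  set Y := dcrd c u (beta D u v)
  have hsplit : Y = (tau c u v, 0) + (0, Y.2) := by rw [← h1]; simp
  have h3 : cform c D (crd c u) (crd c u).2 Y = cform c D (crd c u) (crd c u).2 (tau c u v, 0) := by
    conv_lhs => rw [hsplit, map_add, cform_radial hD hL (crd_mem_cdom hu hs), add_zero]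
  rw [h3] at h2
  exact Prod.ext h1 (eq_neg_of_add_eq_zero_left h2.symm)

lemma isCartanForm_cform {c : TangentBundle (𝓡 n) M} {p} (hp : p ∈ cdom c) :
    IsCartanForm (gform c L p) (fun v w ↦ fderiv ℝ (fun q ↦ gform c L q v w) p) p.2
      (cform c D p) where
  metric := gform_metric hD hL hp
  vertical := gform_vertical hD hL hp
  horizontal v w := by
    have hu := crdInv_mem_dom hp
    have hs := crdInv_mem_slit hp
    have hU : IsOpen (dom c ∩ slit n M) := (isOpen_dom c).inter isOpen_slit
    have h := hD.hh_torsion _ hU Set.inter_subset_right (cst c v) (cst c w)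
      (smoothOn_cst c v) (smoothOn_cst c w) _ ⟨hu, hs⟩
    have h2 := congrArg (tau c (crdInv c p)) h
    rw [tau_torsion hD hu hs (vDiffAt_hLift hD hs (smoothAt_cst hu hs v).diffAt)
      (vDiffAt_hLift hD hs (smoothAt_cst hu hs w).diffAt), map_zero, hLift, hLift,
      dcrd_beta hD hL hu hs, dcrd_beta hD hL hu hs, cst, cst, tau_tauInv hu, tau_tauInv hu,
      crd_crdInv hp] at h2
    exact sub_eq_zero.1 h2

/-- The connection form of the Cartan connection is invariant under dilations. -/
lemma cform_dil {c : TangentBundle (𝓡 n) M} {t : ℝ} (ht : 0 < t) {p} (hp : p ∈ cdom c)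
    (v : EuclideanSpace ℝ (Fin n)) (X : EuclideanSpace ℝ (Fin n) × EuclideanSpace ℝ (Fin n)) :
    cform c D (dil t p) v (dil t X) = cform c D p v X := by
  have hp' : dil t p ∈ cdom c := dil_mem_cdom ht.ne' hp
  have h1 := isCartanForm_cform hD hL hp'
  set Γ' : EuclideanSpace ℝ (Fin n) →L[ℝ] EuclideanSpace ℝ (Fin n) × EuclideanSpace ℝ (Fin n) →L[ℝ]
    EuclideanSpace ℝ (Fin n) :=
    ((ContinuousLinearMap.compL ℝ _ _ _).flip (dil t)).comp (cform c D (dil t p)) with hΓ'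
  have hap : ∀ v X, Γ' v X = cform c D (dil t p) v (dil t X) := fun v X ↦ rfl
  have hd : ∀ v w, ∀ q ∈ cdom c, DifferentiableAt ℝ (fun q ↦ gform c L q v w) q := fun v w q hq ↦
    ((((contDiffOn_gform hL c).contDiffAt ((isOpen_cdom c).mem_nhds hq)).differentiableAt
      (by simp)).clm_apply (differentiableAt_const _)).clm_apply (differentiableAt_const _)
  have hinr : ∀ a : EuclideanSpace ℝ (Fin n), dil t ((0 : EuclideanSpace ℝ (Fin n)), a) =
      (0, t • a) := fun a ↦ rfl
  have hinl : ∀ a : EuclideanSpace ℝ (Fin n), dil t (a, (0 : EuclideanSpace ℝ (Fin n))) =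
      (a, 0) := fun a ↦ by simp
  -- The form pulled back by `dil t` satisfies at `p` the conditions of the original one: the metric
  -- is dilation invariant, and the horizontal condition at `ty` becomes the one at `y` once the
  -- factor `t` is pulled out by linearity.
  have h2 : IsCartanForm (gform c L p) (fun v w ↦ fderiv ℝ (fun q ↦ gform c L q v w) p) p.2 Γ' := by
    refine ⟨fun X v w ↦ ?_, fun v w ↦ ?_, fun a v w ↦ ?_⟩
    · have e := fderiv_dil (isOpen_cdom c) (c := 1) (t := t) (f := fun q ↦ gform c L q v w)
        (fun q hq ↦ by rw [gform_dil hL c ht hq, one_smul]) hp (hd v w p hp) (hd v w _ hp') X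
      rw [one_smul] at e
      rw [← e, h1.metric, gform_dil hL c ht hp, hap, hap]
    · have e := h1.horizontal v w
      have key : ∀ v, dil t (v, - Γ' p.2 (v, 0)) =
          (v, - cform c D (dil t p) (dil t p).2 (v, 0)) := fun v ↦ by
        rw [hap, hinl, dil_apply, dil_apply, map_smul]
        simp
      refine (hap _ _).trans (Eq.trans ?_ (hap _ _).symm)
      rw [key, key]
      exact e
    · rw [hap, hap, hinr, ← gform_dil hL c ht hp]
      exact h1.vertical _ _ _
  rw [← hap, IsCartanForm.unique (gform_pos hL c hp) (gform_symm hL c hp)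
    (fderiv_gform_radial hL c hp) h2 (isCartanForm_cform hD hL hp)]

/-- Invariance of `Γ` and linearity in `y` give `Γ y (v, 0)` degree one in `y`, which is how `dil t`
scales the vertical component. -/
lemma horLift_dil {c : TangentBundle (𝓡 n) M} {t : ℝ} (ht : 0 < t) {p} (hp : p ∈ cdom c)
    (v : EuclideanSpace ℝ (Fin n)) :
    horLift (dil t p).2 (cform c D (dil t p)) v = dil t (horLift p.2 (cform c D p) v) := by
  have h := cform_dil hD hL ht hp p.2 (v, 0)
  have h1 : dil t (v, (0 : EuclideanSpace ℝ (Fin n))) = (v, 0) := by simp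
  rw [h1] at h
  refine Prod.ext rfl ?_
  change -(cform c D (dil t p) (t • p.2) (v, 0)) = t • -(cform c D p p.2 (v, 0))
  rw [map_smul, smul_apply, h, smul_neg]

/-! ### The curvature in coordinates -/

/-- The horizontal lift in the chart at `c`. -/
def hor (c : TangentBundle (𝓡 n) M) (D : Conn n M)
    (p : EuclideanSpace ℝ (Fin n) × EuclideanSpace ℝ (Fin n)) : EuclideanSpace ℝ (Fin n) →L[ℝ]
      EuclideanSpace ℝ (Fin n) × EuclideanSpace ℝ (Fin n) :=
  horLift p.2 (cform c D p)

omit hL in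
lemma contDiffOn_hor (c : TangentBundle (𝓡 n) M) : ContDiffOn ℝ ∞ (hor c D) (cdom c) := by
  have h := contDiffOn_cform hD.smooth c
  have h2 : ContDiffOn ℝ ∞ (fun p ↦ -((cform c D p) p.2).comp
      (ContinuousLinearMap.inl ℝ (EuclideanSpace ℝ (Fin n)) (EuclideanSpace ℝ (Fin n)))) (cdom c) :=
    ((h.clm_apply contDiffOn_snd).clm_comp contDiffOn_const).neg
  rw [contDiffOn_clm_apply]
  intro v
  exact contDiffOn_const.prodMk (h2.clm_apply contDiffOn_const)

/-- The `h`-curvature in the chart at `c`. -/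
def hform (c : TangentBundle (𝓡 n) M) (D : Conn n M)
    (p : EuclideanSpace ℝ (Fin n) × EuclideanSpace ℝ (Fin n)) (x y z : EuclideanSpace ℝ (Fin n)) :
    EuclideanSpace ℝ (Fin n) :=
  curvForm (cform c D) p (hor c D p x) (hor c D p y) z

omit hL in
lemma contDiffAt_hform {c : TangentBundle (𝓡 n) M} {p} (hp : p ∈ cdom c)
    {x y z : EuclideanSpace ℝ (Fin n) × EuclideanSpace ℝ (Fin n) → EuclideanSpace ℝ (Fin n)}
    (hx : ContDiffAt ℝ ∞ x p) (hy : ContDiffAt ℝ ∞ y p) (hz : ContDiffAt ℝ ∞ z p) :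
    ContDiffAt ℝ ∞ (fun q ↦ hform c D q (x q) (y q) (z q)) p := by
  have hn := (isOpen_cdom c).mem_nhds hp
  have h1 := (contDiffOn_cform hD.smooth c).contDiffAt hn
  have h2 := (contDiffOn_fderiv_fun (isOpen_cdom c) (contDiffOn_cform hD.smooth c)).contDiffAt hn
  have h3 := (contDiffOn_hor hD c).contDiffAt hn
  have hX := h3.clm_apply hx
  have hY := h3.clm_apply hy
  exact ((((h2.clm_apply hX).clm_apply hz).clm_apply hY).neg.add
    (((h2.clm_apply hY).clm_apply hz).clm_apply hX)).sub
    ((h1.clm_apply ((h1.clm_apply hz).clm_apply hY)).clm_apply hX) |>.add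
    ((h1.clm_apply ((h1.clm_apply hz).clm_apply hX)).clm_apply hY)

lemma hform_dil {c : TangentBundle (𝓡 n) M} {t : ℝ} (ht : 0 < t) {p} (hp : p ∈ cdom c)
    (x y z : EuclideanSpace ℝ (Fin n)) : hform c D (dil t p) x y z = hform c D p x y z := by
  rw [hform, hor, horLift_dil hD hL ht hp, horLift_dil hD hL ht hp]
  exact curvForm_dil (isOpen_cdom c)
    (fun q hq ↦ ((contDiffOn_cform hD.smooth c).contDiffAt
      ((isOpen_cdom c).mem_nhds hq)).differentiableAt (by simp))
    (fun q hq ↦ dil_mem_cdom ht.ne' hq) (fun q hq v X ↦ cform_dil hD hL ht hq v X) hp _ _ z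

lemma vrep_hLift {c : TangentBundle (𝓡 n) M} (X : PiField n M) {p} (hp : p ∈ cdom c) :
    vrep c (hLift D X) p = hor c D p (rep c X p) := by
  have h := dcrd_beta hD hL (crdInv_mem_dom hp) (crdInv_mem_slit hp) (X (crdInv c p))
  rw [crd_crdInv hp] at h
  exact h

omit hL in
lemma rep_cov_hLift {c : TangentBundle (𝓡 n) M} {Z : PiField n M} (X : VField n M) {p}
    (hp : p ∈ cdom c) (hZ : DiffAt Z (crdInv c p)) :
    rep c (fun u ↦ D Z u (X u)) p = modelCov (cform c D) (rep c Z) (vrep c X) p := by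
  rw [rep, tau_cov hD.isCovariantDerivative (crdInv_mem_dom hp) (crdInv_mem_slit hp) hZ,
    crd_crdInv hp]
  rfl

/-- With `D = d + Γ` near `u` this is `modelCov_curvature`. Only the values of `X`, `Y`, `Z` at `u`
survive, so the extensions chosen in `hCurv` do not matter. -/
lemma tau_curvature {c u : TangentBundle (𝓡 n) M} (hu : u ∈ dom c) (hs : u ∈ slit n M)
    {X Y Z : PiField n M} (hX : SmoothAt X u) (hY : SmoothAt Y u) (hZ : SmoothAt Z u) :
    tau c u (curvature D (hLift D X) (hLift D Y) Z u) =
      hform c D (crd c u) (tau c u (X u)) (tau c u (Y u)) (tau c u (Z u)) := by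
  have hp := crd_mem_cdom hu hs
  have hn := (isOpen_cdom c).mem_nhds hp
  have hΓ : ContDiffAt ℝ ∞ (cform c D) (crd c u) := (contDiffOn_cform hD.smooth c).contDiffAt hn
  have hz := (smoothAt_iff hu hs Z).1 hZ
  -- The formula for `D Z` is going to be differentiated, so it is needed near `u`. Smoothness at a
  -- point spreads to a neighbourhood at each finite order, and order 1 is enough.
  have hZev : ∀ᶠ q in nhds (crd c u), DiffAt Z (crdInv c q) := by
    have : ∀ᶠ q in nhds (crd c u), ContDiffAt ℝ 1 (rep c Z) q :=
      (hz.of_le (m := 1) (by exact_mod_cast le_top)).eventually (by simp)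
    filter_upwards [this, hn] with q hq1 hq
    rw [diffAt_iff (crdInv_mem_dom hq) (crdInv_mem_slit hq), crd_crdInv hq]
    exact hq1.differentiableAt (by simp)
  have hV : ∀ {X : PiField n M}, SmoothAt X u → VDiffAt (hLift D X) u := fun h ↦
    vDiffAt_hLift hD hs h.diffAt
  have hsm : ∀ {X : PiField n M}, SmoothAt X u → ContDiffAt ℝ ∞ (vrep c (hLift D X)) (crd c u) :=
    fun {X} h ↦ by
      refine ContDiffAt.congr_of_eventuallyEq (f := fun p ↦ hor c D p (rep c X p))
        (((contDiffOn_hor hD c).contDiffAt hn).clm_apply ((smoothAt_iff hu hs X).1 h)) ?_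
      filter_upwards [hn] with q hq using vrep_hLift hD hL X hq
  have hev : ∀ X : PiField n M, rep c (fun u ↦ D Z u (hLift D X u)) =ᶠ[nhds (crd c u)]
      modelCov (cform c D) (rep c Z) (vrep c (hLift D X)) := fun X ↦ by
    filter_upwards [hZev, hn] with q h1 h2 using rep_cov_hLift hD _ h2 h1
  have hmod : ∀ {X : PiField n M}, SmoothAt X u → DifferentiableAt ℝ
      (modelCov (cform c D) (rep c Z) (vrep c (hLift D X))) (crd c u) := fun {X} h ↦
    ((((hz.fderiv_right (m := ∞) (by simp)).clm_apply (hsm h)).add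
      ((hΓ.clm_apply hz).clm_apply (hsm h))).differentiableAt (by simp))
  have hdf : ∀ {X : PiField n M}, SmoothAt X u → DiffAt (fun u ↦ D Z u (hLift D X u)) u :=
    fun {X} h ↦ by
      rw [diffAt_iff hu hs]
      exact (hmod h).congr_of_eventuallyEq (hev X)
  have key : ∀ {X Y : PiField n M}, SmoothAt X u → SmoothAt Y u →
      tau c u (D (fun u ↦ D Z u (hLift D Y u)) u (hLift D X u)) =
        modelCov (cform c D) (modelCov (cform c D) (rep c Z) (vrep c (hLift D Y)))
          (vrep c (hLift D X)) (crd c u) := fun {X Y} h h' ↦ by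
    have e : tau c u (D Z u (hLift D Y u)) =
        modelCov (cform c D) (rep c Z) (vrep c (hLift D Y)) (crd c u) :=
      (rep_crd hu _).symm.trans (hev Y).self_of_nhds
    rw [tau_cov hD.isCovariantDerivative hu hs (hdf h'), (hev Y).fderiv_eq, e,
      ← vrep_crd hu (hLift D X)]
    rfl
  have h := modelCov_curvature (hΓ.differentiableAt (by simp)) hz
    ((hsm hX).differentiableAt (by simp)) ((hsm hY).differentiableAt (by simp))
  rw [← dcrd_mlieBracket hu hs (hV hX) (hV hY), vrep_hLift hD hL X hp, vrep_hLift hD hL Y hp] at h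
  rw [← rep_crd hu X, ← rep_crd hu Y, hform]
  rw [rep_crd hu Z] at h
  rw [← h, curvature, map_add, map_add, map_neg, key hX hY, key hY hX,
    tau_cov hD.isCovariantDerivative hu hs hZ.diffAt]

lemma tau_hCurv {c u : TangentBundle (𝓡 n) M} (hu : u ∈ dom c) (hs : u ∈ slit n M)
    (x : Fin 3 → PB n M u) :
    tau c u (hCurv D u x) = hform c D (crd c u) (tau c u (x 0)) (tau c u (x 1)) (tau c u (x 2)) := by
  have h := tau_curvature hD hL hu hs (smoothAt_ext (x 0)) (smoothAt_ext (x 1)) (smoothAt_ext (x 2))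
  rwa [ext_self, ext_self, ext_self] at h

end Cartan

/-! ### Traces -/

lemma trace_eq_sum (f : EuclideanSpace ℝ (Fin n) →ₗ[ℝ] EuclideanSpace ℝ (Fin n)) :
    LinearMap.trace ℝ (EuclideanSpace ℝ (Fin n)) f = ∑ i, f (EuclideanSpace.single i 1) i := by
  rw [LinearMap.trace_eq_matrix_trace ℝ (EuclideanSpace.basisFun (Fin n) ℝ).toBasis, Matrix.trace]
  refine Finset.sum_congr rfl fun i _ ↦ ?_
  rw [Matrix.diag_apply, LinearMap.toMatrix_apply]
  simp

/-- Basis independence of the trace, in the coordinate form in which `ricci` is written. -/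
lemma sum_conj (e : EuclideanSpace ℝ (Fin n) ≃ₗ[ℝ] EuclideanSpace ℝ (Fin n))
    (f g : EuclideanSpace ℝ (Fin n) →ₗ[ℝ] EuclideanSpace ℝ (Fin n)) (h : ∀ v, g (e v) = e (f v)) :
    ∑ i, f (EuclideanSpace.single i 1) i = ∑ i, g (EuclideanSpace.single i 1) i := by
  rw [← trace_eq_sum, ← trace_eq_sum, ← LinearMap.trace_conj' f e]
  congr 1
  ext1 v
  obtain ⟨w, rfl⟩ := e.surjective v
  simp [LinearEquiv.conj_apply, h]

lemma sum_comp_comm (f g : EuclideanSpace ℝ (Fin n) →ₗ[ℝ] EuclideanSpace ℝ (Fin n)) :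
    ∑ i, f (g (EuclideanSpace.single i 1)) i = ∑ i, g (f (EuclideanSpace.single i 1)) i := by
  have := LinearMap.trace_mul_comm ℝ f g
  rwa [trace_eq_sum, trace_eq_sum] at this

/-- The trace of `b` with respect to `a` does not depend on the basis. -/
lemma sum_inv_mul_congr (e : EuclideanSpace ℝ (Fin n) ≃ₗ[ℝ] EuclideanSpace ℝ (Fin n))
    (a b : LinearMap.BilinForm ℝ (EuclideanSpace ℝ (Fin n))) :
    ∑ i, ∑ j, (Matrix.of fun k l : Fin n ↦ a (e (EuclideanSpace.single k 1))
      (e (EuclideanSpace.single l 1)))⁻¹ i j *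
        b (e (EuclideanSpace.single i 1)) (e (EuclideanSpace.single j 1)) =
    ∑ i, ∑ j, (Matrix.of fun k l : Fin n ↦ a (EuclideanSpace.single k 1)
      (EuclideanSpace.single l 1))⁻¹ i j *
        b (EuclideanSpace.single i 1) (EuclideanSpace.single j 1) := by
  set B := (EuclideanSpace.basisFun (Fin n) ℝ).toBasis with hB
  have hBi : ∀ i, B i = EuclideanSpace.single i 1 := fun i ↦ by simp [hB]
  set P := LinearMap.toMatrix B B e.toLinearMap with hP
  have hdet : IsUnit P.det := by
    rw [hP, LinearMap.det_toMatrix]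
    exact e.isUnit_det'
  -- Gram matrices change by `c ↦ PᵀcP`, so in the trace of `a⁻¹bᵀ` the factors `P` cancel
  -- cyclically.
  have key : ∀ c : LinearMap.BilinForm ℝ (EuclideanSpace ℝ (Fin n)),
      (Matrix.of fun k l : Fin n ↦ c (e (EuclideanSpace.single k 1))
        (e (EuclideanSpace.single l 1))) =
      P.transpose * (Matrix.of fun k l : Fin n ↦ c (EuclideanSpace.single k 1)
        (EuclideanSpace.single l 1)) * P := fun c ↦ by
    have h1 : ∀ c : LinearMap.BilinForm ℝ (EuclideanSpace ℝ (Fin n)),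
        (Matrix.of fun k l : Fin n ↦ c (EuclideanSpace.single k 1) (EuclideanSpace.single l 1)) =
          LinearMap.BilinForm.toMatrix B c := fun c ↦ by
      ext i j
      simp [LinearMap.BilinForm.toMatrix_apply, hBi]
    have h2 := LinearMap.BilinForm.toMatrix_comp B B c e.toLinearMap e.toLinearMap
    rw [← h1, ← h1] at h2
    exact h2
  have htr : ∀ a b : Matrix (Fin n) (Fin n) ℝ, ∑ i, ∑ j, a⁻¹ i j * b i j =
      (a⁻¹ * b.transpose).trace := fun a b ↦ by
    simp [Matrix.trace, Matrix.mul_apply]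
  have e1 := htr (Matrix.of fun k l : Fin n ↦ a (e (EuclideanSpace.single k 1))
        (e (EuclideanSpace.single l 1))) (Matrix.of fun k l : Fin n ↦ b (e (EuclideanSpace.single k 1))
        (e (EuclideanSpace.single l 1)))
  have e2 := htr (Matrix.of fun k l : Fin n ↦ a (EuclideanSpace.single k 1)
        (EuclideanSpace.single l 1)) (Matrix.of fun k l : Fin n ↦ b (EuclideanSpace.single k 1)
        (EuclideanSpace.single l 1))
  refine e1.trans (Eq.trans ?_ e2.symm)
  rw [key a, key b]
  set a' := Matrix.of fun k l : Fin n ↦ a (EuclideanSpace.single k 1) (EuclideanSpace.single l 1)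
  set b' := Matrix.of fun k l : Fin n ↦ b (EuclideanSpace.single k 1) (EuclideanSpace.single l 1)
  have hdt : IsUnit P.transpose.det := by rwa [Matrix.det_transpose]
  rw [Matrix.mul_inv_rev, Matrix.mul_inv_rev, Matrix.transpose_mul, Matrix.transpose_mul,
    Matrix.transpose_transpose, Matrix.mul_assoc, Matrix.mul_assoc, ← Matrix.mul_assoc _ P.transpose,
    Matrix.nonsing_inv_mul _ hdt, Matrix.one_mul, Matrix.trace_mul_comm, Matrix.mul_assoc,
    Matrix.mul_assoc, Matrix.mul_nonsing_inv _ hdet, Matrix.mul_one]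

lemma contDiffAt_det {H : Type*} [NormedAddCommGroup H] [NormedSpace ℝ H] {p : H}
    {a : H → Matrix (Fin n) (Fin n) ℝ} (h : ∀ i j, ContDiffAt ℝ ∞ (fun q ↦ a q i j) p) :
    ContDiffAt ℝ ∞ (fun q ↦ (a q).det) p := by
  simp only [Matrix.det_apply']
  exact ContDiffAt.sum fun σ _ ↦ contDiffAt_const.mul (contDiffAt_prod fun i _ ↦ h _ _)

/-- Cramer's rule: the entries of the inverse are quotients of determinants, which are polynomial in
the entries. -/
lemma contDiffAt_matrix_inv {H : Type*} [NormedAddCommGroup H] [NormedSpace ℝ H] {p : H}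
    {a : H → Matrix (Fin n) (Fin n) ℝ} (h : ∀ i j, ContDiffAt ℝ ∞ (fun q ↦ a q i j) p)
    (h0 : (a p).det ≠ 0) (i j : Fin n) : ContDiffAt ℝ ∞ (fun q ↦ (a q)⁻¹ i j) p := by
  simp only [Matrix.inv_def, Ring.inverse_eq_inv', Matrix.smul_apply, Matrix.adjugate_apply,
    smul_eq_mul]
  refine ((contDiffAt_det h).inv h0).mul (contDiffAt_det fun k l ↦ ?_)
  -- The adjugate replaces row `j` by a constant unit vector and leaves the other rows alone.
  rcases eq_or_ne k j with rfl | hk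
  · simpa using contDiffAt_const
  · simpa [Matrix.updateRow_ne hk] using h k l

/-! ### The curvature form -/

section CurvForm

variable {V : Type*} [NormedAddCommGroup V] [NormedSpace ℝ V]
  (Γ : V × V → V →L[ℝ] V × V →L[ℝ] V) (p X X' Y Y' : V × V) (z z' : V) (t : ℝ)

set_option synthInstance.maxHeartbeats 100000 in
lemma curvForm_add_left : curvForm Γ p (X + X') Y z = curvForm Γ p X Y z + curvForm Γ p X' Y z := by
  simp only [curvForm, map_add, add_apply, neg_add]
  abel

set_option synthInstance.maxHeartbeats 100000 in
lemma curvForm_smul_left : curvForm Γ p (t • X) Y z = t • curvForm Γ p X Y z := by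
  simp only [curvForm, map_smul, smul_apply, smul_add, smul_sub, smul_neg]

lemma curvForm_swap : curvForm Γ p X Y z = - curvForm Γ p Y X z := by
  simp only [curvForm]
  abel

lemma curvForm_add_right : curvForm Γ p X Y (z + z') = curvForm Γ p X Y z + curvForm Γ p X Y z' := by
  simp only [curvForm, map_add, add_apply, neg_add]
  abel

lemma curvForm_smul_right : curvForm Γ p X Y (t • z) = t • curvForm Γ p X Y z := by
  simp only [curvForm, map_smul, smul_apply, smul_add, smul_sub, smul_neg]

end CurvForm

section

variable (c : TangentBundle (𝓡 n) M) (D : Conn n M)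
  (p : EuclideanSpace ℝ (Fin n) × EuclideanSpace ℝ (Fin n))

/-- The `h`-curvature as a linear map of its first argument. -/
def hform₁ (y z : EuclideanSpace ℝ (Fin n)) : EuclideanSpace ℝ (Fin n) →ₗ[ℝ]
    EuclideanSpace ℝ (Fin n) where
  toFun x := hform c D p x y z
  map_add' x x' := by rw [hform, map_add, curvForm_add_left]; rfl
  map_smul' t x := by rw [hform, map_smul, curvForm_smul_left]; rfl

/-- The `h`-curvature as a linear map of its second argument. -/
def hform₂ (x z : EuclideanSpace ℝ (Fin n)) : EuclideanSpace ℝ (Fin n) →ₗ[ℝ]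
    EuclideanSpace ℝ (Fin n) where
  toFun y := hform c D p x y z
  map_add' y y' := by
    rw [hform, map_add, curvForm_swap, curvForm_add_left, neg_add, ← curvForm_swap, ← curvForm_swap]
    rfl
  map_smul' t y := by
    rw [hform, map_smul, curvForm_swap, curvForm_smul_left, ← smul_neg, ← curvForm_swap]
    rfl

/-- The `h`-curvature as a linear map of its third argument. -/
def hform₃ (x y : EuclideanSpace ℝ (Fin n)) : EuclideanSpace ℝ (Fin n) →L[ℝ]
    EuclideanSpace ℝ (Fin n) :=
  LinearMap.toContinuousLinearMap
  { toFun := hform c D p x y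
    map_add' _ _ := curvForm_add_right _ _ _ _ _ _
    map_smul' _ _ := curvForm_smul_right _ _ _ _ _ _ }

lemma hform₁_apply (x y z) : hform₁ c D p y z x = hform c D p x y z := rfl

lemma hform₂_apply (x y z) : hform₂ c D p x z y = hform c D p x y z := rfl

lemma hform₃_apply (x y z) : hform₃ c D p x y z = hform c D p x y z := rfl

/-- The horizontal Ricci tensor in the chart at `c`. -/
def ricForm : LinearMap.BilinForm ℝ (EuclideanSpace ℝ (Fin n)) :=
  LinearMap.mk₂ ℝ (fun x z ↦ ∑ i, hform c D p x (EuclideanSpace.single i 1) z i)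
    (fun x x' z ↦ by
      simp only [← hform₁_apply, map_add, PiLp.add_apply, Finset.sum_add_distrib])
    (fun t x z ↦ by
      simp only [← hform₁_apply, map_smul, PiLp.smul_apply, Finset.smul_sum])
    (fun x z z' ↦ by
      simp only [← hform₃_apply, map_add, PiLp.add_apply, Finset.sum_add_distrib])
    (fun t x z ↦ by
      simp only [← hform₃_apply, map_smul, PiLp.smul_apply, Finset.smul_sum])

lemma ricForm_apply (x z) :
    ricForm c D p x z = ∑ i, hform c D p x (EuclideanSpace.single i 1) z i := rfl

/-- The horizontal scalar curvature in the chart at `c`. -/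
def scalForm (L : TangentBundle (𝓡 n) M → ℝ) : ℝ :=
  ∑ i, ∑ j, (Matrix.of fun k l : Fin n ↦ gform c L p (EuclideanSpace.single k 1)
    (EuclideanSpace.single l 1))⁻¹ i j *
      ricForm c D p (EuclideanSpace.single i 1) (EuclideanSpace.single j 1)

end

/-- The components of a vector in the chart at `c`, as a linear equivalence. -/
def tauEquiv {c u : TangentBundle (𝓡 n) M} (hu : u ∈ dom c) :
    EuclideanSpace ℝ (Fin n) ≃ₗ[ℝ] EuclideanSpace ℝ (Fin n) :=
  LinearEquiv.ofInjectiveEndo (tau c u).toLinearMap (tau_injective hu)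

/-! ### Ricci tensor and scalar curvature: smoothness, dilation invariance, coordinate expression -/

section Cartan

variable {L : TangentBundle (𝓡 n) M → ℝ} {D : Conn n M} (hD : IsCartan L D)
  (hL : IsFinsler L)
include hD

lemma contDiffAt_hform₃ {c : TangentBundle (𝓡 n) M} {p} (hp : p ∈ cdom c) (x y) :
    ContDiffAt ℝ ∞ (fun q ↦ hform₃ c D q x y) p := by
  have h : ContDiffOn ℝ ∞ (fun q ↦ hform₃ c D q x y) (cdom c) := by
    rw [contDiffOn_clm_apply]
    exact fun z q hq ↦ (contDiffAt_hform hD hq contDiffAt_const contDiffAt_const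
      contDiffAt_const).contDiffWithinAt
  exact h.contDiffAt ((isOpen_cdom c).mem_nhds hp)

lemma contDiffAt_ricForm {c : TangentBundle (𝓡 n) M} {p} (hp : p ∈ cdom c) (x z) :
    ContDiffAt ℝ ∞ (fun q ↦ ricForm c D q x z) p := by
  simp only [ricForm_apply]
  refine ContDiffAt.sum fun i _ ↦ ?_
  exact (contDiffAt_euclidean.1 (contDiffAt_hform hD hp contDiffAt_const contDiffAt_const
    contDiffAt_const)) i

include hL

-- A kernel vector of the Gram matrix would be a nonzero null vector of `g`.
omit hD in
lemma det_gform_ne_zero {c : TangentBundle (𝓡 n) M} {p} (hp : p ∈ cdom c) :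
    (Matrix.of fun k l : Fin n ↦ gform c L p (EuclideanSpace.single k 1)
      (EuclideanSpace.single l 1)).det ≠ 0 := by
  intro h
  obtain ⟨v, hv, hv0⟩ := Matrix.exists_mulVec_eq_zero_iff.2 h
  set w : EuclideanSpace ℝ (Fin n) := WithLp.toLp 2 v with hw
  have hw0 : w ≠ 0 := fun h0 ↦ hv (by
    funext i
    exact congrArg (fun a : EuclideanSpace ℝ (Fin n) ↦ a i) h0)
  refine (gform_pos hL c hp w hw0).ne' ?_
  have h1 : ∀ k, gform c L p (EuclideanSpace.single k 1) w = 0 := fun k ↦ by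
    have h2 := congrFun hv0 k
    rw [← sum_single w]
    simp only [map_sum, map_smul, smul_eq_mul]
    simpa [Matrix.mulVec, dotProduct, mul_comm] using h2
  have h3 : gform c L p w = ∑ i, w i • gform c L p (EuclideanSpace.single i 1) := by
    conv_lhs => rw [← sum_single w]
    simp only [map_sum, map_smul]
  rw [h3]
  simp only [sum_apply, smul_apply, h1, smul_zero, Finset.sum_const_zero]

lemma contDiffAt_scalForm {c : TangentBundle (𝓡 n) M} {p} (hp : p ∈ cdom c) :
    ContDiffAt ℝ ∞ (fun q ↦ scalForm c D q L) p := by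
  refine ContDiffAt.sum fun i _ ↦ ContDiffAt.sum fun j _ ↦ ContDiffAt.mul ?_
    (contDiffAt_ricForm hD hp _ _)
  refine contDiffAt_matrix_inv (a := fun q ↦ Matrix.of fun k l : Fin n ↦ gform c L q
    (EuclideanSpace.single k 1) (EuclideanSpace.single l 1)) (fun k l ↦ ?_)
    (det_gform_ne_zero hL hp) i j
  exact (((contDiffOn_gform hL c).contDiffAt ((isOpen_cdom c).mem_nhds hp)).clm_apply
    contDiffAt_const).clm_apply contDiffAt_const

lemma scalForm_dil {c : TangentBundle (𝓡 n) M} {t : ℝ} (ht : 0 < t) {p} (hp : p ∈ cdom c) :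
    scalForm c D (dil t p) L = scalForm c D p L := by
  simp only [scalForm, ricForm_apply, gform_dil hL c ht hp, hform_dil hD hL ht hp]

/-- The fibre over `u` is the model space itself, but `basisVec u` need not be the frame of the
chart at `c`. The endomorphisms traced on the two sides are conjugate under `tau c u`. -/
lemma ricci_crd {c u : TangentBundle (𝓡 n) M} (hu : u ∈ dom c) (hs : u ∈ slit n M)
    (x : Fin 2 → PB n M u) :
    ricci D u x = ricForm c D (crd c u) (tau c u (x 0)) (tau c u (x 1)) := by
  rw [ricForm_apply]
  let e := tauEquiv hu
  let g := hform₂ c D (crd c u) (tau c u (x 0)) (tau c u (x 1))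
  have h : ∀ v : EuclideanSpace ℝ (Fin n),
      (show EuclideanSpace ℝ (Fin n) from hCurv D u ![x 0, v, x 1]) = e.symm (g (e v)) := fun v ↦ by
    rw [LinearEquiv.eq_symm_apply]
    exact tau_hCurv hD hL hu hs ![x 0, v, x 1]
  refine Eq.trans (Finset.sum_congr rfl fun i _ ↦ congrArg (fun a : EuclideanSpace ℝ (Fin n) ↦ a i)
    (h (EuclideanSpace.single i 1))) ?_
  exact sum_conj e (e.symm.toLinearMap ∘ₗ g ∘ₗ e.toLinearMap) g fun v ↦ by simp

lemma scalarCurv_crd {c u : TangentBundle (𝓡 n) M} (hu : u ∈ dom c) (hs : u ∈ slit n M) :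
    scalarCurv L D u = scalForm c D (crd c u) L := by
  let a : LinearMap.BilinForm ℝ (EuclideanSpace ℝ (Fin n)) :=
    LinearMap.mk₂ ℝ (fun v w ↦ gform c L (crd c u) v w) (by simp) (by simp) (by simp) (by simp)
  refine Eq.trans ?_ (sum_inv_mul_congr (tauEquiv hu) a (ricForm c D (crd c u)))
  have h1 : (Matrix.of fun k l : Fin n ↦ metric L u (basisVec u k) (basisVec u l)) =
      Matrix.of fun k l : Fin n ↦ a (tauEquiv hu (EuclideanSpace.single k 1))
        (tauEquiv hu (EuclideanSpace.single l 1)) := by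
    ext k l
    exact metric_crd hL hu hs _ _
  rw [scalarCurv, h1]
  refine Finset.sum_congr rfl fun i _ ↦ Finset.sum_congr rfl fun j _ ↦ ?_
  congr 1
  exact ricci_crd hD hL hu hs _

end Cartan

/-! ### Recurrence forms in coordinates -/

/-- A scalar tensor field with smooth, multilinear and dilation invariant components is a
recurrence form as soon as it is nonzero. -/
lemma isRecurrenceForm_of_components {k : ℕ} {A : STensor n M k}
    {F : TangentBundle (𝓡 n) M → EuclideanSpace ℝ (Fin n) × EuclideanSpace ℝ (Fin n) →
      (Fin k → EuclideanSpace ℝ (Fin n)) → ℝ}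
    (hF : ∀ c u, u ∈ dom c → u ∈ slit n M → ∀ x, A u x = F c (crd c u) fun i ↦ tau c u (x i))
    (hadd : ∀ c, ∀ p ∈ cdom c, ∀ x i v w, F c p (Function.update x i (v + w)) =
      F c p (Function.update x i v) + F c p (Function.update x i w))
    (hsmul : ∀ c, ∀ p ∈ cdom c, ∀ x i (t : ℝ) v, F c p (Function.update x i (t • v)) =
      t * F c p (Function.update x i v))
    (hsmooth : ∀ c, ∀ p ∈ cdom c, ∀ x : Fin k → EuclideanSpace ℝ (Fin n) × EuclideanSpace ℝ (Fin n) →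
      EuclideanSpace ℝ (Fin n), (∀ i, ContDiffAt ℝ ∞ (x i) p) →
        ContDiffAt ℝ ∞ (fun q ↦ F c q fun i ↦ x i q) p)
    (hdil : ∀ c, ∀ p ∈ cdom c, ∀ t : ℝ, 0 < t → ∀ x, F c (dil t p) x = F c p x)
    (h0 : A.NonZero) : IsRecurrenceForm A where
  map_add u hs x i v w := by
    have hu := mem_dom_self u
    have hup : ∀ v : PB n M u, (fun j ↦ tau u u (Function.update x i v j)) =
        Function.update (fun j ↦ tau u u (x j)) i (tau u u v) := fun v ↦ by
      funext j
      rcases eq_or_ne j i with rfl | h <;> simp [*]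
    rw [hF u u hu hs, hF u u hu hs, hF u u hu hs, hup, hup, hup, map_add,
      hadd u _ (crd_mem_cdom hu hs)]
  map_smul u hs x i t v := by
    have hu := mem_dom_self u
    have hup : ∀ v : PB n M u, (fun j ↦ tau u u (Function.update x i v j)) =
        Function.update (fun j ↦ tau u u (x j)) i (tau u u v) := fun v ↦ by
      funext j
      rcases eq_or_ne j i with rfl | h <;> simp [*]
    rw [hF u u hu hs, hF u u hu hs, hup, hup, map_smul, hsmul u _ (crd_mem_cdom hu hs)]
  smooth U hU hUs X hX u huU := by
    have hu := mem_dom_self u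
    have hs := hUs huU
    refine ContMDiffAt.contMDiffWithinAt ?_
    rw [contMDiffAt_iff_crd hu hs]
    refine (hsmooth u _ (crd_mem_cdom hu hs) (fun i ↦ rep u (X i)) fun i ↦
      (smoothAt_iff hu hs _).1 ((hX i).smoothAt hU huU)).congr_of_eventuallyEq ?_
    filter_upwards [(isOpen_cdom u).mem_nhds (crd_mem_cdom hu hs)] with q hq
    rw [hF u _ (crdInv_mem_dom hq) (crdInv_mem_slit hq), crd_crdInv hq]
    rfl
  homogeneous y v hv t ht x := by
    obtain ⟨u, hu'⟩ : ∃ u : TangentBundle (𝓡 n) M, u = ⟨y, v⟩ := ⟨_, rfl⟩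
    have hu := mem_dom_self u
    have hs : u ∈ slit n M := by rw [hu']; exact hv
    subst hu'
    -- The dilated point is read in the chart centred at the original one, where vectors keep their
    -- components and the point itself moves by `dil t`. This is one reason why `hF` is required for
    -- all charts around a point.
    have h1 := hF _ (dilT t ⟨y, v⟩) (dilT_mem_dom hu t) (dilT_mem_slit hs ht.ne') x
    rw [crd_dilT hu, hdil _ _ (crd_mem_cdom hu hs) t ht] at h1
    refine h1.trans (Eq.trans ?_ (hF _ _ hu hs x).symm)
    exact congrArg _ (funext fun i ↦ tau_dilT hu t (x i))
  nonZero := h0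

/-- The components of a scalar tensor field of type `(0, 1)` in the chart at `c`. -/
def oneForm (c : TangentBundle (𝓡 n) M) (A : STensor n M 1)
    (p : EuclideanSpace ℝ (Fin n) × EuclideanSpace ℝ (Fin n)) : EuclideanSpace ℝ (Fin n) →L[ℝ] ℝ :=
  ∑ i, A (crdInv c p) (fun _ ↦ cst c (EuclideanSpace.single i 1) (crdInv c p)) •
    (EuclideanSpace.proj i : EuclideanSpace ℝ (Fin n) →L[ℝ] ℝ)

section OneForm

variable {A : STensor n M 1} (hA : IsRecurrenceForm A)
include hA

lemma oneForm_crd {c u : TangentBundle (𝓡 n) M} (hu : u ∈ dom c) (hs : u ∈ slit n M)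
    (x : Fin 1 → PB n M u) : A u x = oneForm c A (crd c u) (tau c u (x 0)) := by
  have hup' : ∀ v w : PB n M u, Function.update (fun _ : Fin 1 ↦ v) 0 w = fun _ ↦ w := fun v w ↦ by
    funext i
    rw [Subsingleton.elim i 0, Function.update_self]
  let f : PB n M u →ₗ[ℝ] ℝ :=
    { toFun v := A u fun _ ↦ v
      map_add' v w := by simpa only [hup'] using hA.map_add u hs (fun _ ↦ 0) 0 v w
      map_smul' t v := by
        simpa only [hup', smul_eq_mul, RingHom.id_apply] using hA.map_smul u hs (fun _ ↦ 0) 0 t v }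
  have hx : A u x = f (x 0) := congrArg (A u) (funext fun i ↦ by rw [Subsingleton.elim i 0])
  have h1 : x 0 = ∑ i, (tau c u (x 0)) i • tauInv c u (EuclideanSpace.single i 1) := by
    conv_lhs => rw [← tauInv_tau hu (x 0), ← sum_single (tau c u (x 0))]
    simp only [map_sum, map_smul]
  rw [hx, oneForm, crdInv_crd hu]
  conv_lhs => rw [h1]
  simp only [map_sum, map_smul, sum_apply, smul_apply, smul_eq_mul]
  refine Finset.sum_congr rfl fun i _ ↦ mul_comm _ _

lemma contDiffOn_oneForm (c : TangentBundle (𝓡 n) M) : ContDiffOn ℝ ∞ (oneForm c A) (cdom c) := by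
  refine ContDiffOn.sum fun i _ ↦ ContDiffOn.fun_smul (fun p hp ↦ ?_) contDiffOn_const
  have hu := crdInv_mem_dom hp
  have hs := crdInv_mem_slit hp
  have hU : IsOpen (dom c ∩ slit n M) := (isOpen_dom c).inter isOpen_slit
  have h := (hA.smooth _ hU Set.inter_subset_right (fun _ ↦ cst c (EuclideanSpace.single i 1))
    (fun _ ↦ smoothOn_cst c _) _ ⟨hu, hs⟩).contMDiffAt (hU.mem_nhds ⟨hu, hs⟩)
  have h1 := (contMDiffAt_iff_crd hu hs _).1 h
  rw [crd_crdInv hp] at h1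
  exact h1.contDiffWithinAt

lemma oneForm_dil {c : TangentBundle (𝓡 n) M} {t : ℝ} (ht : 0 < t) {p} (hp : p ∈ cdom c) :
    oneForm c A (dil t p) = oneForm c A p := by
  ext1 v
  set u := crdInv c p
  have hu : u ∈ dom c := crdInv_mem_dom hp
  have hs : u ∈ slit n M := crdInv_mem_slit hp
  have hcu : crd c u = p := crd_crdInv hp
  have h1 := oneForm_crd hA (dilT_mem_dom hu t) (dilT_mem_slit hs ht.ne') (fun _ ↦ tauInv c u v)
  have h2 := oneForm_crd hA hu hs (fun _ ↦ tauInv c u v)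
  rw [crd_dilT hu, tau_dilT hu, tau_tauInv hu, hcu] at h1
  rw [tau_tauInv hu, hcu] at h2
  rw [← h1, ← h2]
  exact hA.homogeneous _ _ hs t ht _

end OneForm

/-! ### Covariant derivatives in coordinates -/

section Cartan

variable {L : TangentBundle (𝓡 n) M → ℝ} {D : Conn n M} (hD : IsCartan L D)
  (hL : IsFinsler L)
include hD

lemma tau_cov_ext {u : TangentBundle (𝓡 n) M} (hs : u ∈ slit n M) (v : PB n M u)
    (X : TangentSpace (𝓡 n).tangent u) :
    tau u u (D (ext v) u X) = cform u D (crd u u) (tau u u v) (dcrd u u X) := by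
  have hu := mem_dom_self u
  rw [tau_cov hD.isCovariantDerivative hu hs (smoothAt_ext v).diffAt, ext_self]
  have h : rep u (ext v) =ᶠ[nhds (crd u u)] fun _ ↦ tau u u v := by
    filter_upwards [(isOpen_cdom u).mem_nhds (crd_mem_cdom hu hs)] with q hq using rep_ext v hq
  rw [h.fderiv_eq, fderiv_const_apply]
  simp

include hL

lemma dcrd_beta_eq_hor {c u : TangentBundle (𝓡 n) M} (hu : u ∈ dom c) (hs : u ∈ slit n M)
    (v : PB n M u) : dcrd c u (beta D u v) = hor c D (crd c u) (tau c u v) :=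
  dcrd_beta hD hL hu hs v

/-- Holds in every chart around `u`, as `isRecurrenceForm_of_components` requires. There `ext (x 1)`
may have varying components, but their derivative occurs both in the derivative of `A(ext (x 1))`
and in the correction `A(D (ext (x 1)))`, and cancels. -/
lemma nablaS_one {A : STensor n M 1} (hA : IsRecurrenceForm A) {c u : TangentBundle (𝓡 n) M}
    (hu : u ∈ dom c) (hs : u ∈ slit n M) (x : Fin 2 → PB n M u) :
    nablaS D A u x =
      fderiv ℝ (oneForm c A) (crd c u) (hor c D (crd c u) (tau c u (x 0))) (tau c u (x 1)) -
        oneForm c A (crd c u) (cform c D (crd c u) (tau c u (x 1))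
          (hor c D (crd c u) (tau c u (x 0)))) := by
  have hp := crd_mem_cdom hu hs
  have hn := (isOpen_cdom c).mem_nhds hp
  have hev : (fun p ↦ A (crdInv c p) fun i : Fin 1 ↦ ext (x i.succ) (crdInv c p))
      =ᶠ[nhds (crd c u)] fun p ↦ oneForm c A p (rep c (ext (x 1)) p) := by
    filter_upwards [hn] with q hq
    rw [oneForm_crd hA (crdInv_mem_dom hq) (crdInv_mem_slit hq), crd_crdInv hq]
    rfl
  have hσ := smoothAt_ext (x 1)
  have hr : DifferentiableAt ℝ (rep c (ext (x 1))) (crd c u) := (diffAt_iff hu hs _).1 hσ.diffAt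
  have ha : DifferentiableAt ℝ (oneForm c A) (crd c u) :=
    ((contDiffOn_oneForm hA c).contDiffAt hn).differentiableAt (by simp)
  have hd : MDifferentiableAt (𝓡 n).tangent 𝓘(ℝ, ℝ)
      (fun u' ↦ A u' fun i : Fin 1 ↦ ext (x i.succ) u') u := by
    rw [mdifferentiableAt_iff_crd hu hs]
    exact (ha.clm_apply hr).congr_of_eventuallyEq hev
  have h1 := tau_cov hD.isCovariantDerivative hu hs hσ.diffAt (beta D u (x 0))
  rw [ext_self, dcrd_beta_eq_hor hD hL hu hs] at h1
  rw [nablaS, mvfderiv_crd hu hs hd, hev.fderiv_eq, Fin.sum_univ_one, oneForm_crd hA hu hs,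
    dcrd_beta_eq_hor hD hL hu hs, fderiv_clm_apply ha hr, rep_crd hu, ext_self]
  have h2 : tau c u (Function.update (Fin.tail x) 0 (D (ext (x (Fin.succ 0))) u (beta D u (x 0))) 0) =
      tau c u (D (ext (x 1)) u (beta D u (x 0))) := by
    rw [Function.update_self]
    rfl
  rw [h2, h1, map_add, add_apply, ContinuousLinearMap.comp_apply, ContinuousLinearMap.flip_apply]
  ring

lemma nablaScalar_crd {c u : TangentBundle (𝓡 n) M} (hu : u ∈ dom c) (hs : u ∈ slit n M)
    (x : Fin 1 → PB n M u) :
    nablaScalar L D u x = fderiv ℝ (fun p ↦ scalForm c D p L) (crd c u)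
      (hor c D (crd c u) (tau c u (x 0))) := by
  have hp := crd_mem_cdom hu hs
  have hn := (isOpen_cdom c).mem_nhds hp
  have hev : (fun p ↦ scalarCurv L D (crdInv c p)) =ᶠ[nhds (crd c u)]
      fun p ↦ scalForm c D p L := by
    filter_upwards [hn] with q hq
    rw [scalarCurv_crd hD hL (crdInv_mem_dom hq) (crdInv_mem_slit hq), crd_crdInv hq]
  have hd : MDifferentiableAt (𝓡 n).tangent 𝓘(ℝ, ℝ) (scalarCurv L D) u := by
    rw [mdifferentiableAt_iff_crd hu hs]
    exact ((contDiffAt_scalForm hD hL hp).differentiableAt (by simp)).congr_of_eventuallyEq hev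
  rw [nablaScalar, nablaS, Finset.univ_eq_empty, Finset.sum_empty, sub_zero,
    mvfderiv_crd hu hs hd, hev.fderiv_eq, dcrd_beta_eq_hor hD hL hu hs]

/-- In the chart centred at `u` the fields `ext` have constant components, so no derivative of the
arguments occurs. This single chart suffices for pointwise identities such as the recurrence
equations. -/
lemma tau_nablaV {k : ℕ} {T : VTensor n M k} {u : TangentBundle (𝓡 n) M}
    {F : EuclideanSpace ℝ (Fin n) × EuclideanSpace ℝ (Fin n) → (Fin k → EuclideanSpace ℝ (Fin n)) →
      EuclideanSpace ℝ (Fin n)} (hs : u ∈ slit n M)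
    (hT : ∀ u' ∈ dom u, u' ∈ slit n M → ∀ x, tau u u' (T u' x) =
      F (crd u u') fun i ↦ tau u u' (x i)) (x : Fin (k + 1) → PB n M u)
    (hF : DifferentiableAt ℝ (fun q ↦ F q fun i ↦ tau u u (x i.succ)) (crd u u)) :
    tau u u (nablaV D T u x) =
      fderiv ℝ (fun q ↦ F q fun i ↦ tau u u (x i.succ)) (crd u u)
          (hor u D (crd u u) (tau u u (x 0))) +
        cform u D (crd u u) (F (crd u u) fun i ↦ tau u u (x i.succ))
          (hor u D (crd u u) (tau u u (x 0))) -
        ∑ i, F (crd u u) (Function.update (fun i ↦ tau u u (x (Fin.succ i))) i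
          (cform u D (crd u u) (tau u u (x i.succ)) (hor u D (crd u u) (tau u u (x 0))))) := by
  have hu := mem_dom_self u
  have hev : rep u (fun u' ↦ T u' fun i ↦ ext (x i.succ) u') =ᶠ[nhds (crd u u)]
      fun q ↦ F q fun i ↦ tau u u (x i.succ) := by
    filter_upwards [(isOpen_cdom u).mem_nhds (crd_mem_cdom hu hs)] with q hq
    rw [rep, hT _ (crdInv_mem_dom hq) (crdInv_mem_slit hq), crd_crdInv hq]
    exact congrArg _ (funext fun i ↦ rep_ext (x i.succ) hq)
  have hd : DiffAt (fun u' ↦ T u' fun i ↦ ext (x i.succ) u') u := by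
    rw [diffAt_iff hu hs]
    exact hF.congr_of_eventuallyEq hev
  have h1 : tau u u (T u fun i ↦ ext (x i.succ) u) = F (crd u u) fun i ↦ tau u u (x i.succ) := by
    rw [hT u hu hs]
    exact congrArg _ (funext fun i ↦ congrArg _ (ext_self _))
  rw [nablaV, map_sub, tau_cov hD.isCovariantDerivative hu hs hd, hev.fderiv_eq, h1,
    dcrd_beta_eq_hor hD hL hu hs, map_sum]
  congr 1
  refine Finset.sum_congr rfl fun i _ ↦ ?_
  rw [hT u hu hs, ← dcrd_beta_eq_hor hD hL hu hs, ← tau_cov_ext hD hs]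
  congr 1
  funext j
  rcases eq_or_ne j i with rfl | h
  · rw [Function.update_self, Function.update_self]
  · rw [Function.update_of_ne h, Function.update_of_ne h]
    rfl

lemma tau_nablaV_hCurv {u : TangentBundle (𝓡 n) M} (hs : u ∈ slit n M) (w x y z : PB n M u) :
    tau u u (nablaV D (hCurv D) u ![w, x, y, z]) =
      fderiv ℝ (fun q ↦ hform u D q (tau u u x) (tau u u y) (tau u u z)) (crd u u)
          (hor u D (crd u u) (tau u u w)) +
        cform u D (crd u u) (hform u D (crd u u) (tau u u x) (tau u u y) (tau u u z))
          (hor u D (crd u u) (tau u u w)) -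
        (hform u D (crd u u) (cform u D (crd u u) (tau u u x) (hor u D (crd u u) (tau u u w)))
            (tau u u y) (tau u u z) +
          hform u D (crd u u) (tau u u x) (cform u D (crd u u) (tau u u y)
            (hor u D (crd u u) (tau u u w))) (tau u u z) +
          hform u D (crd u u) (tau u u x) (tau u u y) (cform u D (crd u u) (tau u u z)
            (hor u D (crd u u) (tau u u w)))) := by
  have h := tau_nablaV hD hL (F := fun q a ↦ hform u D q (a 0) (a 1) (a 2)) hs
    (fun u' hu' hs' x ↦ tau_hCurv hD hL hu' hs' x) ![w, x, y, z]
    ((contDiffAt_hform hD (crd_mem_cdom (mem_dom_self u) hs) contDiffAt_const contDiffAt_const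
      contDiffAt_const).differentiableAt (by simp))
  rw [Fin.sum_univ_three] at h
  exact h

lemma nablaS_ricci {u : TangentBundle (𝓡 n) M} (hs : u ∈ slit n M) (w x y : PB n M u) :
    nablaS D (ricci D) u ![w, x, y] =
      fderiv ℝ (fun q ↦ ricForm u D q (tau u u x) (tau u u y)) (crd u u)
          (hor u D (crd u u) (tau u u w)) -
        (ricForm u D (crd u u) (cform u D (crd u u) (tau u u x) (hor u D (crd u u) (tau u u w)))
            (tau u u y) +
          ricForm u D (crd u u) (tau u u x) (cform u D (crd u u) (tau u u y)
            (hor u D (crd u u) (tau u u w)))) := by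
  have hu := mem_dom_self u
  have hp := crd_mem_cdom hu hs
  have hev : (fun p ↦ ricci D (crdInv u p) fun i : Fin 2 ↦ ext (![x, y] i) (crdInv u p))
      =ᶠ[nhds (crd u u)] fun q ↦ ricForm u D q (tau u u x) (tau u u y) := by
    filter_upwards [(isOpen_cdom u).mem_nhds hp] with q hq
    rw [ricci_crd hD hL (crdInv_mem_dom hq) (crdInv_mem_slit hq), crd_crdInv hq,
      ← rep_ext x hq, ← rep_ext y hq]
    rfl
  have hd : MDifferentiableAt (𝓡 n).tangent 𝓘(ℝ, ℝ)
      (fun u' ↦ ricci D u' fun i : Fin 2 ↦ ext (![x, y] i) u') u := by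
    rw [mdifferentiableAt_iff_crd hu hs]
    exact ((contDiffAt_ricForm hD hp _ _).differentiableAt (by simp)).congr_of_eventuallyEq hev
  have h1 := mvfderiv_crd hu hs hd (beta D u w)
  rw [hev.fderiv_eq, dcrd_beta_eq_hor hD hL hu hs] at h1
  have h2 := tau_cov_ext hD hs x (beta D u w)
  have h3 := tau_cov_ext hD hs y (beta D u w)
  rw [dcrd_beta_eq_hor hD hL hu hs] at h2 h3
  rw [nablaS, Fin.sum_univ_two, ricci_crd hD hL hu hs, ricci_crd hD hL hu hs]
  refine congrArg₂ (· - ·) h1 (congrArg₂ (· + ·) ?_ ?_)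
  · rw [← h2]; rfl
  · rw [← h3]; rfl

/-- The contraction of `∇ʰR` is `∇ʰRic`. -/
lemma sum_coord_nablaV_hCurv {u : TangentBundle (𝓡 n) M} (hs : u ∈ slit n M) (w x y : PB n M u) :
    ∑ i, coord u (nablaV D (hCurv D) u ![w, x, basisVec u i, y]) i =
      nablaS D (ricci D) u ![w, x, y] := by
  have hu := mem_dom_self u
  have hp := crd_mem_cdom hu hs
  rw [nablaS_ricci hD hL hs]
  set p := crd u u
  set H := hor u D p (tau u u w)
  set a := tau u u x
  set b := tau u u y
  let Γ : EuclideanSpace ℝ (Fin n) →ₗ[ℝ] EuclideanSpace ℝ (Fin n) :=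
    { toFun v := cform u D p v H
      map_add' v v' := by rw [map_add, add_apply]
      map_smul' t v := by rw [map_smul, smul_apply]; rfl }
  have hdf : ∀ y, DifferentiableAt ℝ (fun q ↦ hform₂ u D q a b y) p := fun y ↦
    (contDiffAt_hform hD hp contDiffAt_const contDiffAt_const contDiffAt_const).differentiableAt
      (by simp)
  -- The differentiated curvature is still linear in the slot to be contracted, so it has a trace.
  let F : EuclideanSpace ℝ (Fin n) →ₗ[ℝ] EuclideanSpace ℝ (Fin n) :=
    { toFun v := fderiv ℝ (fun q ↦ hform₂ u D q a b v) p H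
      map_add' v v' := by
        simp only [map_add]
        rw [fderiv_fun_add (hdf v) (hdf v'), add_apply]
      map_smul' t v := by
        simp only [map_smul]
        rw [fderiv_fun_const_smul (hdf v), smul_apply]
        rfl }
  let g : EuclideanSpace ℝ (Fin n) →ₗ[ℝ] EuclideanSpace ℝ (Fin n) :=
    F + Γ ∘ₗ hform₂ u D p a b - (hform₂ u D p (Γ a) b + hform₂ u D p a b ∘ₗ Γ +
      hform₂ u D p a (Γ b))
  let e := tauEquiv hu
  have h : ∀ v : EuclideanSpace ℝ (Fin n), (show EuclideanSpace ℝ (Fin n) from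
      nablaV D (hCurv D) u ![w, x, v, y]) = e.symm (g (e v)) := fun v ↦ by
    rw [LinearEquiv.eq_symm_apply]
    exact tau_nablaV_hCurv hD hL hs w x v y
  refine (Finset.sum_congr rfl fun i _ ↦ congrArg (fun a : EuclideanSpace ℝ (Fin n) ↦ a i)
    (h (EuclideanSpace.single i 1))).trans ((sum_conj e (e.symm.toLinearMap ∘ₗ g ∘ₗ e.toLinearMap)
      g fun v ↦ by simp).trans ?_)
  have hF : fderiv ℝ (fun q ↦ ricForm u D q a b) p H = ∑ i, F (EuclideanSpace.single i 1) i := by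
    simp only [ricForm_apply]
    have : ∀ i, HasFDerivAt (fun q ↦ hform u D q a (EuclideanSpace.single i 1) b i)
        ((EuclideanSpace.proj i : EuclideanSpace ℝ (Fin n) →L[ℝ] ℝ).comp
          (fderiv ℝ (fun q ↦ hform₂ u D q a b (EuclideanSpace.single i 1)) p)) p := fun i ↦
      (EuclideanSpace.proj i : EuclideanSpace ℝ (Fin n) →L[ℝ] ℝ).hasFDerivAt.comp p
        (hdf (EuclideanSpace.single i 1)).hasFDerivAt
    rw [(HasFDerivAt.fun_sum fun i _ ↦ this i).fderiv, sum_apply]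
    rfl
  -- The connection terms acting on the output and on the contracted slot are `Γ ∘ R` and `R ∘ Γ`;
  -- they have the same trace and enter with opposite signs.
  have hc := sum_comp_comm Γ (hform₂ u D p a b)
  simp only [hform₂_apply] at hc
  rw [hF]
  simp only [g, LinearMap.sub_apply, LinearMap.add_apply, LinearMap.comp_apply, PiLp.sub_apply,
    PiLp.add_apply, Finset.sum_sub_distrib, Finset.sum_add_distrib, ricForm_apply,
    hform₂_apply]
  change _ = _ - (∑ i, hform u D p (Γ a) (EuclideanSpace.single i 1) b i +
    ∑ i, hform u D p a (EuclideanSpace.single i 1) (Γ b) i)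
  linear_combination hc

end Cartan

/-! ### The concircular curvature tensor -/

/-- The tensor `G` in the chart at `c`. -/
def gtForm (c : TangentBundle (𝓡 n) M) (L : TangentBundle (𝓡 n) M → ℝ)
    (p : EuclideanSpace ℝ (Fin n) × EuclideanSpace ℝ (Fin n)) (x y z : EuclideanSpace ℝ (Fin n)) :
    EuclideanSpace ℝ (Fin n) :=
  gform c L p x z • y - gform c L p y z • x

/-- The concircular curvature tensor in the chart at `c`. -/
def concForm (c : TangentBundle (𝓡 n) M) (L : TangentBundle (𝓡 n) M → ℝ) (D : Conn n M)
    (p : EuclideanSpace ℝ (Fin n) × EuclideanSpace ℝ (Fin n)) (x y z : EuclideanSpace ℝ (Fin n)) :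
    EuclideanSpace ℝ (Fin n) :=
  hform c D p x y z - (scalForm c D p L / ((n : ℝ) * ((n : ℝ) - 1))) • gtForm c L p x y z

section Cartan

variable {L : TangentBundle (𝓡 n) M → ℝ} {D : Conn n M} (hD : IsCartan L D)
  (hL : IsFinsler L)
include hL

lemma tau_gTensor {c u : TangentBundle (𝓡 n) M} (hu : u ∈ dom c) (hs : u ∈ slit n M)
    (x : Fin 3 → PB n M u) : tau c u (gTensor L u x) =
      gtForm c L (crd c u) (tau c u (x 0)) (tau c u (x 1)) (tau c u (x 2)) := by
  rw [gTensor, map_sub, map_smul, map_smul, metric_crd hL hu hs, metric_crd hL hu hs, gtForm]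

lemma differentiableAt_gform {c : TangentBundle (𝓡 n) M} {p} (hp : p ∈ cdom c)
    (v w : EuclideanSpace ℝ (Fin n)) : DifferentiableAt ℝ (fun q ↦ gform c L q v w) p :=
  ((((contDiffOn_gform hL c).contDiffAt ((isOpen_cdom c).mem_nhds hp)).differentiableAt
    (by simp)).clm_apply (differentiableAt_const _)).clm_apply (differentiableAt_const _)

lemma differentiableAt_gtForm {c : TangentBundle (𝓡 n) M} {p} (hp : p ∈ cdom c)
    (x y z : EuclideanSpace ℝ (Fin n)) : DifferentiableAt ℝ (fun q ↦ gtForm c L q x y z) p :=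
  ((differentiableAt_gform hL hp x z).smul_const y).sub
    ((differentiableAt_gform hL hp y z).smul_const x)

include hD

/-- The tensor `G` is parallel, in coordinates. -/
lemma fderiv_gtForm {c : TangentBundle (𝓡 n) M} {p} (hp : p ∈ cdom c)
    (X : EuclideanSpace ℝ (Fin n) × EuclideanSpace ℝ (Fin n)) (x y z : EuclideanSpace ℝ (Fin n)) :
    fderiv ℝ (fun q ↦ gtForm c L q x y z) p X + cform c D p (gtForm c L p x y z) X =
      gtForm c L p (cform c D p x X) y z + gtForm c L p x (cform c D p y X) z +
        gtForm c L p x y (cform c D p z X) := by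
  have h : HasFDerivAt (fun q ↦ gtForm c L q x y z) _ p :=
    ((differentiableAt_gform hL hp x z).hasFDerivAt.smul_const y).sub
      ((differentiableAt_gform hL hp y z).hasFDerivAt.smul_const x)
  rw [h.fderiv, sub_apply, ContinuousLinearMap.smulRight_apply, ContinuousLinearMap.smulRight_apply,
    gform_metric hD hL hp, gform_metric hD hL hp]
  simp only [gtForm, map_sub, map_smul, sub_apply, smul_apply]
  module

lemma tau_concircular {c u : TangentBundle (𝓡 n) M} (hu : u ∈ dom c) (hs : u ∈ slit n M)
    (x : Fin 3 → PB n M u) : tau c u (concircular L D u x) =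
      concForm c L D (crd c u) (tau c u (x 0)) (tau c u (x 1)) (tau c u (x 2)) := by
  rw [concircular, map_sub, map_smul, tau_hCurv hD hL hu hs, tau_gTensor hL hu hs,
    scalarCurv_crd hD hL hu hs, concForm]

omit hL in
lemma differentiableAt_hform {c : TangentBundle (𝓡 n) M} {p} (hp : p ∈ cdom c)
    (x y z : EuclideanSpace ℝ (Fin n)) : DifferentiableAt ℝ (fun q ↦ hform c D q x y z) p :=
  (contDiffAt_hform hD hp contDiffAt_const contDiffAt_const contDiffAt_const).differentiableAt
    (by simp)

lemma differentiableAt_scalForm {c : TangentBundle (𝓡 n) M} {p} (hp : p ∈ cdom c) :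
    DifferentiableAt ℝ (fun q ↦ scalForm c D q L) p :=
  (contDiffAt_scalForm hD hL hp).differentiableAt (by simp)

lemma differentiableAt_concForm {c : TangentBundle (𝓡 n) M} {p} (hp : p ∈ cdom c)
    (x y z : EuclideanSpace ℝ (Fin n)) : DifferentiableAt ℝ (fun q ↦ concForm c L D q x y z) p := by
  have h : DifferentiableAt ℝ (fun q ↦ scalForm c D q L / ((n : ℝ) * ((n : ℝ) - 1))) p := by
    simp only [div_eq_mul_inv]
    exact (differentiableAt_scalForm hD hL hp).mul_const _
  exact (differentiableAt_hform hD hp x y z).fun_sub (h.fun_smul (differentiableAt_gtForm hL hp x y z))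

lemma tau_nablaV_concircular {u : TangentBundle (𝓡 n) M} (hs : u ∈ slit n M) (w x y z : PB n M u) :
    tau u u (nablaV D (concircular L D) u ![w, x, y, z]) =
      fderiv ℝ (fun q ↦ concForm u L D q (tau u u x) (tau u u y) (tau u u z)) (crd u u)
          (hor u D (crd u u) (tau u u w)) +
        cform u D (crd u u) (concForm u L D (crd u u) (tau u u x) (tau u u y) (tau u u z))
          (hor u D (crd u u) (tau u u w)) -
        (concForm u L D (crd u u) (cform u D (crd u u) (tau u u x) (hor u D (crd u u) (tau u u w)))
            (tau u u y) (tau u u z) +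
          concForm u L D (crd u u) (tau u u x) (cform u D (crd u u) (tau u u y)
            (hor u D (crd u u) (tau u u w))) (tau u u z) +
          concForm u L D (crd u u) (tau u u x) (tau u u y) (cform u D (crd u u) (tau u u z)
            (hor u D (crd u u) (tau u u w)))) := by
  have h := tau_nablaV hD hL (F := fun q a ↦ concForm u L D q (a 0) (a 1) (a 2)) hs
    (fun u' hu' hs' x ↦ tau_concircular hD hL hu' hs' x) ![w, x, y, z]
    (differentiableAt_concForm hD hL (crd_mem_cdom (mem_dom_self u) hs) _ _ _)
  rw [Fin.sum_univ_three] at h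
  exact h

/-- `G` is parallel by `fderiv_gtForm`, so in the product with `r` the Leibniz rule differentiates
only `r`. -/
lemma nablaV_concircular {u : TangentBundle (𝓡 n) M} (hs : u ∈ slit n M) (w x y z : PB n M u) :
    nablaV D (concircular L D) u ![w, x, y, z] = nablaV D (hCurv D) u ![w, x, y, z] -
      (nablaScalar L D u ![w] / ((n : ℝ) * ((n : ℝ) - 1))) • gTensor L u ![x, y, z] := by
  have hu := mem_dom_self u
  have hp := crd_mem_cdom hu hs
  refine tau_injective hu ?_
  rw [map_sub, map_smul, tau_nablaV_concircular hD hL hs, tau_nablaV_hCurv hD hL hs,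
    tau_gTensor hL hu hs, nablaScalar_crd hD hL hu hs]
  change _ = _ - _ • gtForm u L (crd u u) (tau u u x) (tau u u y) (tau u u z)
  have hw : tau u u (![w] 0) = tau u u w := rfl
  rw [hw]
  set X := hor u D (crd u u) (tau u u w)
  set a := tau u u x
  set b := tau u u y
  set d := tau u u z
  have h : HasFDerivAt (fun q ↦ concForm u L D q a b d) _ (crd u u) :=
    (differentiableAt_hform hD hp a b d).hasFDerivAt.sub
      (((differentiableAt_scalForm hD hL hp).hasFDerivAt.mul_const
        ((n : ℝ) * ((n : ℝ) - 1))⁻¹).smul (differentiableAt_gtForm hL hp a b d).hasFDerivAt)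
  have hG := fderiv_gtForm hD hL hp X a b d
  rw [h.fderiv]
  simp only [concForm, map_sub, map_smul, sub_apply, smul_apply, add_apply,
    ContinuousLinearMap.smulRight_apply, div_eq_mul_inv, smul_eq_mul]
  linear_combination (norm := module)
    (-(scalForm u D (crd u u) L * ((n : ℝ) * ((n : ℝ) - 1))⁻¹)) • hG

/-- `∇ʰR` of a concircularly recurrent Finsler manifold. -/
lemma nablaV_hCurv_of_concircular {A : STensor n M 1} (hA : IsConcircularlyRecurrent L D A)
    {u : TangentBundle (𝓡 n) M} (hs : u ∈ slit n M) (w x y z : PB n M u) :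
    nablaV D (hCurv D) u ![w, x, y, z] = A u ![w] • hCurv D u ![x, y, z] +
      ((nablaScalar L D u ![w] - scalarCurv L D u * A u ![w]) / ((n : ℝ) * ((n : ℝ) - 1))) •
        gTensor L u ![x, y, z] := by
  have h := nablaV_concircular hD hL hs w x y z
  -- Expanding `A ⊗ C` gives `A ⊗ R` and a multiple of `G`, which joins the `G`-term coming from
  -- `∇ʰr`.
  rw [hA.2.2 u hs, concircular, eq_sub_iff_add_eq] at h
  rw [← h]
  module

/-! ### The recurrence forms -/

/-- The divisor `s` will be `n(n-1)` for the curvature and `n` for `Ric`. Since `r` is dilation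
invariant, its differential takes equal values on horizontal lifts that correspond under a dilation,
and `horLift_dil` says that they do. -/
lemma isRecurrenceForm_scalar {A : STensor n M 1} (hA : IsRecurrenceForm A) {s : ℝ} (hs : s ≠ 0)
    (h0 : STensor.NonZero (n := n) (M := M) (k := 1) fun u x ↦
      nablaScalar L D u x - scalarCurv L D u * A u x) :
    IsRecurrenceForm (n := n) (M := M) (k := 1) fun u x ↦
      (nablaScalar L D u x - scalarCurv L D u * A u x) / s := by
  refine isRecurrenceForm_of_components (F := fun c p a ↦
    (fderiv ℝ (fun p ↦ scalForm c D p L) p (hor c D p (a 0)) -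
      scalForm c D p L * oneForm c A p (a 0)) / s) ?_ ?_ ?_ ?_ ?_ ?_
  · intro c u hu hs x
    rw [nablaScalar_crd hD hL hu hs, scalarCurv_crd hD hL hu hs, oneForm_crd hA hu hs]
  · intro c p hp x i v w
    rw [Subsingleton.elim i 0]
    simp only [Function.update_self, map_add]
    ring
  · intro c p hp x i t v
    rw [Subsingleton.elim i 0]
    simp only [Function.update_self, map_smul, smul_eq_mul]
    ring
  · intro c p hp x hx
    have hn := (isOpen_cdom c).mem_nhds hp
    have h1 := contDiffAt_scalForm hD hL hp
    exact ((((h1.fderiv_right (m := ∞) (by simp)).clm_apply (((contDiffOn_hor hD c).contDiffAt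
      hn).clm_apply (hx 0))).sub (h1.mul (((contDiffOn_oneForm hA c).contDiffAt hn).clm_apply
        (hx 0)))).div_const s)
  · intro c p hp t ht x
    have h1 := fderiv_dil (isOpen_cdom c) (c := 1) (t := t) (f := fun p ↦ scalForm c D p L)
      (fun q hq ↦ by rw [scalForm_dil hD hL ht hq, one_smul]) hp
      (differentiableAt_scalForm hD hL hp)
      (differentiableAt_scalForm hD hL (dil_mem_cdom ht.ne' hp)) (hor c D p (x 0))
    rw [one_smul, hor, ← horLift_dil hD hL ht hp] at h1
    rw [hor, h1, scalForm_dil hD hL ht hp, oneForm_dil hA ht hp, hor]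
  · obtain ⟨u, hu, x, hx⟩ := h0
    exact ⟨u, hu, x, div_ne_zero hx hs⟩

/-- `A`, its derivative along horizontal lifts and `Γ` evaluated on such lifts are all smooth and
dilation invariant, the last by `cform_dil`. -/
lemma isRecurrenceForm_two {A : STensor n M 1} (hA : IsRecurrenceForm A)
    (h0 : STensor.NonZero (n := n) (M := M) (k := 2) fun u x ↦
      nablaS D A u x + A u ![x 0] * A u ![x 1]) :
    IsRecurrenceForm (n := n) (M := M) (k := 2) fun u x ↦
      nablaS D A u x + A u ![x 0] * A u ![x 1] := by
  refine isRecurrenceForm_of_components (F := fun c p a ↦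
    fderiv ℝ (oneForm c A) p (hor c D p (a 0)) (a 1) -
      oneForm c A p (cform c D p (a 1) (hor c D p (a 0))) +
      oneForm c A p (a 0) * oneForm c A p (a 1)) ?_ ?_ ?_ ?_ ?_ h0
  · intro c u hu hs x
    rw [nablaS_one hD hL hA hu hs, oneForm_crd hA hu hs, oneForm_crd hA hu hs]
    rfl
  · intro c p hp x i v w
    fin_cases i
    · simp [Function.update]
      ring
    · simp [Function.update]
      ring
  · intro c p hp x i t v
    fin_cases i
    · simp [Function.update]
      ring
    · simp [Function.update]
      ring
  · intro c p hp x hx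
    have hn := (isOpen_cdom c).mem_nhds hp
    have h1 := (contDiffOn_oneForm hA c).contDiffAt hn
    have h2 := ((contDiffOn_hor hD c).contDiffAt hn).clm_apply (hx 0)
    have h3 := (contDiffOn_cform hD.smooth c).contDiffAt hn
    exact ((((h1.fderiv_right (m := ∞) (by simp)).clm_apply h2).clm_apply (hx 1)).sub
      (h1.clm_apply ((h3.clm_apply (hx 1)).clm_apply h2))).add
        ((h1.clm_apply (hx 0)).mul (h1.clm_apply (hx 1)))
  · intro c p hp t ht x
    have hd : ∀ q ∈ cdom c, DifferentiableAt ℝ (oneForm c A) q := fun q hq ↦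
      ((contDiffOn_oneForm hA c).contDiffAt ((isOpen_cdom c).mem_nhds hq)).differentiableAt
        (by simp)
    have h1 := fderiv_dil (isOpen_cdom c) (c := 1) (t := t) (f := oneForm c A)
      (fun q hq ↦ by rw [oneForm_dil hA ht hq, one_smul]) hp (hd p hp)
      (hd _ (dil_mem_cdom ht.ne' hp)) (hor c D p (x 0))
    rw [one_smul] at h1
    rw [hor, horLift_dil hD hL ht hp, ← hor, h1, cform_dil hD hL ht hp, oneForm_dil hA ht hp]

/-! ### The main results -/

/-- The recurrence equation holds on the whole slit bundle, hence near `u`, so the components of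
`∇ʰC` to be differentiated are those of `A ⊗ C`. -/
lemma tau_nablaV_nablaV_concircular {A : STensor n M 1} (hA : IsConcircularlyRecurrent L D A)
    {u : TangentBundle (𝓡 n) M} (hs : u ∈ slit n M) (v w x y z : PB n M u) :
    tau u u (nablaV D (nablaV D (concircular L D)) u ![v, w, x, y, z]) =
      fderiv ℝ (fun q ↦ oneForm u A q (tau u u w) •
          concForm u L D q (tau u u x) (tau u u y) (tau u u z)) (crd u u)
          (hor u D (crd u u) (tau u u v)) +
        cform u D (crd u u) (oneForm u A (crd u u) (tau u u w) •
          concForm u L D (crd u u) (tau u u x) (tau u u y) (tau u u z))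
          (hor u D (crd u u) (tau u u v)) -
        (oneForm u A (crd u u) (cform u D (crd u u) (tau u u w) (hor u D (crd u u) (tau u u v))) •
            concForm u L D (crd u u) (tau u u x) (tau u u y) (tau u u z) +
          oneForm u A (crd u u) (tau u u w) • concForm u L D (crd u u)
            (cform u D (crd u u) (tau u u x) (hor u D (crd u u) (tau u u v)))
            (tau u u y) (tau u u z) +
          oneForm u A (crd u u) (tau u u w) • concForm u L D (crd u u) (tau u u x)
            (cform u D (crd u u) (tau u u y) (hor u D (crd u u) (tau u u v))) (tau u u z) +
          oneForm u A (crd u u) (tau u u w) • concForm u L D (crd u u) (tau u u x) (tau u u y)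
            (cform u D (crd u u) (tau u u z) (hor u D (crd u u) (tau u u v)))) := by
  have hp := crd_mem_cdom (mem_dom_self u) hs
  have hN : ∀ u' ∈ slit n M, ∀ Y : Fin 4 → PB n M u', nablaV D (concircular L D) u' Y =
      A u' ![Y 0] • concircular L D u' ![Y 1, Y 2, Y 3] := fun u' hs' Y ↦ by
    rw [← hA.2.2 u' hs']
    congr 1
    funext i
    fin_cases i <;> rfl
  have ha : DifferentiableAt ℝ (oneForm u A) (crd u u) :=
    ((contDiffOn_oneForm hA.2.1 u).contDiffAt ((isOpen_cdom u).mem_nhds hp)).differentiableAt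
      (by simp)
  have h := tau_nablaV hD hL (T := nablaV D (concircular L D))
    (F := fun q a ↦ oneForm u A q (a 0) • concForm u L D q (a 1) (a 2) (a 3)) hs
    (fun u' hu' hs' Y ↦ by
      rw [hN u' hs', map_smul, tau_concircular hD hL hu' hs', oneForm_crd hA.2.1 hu' hs']
      rfl) ![v, w, x, y, z] ((ha.clm_apply (differentiableAt_const (tau u u w))).smul
        (differentiableAt_concForm hD hL hp (tau u u x) (tau u u y) (tau u u z)))
  rw [Fin.sum_univ_four] at h
  exact h

/-- By Leibniz the derivative of `A ⊗ C` is `∇ʰA ⊗ C` plus `A(w)` times the derivative of `C` in the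
new direction `v`, to which the recurrence equation applies again. -/
lemma nablaV_nablaV_concircular {A : STensor n M 1} (hA : IsConcircularlyRecurrent L D A)
    {u : TangentBundle (𝓡 n) M} (hs : u ∈ slit n M) (v w x y z : PB n M u) :
    nablaV D (nablaV D (concircular L D)) u ![v, w, x, y, z] =
      (nablaS D A u ![v, w] + A u ![v] * A u ![w]) • concircular L D u ![x, y, z] := by
  have hu := mem_dom_self u
  have hp := crd_mem_cdom hu hs
  have ha : DifferentiableAt ℝ (oneForm u A) (crd u u) :=
    ((contDiffOn_oneForm hA.2.1 u).contDiffAt ((isOpen_cdom u).mem_nhds hp)).differentiableAt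
      (by simp)
  have hC := differentiableAt_concForm hD hL hp (tau u u x) (tau u u y) (tau u u z)
  have h1 := tau_nablaV_concircular hD hL hs v x y z
  have hx : tau u u (concircular L D u ![x, y, z]) =
    concForm u L D (crd u u) (tau u u x) (tau u u y) (tau u u z) := tau_concircular hD hL hu hs _
  have hAv : ∀ v : PB n M u, A u ![v] = oneForm u A (crd u u) (tau u u v) := fun v ↦
    oneForm_crd hA.2.1 hu hs _
  have h2 : nablaS D A u ![v, w] = fderiv ℝ (oneForm u A) (crd u u)
      (hor u D (crd u u) (tau u u v)) (tau u u w) - oneForm u A (crd u u)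
        (cform u D (crd u u) (tau u u w) (hor u D (crd u u) (tau u u v))) :=
    nablaS_one hD hL hA.2.1 hu hs ![v, w]
  rw [hA.2.2 u hs, map_smul, hx, hAv] at h1
  have hf : HasFDerivAt (fun q ↦ oneForm u A q (tau u u w) •
      concForm u L D q (tau u u x) (tau u u y) (tau u u z)) _ (crd u u) :=
    (ha.hasFDerivAt.clm_apply (hasFDerivAt_const (tau u u w) (crd u u))).fun_smul hC.hasFDerivAt
  have h := tau_nablaV_nablaV_concircular hD hL hA hs v w x y z
  rw [hf.fderiv] at h
  refine tau_injective hu ((h.trans ?_).trans (map_smul (tau u u) _ _).symm)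
  clear h hf
  rw [hx, h2, hAv, hAv, map_smul]
  simp only [add_apply, smul_apply, ContinuousLinearMap.smulRight_apply,
    ContinuousLinearMap.comp_apply, ContinuousLinearMap.flip_apply, zero_apply, map_zero, zero_add]
  linear_combination (norm := module) (-(oneForm u A (crd u u) (tau u u w))) • h1

lemma isTwoConcircularlyRecurrent {A : STensor n M 1} (hA : IsConcircularlyRecurrent L D A)
    (h0 : STensor.NonZero (n := n) (M := M) (k := 2) fun u x ↦
      nablaS D A u x + A u ![x 0] * A u ![x 1]) : IsTwoConcircularlyRecurrent L D :=
  ⟨hA.1, _, isRecurrenceForm_two hD hL hA.2.1 h0, fun _ hs v w x y z ↦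
    nablaV_nablaV_concircular hD hL hA hs v w x y z⟩

end Cartan

/-! ### Contractions -/

section Contraction

lemma coord_add (u : TangentBundle (𝓡 n) M) (v w : PB n M u) (i : Fin n) :
    coord u (v + w) i = coord u v i + coord u w i := rfl

lemma coord_sub (u : TangentBundle (𝓡 n) M) (v w : PB n M u) (i : Fin n) :
    coord u (v - w) i = coord u v i - coord u w i := rfl

lemma coord_smul (u : TangentBundle (𝓡 n) M) (t : ℝ) (v : PB n M u) (i : Fin n) :
    coord u (t • v) i = t * coord u v i := rfl

lemma coord_basisVec (u : TangentBundle (𝓡 n) M) (i : Fin n) : coord u (basisVec u i) i = 1 := by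
  simp [coord, basisVec]

lemma ricci_eq_zero {D : Conn n M} {u : TangentBundle (𝓡 n) M} (h : ∀ x, hCurv D u x = 0)
    (x : Fin 2 → PB n M u) : ricci D u x = 0 := by
  refine Finset.sum_eq_zero fun i _ ↦ ?_
  rw [h]
  rfl

lemma scalarCurv_eq_zero (L : TangentBundle (𝓡 n) M → ℝ) {D : Conn n M} {u : TangentBundle (𝓡 n) M}
    (h : ∀ x, ricci D u x = 0) : scalarCurv L D u = 0 := by
  simp [scalarCurv, h]

/-- `R = 0` would force `Ric = 0` and `r = 0`, hence `C = 0`. -/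
lemma IsConcircularlyRecurrent.hCurv_nonZero {L : TangentBundle (𝓡 n) M → ℝ} {D : Conn n M}
    {A : STensor n M 1} (hA : IsConcircularlyRecurrent L D A) : (hCurv D).NonZero := by
  by_contra h
  have hR : ∀ u ∈ slit n M, ∀ x, hCurv D u x = 0 := fun u hu x ↦ by
    by_contra h1
    exact h ⟨u, hu, x, h1⟩
  obtain ⟨u, hu, x, hx⟩ := hA.1
  refine hx ?_
  rw [concircular, hR u hu, scalarCurv_eq_zero L (ricci_eq_zero (hR u hu)), zero_div, zero_smul,
    sub_zero]

/-- The trace of `Z ↦ g(x, y)Z - g(Z, y)x` is `n g(x, y) - g(x, y)`. -/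
lemma sum_coord_gTensor {L : TangentBundle (𝓡 n) M → ℝ} (hL : IsFinsler L)
    {u : TangentBundle (𝓡 n) M} (hs : u ∈ slit n M) (x y : PB n M u) :
    ∑ i, coord u (gTensor L u ![x, basisVec u i, y]) i =
      ((n : ℝ) - 1) * metricTensor L u ![x, y] := by
  have hu := mem_dom_self u
  have h1 : ∀ i, coord u (gTensor L u ![x, basisVec u i, y]) i =
      metric L u x y - metric L u (basisVec u i) y * coord u x i := fun i ↦ by
    change coord u (metric L u x y • basisVec u i - metric L u (basisVec u i) y • x) i = _
    rw [coord_sub, coord_smul, coord_smul, coord_basisVec, mul_one]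
  let f : EuclideanSpace ℝ (Fin n) →ₗ[ℝ] ℝ :=
    ((gform u L (crd u u)).flip (tau u u y)).toLinearMap ∘ₗ (tauEquiv hu).toLinearMap
  have hf : ∀ v : EuclideanSpace ℝ (Fin n), metric L u v y = f v := fun v ↦ metric_crd hL hu hs _ _
  obtain ⟨x', hx'⟩ : ∃ x' : EuclideanSpace ℝ (Fin n), x' = x := ⟨x, rfl⟩
  have h2 : ∑ i, metric L u (basisVec u i) y * coord u x i = metric L u x y := by
    have h3 : ∑ i, f (EuclideanSpace.single i 1) * x' i = f x' := by
      conv_rhs => rw [← sum_single x']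
      simp only [map_sum, map_smul, smul_eq_mul, mul_comm]
    subst hx'
    rw [hf x', ← h3]
    exact Finset.sum_congr rfl fun i _ ↦ congrArg (· * x' i) (hf (EuclideanSpace.single i 1))
  simp only [h1, Finset.sum_sub_distrib, h2, Finset.sum_const, Finset.card_univ, Fintype.card_fin,
    nsmul_eq_mul]
  change _ = ((n : ℝ) - 1) * metric L u x y
  ring

end Contraction

/-! ### Generalized recurrence -/

section Cartan

variable {L : TangentBundle (𝓡 n) M → ℝ} {D : Conn n M} (hD : IsCartan L D)
  (hL : IsFinsler L) {A : STensor n M 1} (hA : IsConcircularlyRecurrent L D A)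
include hD hL hA

lemma isGeneralizedRecurrent (hn : 2 ≤ n)
    (h0 : STensor.NonZero (n := n) (M := M) (k := 1) fun u x ↦
      nablaScalar L D u x - scalarCurv L D u * A u x) : IsGeneralizedRecurrent L D := by
  have hn' : (2 : ℝ) ≤ n := by exact_mod_cast hn
  have hN : (n : ℝ) * ((n : ℝ) - 1) ≠ 0 := by
    have : (0 : ℝ) < n * (n - 1) := by nlinarith
    exact this.ne'
  exact ⟨hA.hCurv_nonZero, A, _, hA.2.1, isRecurrenceForm_scalar hD hL hA.2.1 hN h0,
    fun u hs w x y z ↦ nablaV_hCurv_of_concircular hD hL hA hs w x y z⟩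

omit hA in
lemma nablaScalar_eq_zero (h : ∀ u ∈ slit n M, scalarCurv L D u = 0) {u : TangentBundle (𝓡 n) M}
    (hs : u ∈ slit n M) (x : Fin 1 → PB n M u) : nablaScalar L D u x = 0 := by
  have hu := mem_dom_self u
  have hev : (fun p ↦ scalForm u D p L) =ᶠ[nhds (crd u u)] fun _ ↦ 0 := by
    filter_upwards [(isOpen_cdom u).mem_nhds (crd_mem_cdom hu hs)] with q hq
    rw [← h _ (crdInv_mem_slit hq), scalarCurv_crd hD hL (crdInv_mem_dom hq) (crdInv_mem_slit hq),
      crd_crdInv hq]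
  rw [nablaScalar_crd hD hL hu hs, hev.fderiv_eq, fderiv_const_apply, zero_apply]

lemma isGeneralizedRicciRecurrent (hn : 2 ≤ n)
    (h0 : STensor.NonZero (n := n) (M := M) (k := 1) fun u x ↦
      nablaScalar L D u x - scalarCurv L D u * A u x) : IsGeneralizedRicciRecurrent L D := by
  have hn' : (2 : ℝ) ≤ n := by exact_mod_cast hn
  have hn0 : (n : ℝ) ≠ 0 := by positivity
  have hn1 : (n : ℝ) - 1 ≠ 0 := by
    have : (0 : ℝ) < n - 1 := by linarith
    exact this.ne'
  refine ⟨?_, A, _, hA.2.1, isRecurrenceForm_scalar hD hL hA.2.1 hn0 h0, fun u hs w x y ↦ ?_⟩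
  -- If `Ric` vanished, so would `r` on the open slit bundle, and with it `∇ʰr - rA`, against `h0`.
  · by_contra h
    have hr : ∀ u ∈ slit n M, scalarCurv L D u = 0 := fun u hu ↦ scalarCurv_eq_zero L fun x ↦ by
      by_contra h1
      exact h ⟨u, hu, x, h1⟩
    obtain ⟨u, hu, x, hx⟩ := h0
    refine hx ?_
    change nablaScalar L D u x - scalarCurv L D u * A u x = 0
    rw [nablaScalar_eq_zero hD hL hr hu, hr u hu, zero_mul, sub_zero]
  -- The equation for `∇ʰR` is contracted; the factor `n - 1` from `G` turns the denominator
  -- `n(n-1)` into `n`.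
  · rw [← sum_coord_nablaV_hCurv hD hL hs]
    simp only [nablaV_hCurv_of_concircular hD hL hA hs, coord_add, coord_smul,
      Finset.sum_add_distrib, ← Finset.mul_sum, sum_coord_gTensor hL hs]
    have h1 : ∑ i, coord u (hCurv D u ![x, basisVec u i, y]) i = ricci D u ![x, y] := rfl
    rw [h1]
    field_simp

/-! ### The case of vanishing contracted curvature -/

omit hA in
/-- If `R(X, Y)η` vanishes, so does its `h`-covariant derivative. -/
lemma nablaV_hCurv_eta (hR : ∀ u ∈ slit n M, ∀ x, hatR D u x = 0) {u : TangentBundle (𝓡 n) M}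
    (hs : u ∈ slit n M) (w x y : PB n M u) :
    nablaV D (hCurv D) u ![w, x, y, eta n M u] = 0 := by
  have hu := mem_dom_self u
  have hp := crd_mem_cdom hu hs
  have h0 : ∀ q ∈ cdom u, ∀ a b, hform u D q a b q.2 = 0 := fun q hq a b ↦ by
    have hq' := crdInv_mem_dom hq
    have h := congrArg (tau u (crdInv u q))
      (hR _ (crdInv_mem_slit hq) ![tauInv u _ a, tauInv u _ b])
    rw [hatR, tau_hCurv hD hL hq' (crdInv_mem_slit hq), map_zero, crd_crdInv hq] at h
    have e1 := tau_tauInv hq' a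
    have e2 := tau_tauInv hq' b
    have e3 := crd_snd hq'
    rw [crd_crdInv hq] at e3
    refine Eq.trans ?_ h
    exact congr (congrArg₂ (hform u D q) e1.symm e2.symm) e3
  refine tau_injective hu ?_
  rw [tau_nablaV_hCurv hD hL hs, map_zero, ← crd_snd hu]
  set p := crd u u
  set a := tau u u x
  set b := tau u u y
  -- The lift moves the fibre coordinate `y` by `-Γ(y)(X)`: this is `∇_{βw} η = 0` in the chart.
  have hX : (hor u D p (tau u u w)).2 = - cform u D p p.2 (hor u D p (tau u u w)) := by
    have h1 : hor u D p (tau u u w) = (tau u u w, 0) + (0, - cform u D p p.2 (tau u u w, 0)) := by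
      rw [hor, horLift_apply]
      simp
    conv_rhs => rw [h1, map_add, cform_radial hD hL hp, add_zero]
    rfl
  set X := hor u D p (tau u u w)
  have hd : DifferentiableAt ℝ (fun q ↦ hform₃ u D q a b) p :=
    (contDiffAt_hform₃ hD hp a b).differentiableAt (by simp)
  -- The identity `R(a, b)y = 0` is differentiated with `y` moving. By `hX` the extra term is the
  -- correction `-R(a, b)(Γ(y)X)` that `∇ʰR` carries in its last slot; the remaining connection
  -- terms vanish by `h0`.
  have h1 : HasFDerivAt (fun q ↦ hform₃ u D q a b q.2) _ p :=
    hd.hasFDerivAt.clm_apply hasFDerivAt_snd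
  have h2 := h1.congr_of_eventuallyEq (f₁ := fun _ ↦ 0) (by
    filter_upwards [(isOpen_cdom u).mem_nhds hp] with q hq using (h0 q hq a b).symm)
  have h3 := congrArg (fun T : EuclideanSpace ℝ (Fin n) × EuclideanSpace ℝ (Fin n) →L[ℝ]
    EuclideanSpace ℝ (Fin n) ↦ T X) (h2.unique (hasFDerivAt_const 0 p))
  have h4 : HasFDerivAt (fun q ↦ hform u D q a b p.2) _ p :=
    hd.hasFDerivAt.clm_apply (hasFDerivAt_const p.2 p)
  rw [h4.fderiv, h0 p hp, h0 p hp, h0 p hp]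
  have h5 : hform₃ u D p a b X.2 = - hform u D p a b (cform u D p p.2 X) := by
    rw [hX, map_neg]
    rfl
  simp only [add_apply, ContinuousLinearMap.comp_apply, ContinuousLinearMap.flip_apply,
    ContinuousLinearMap.coe_snd', zero_apply, map_zero, zero_add, h5] at h3 ⊢
  refine Eq.trans ?_ h3
  abel

/-- The recurrence form is `A` itself. On `η` the equation `∇ʰR = A ⊗ R + B ⊗ G` reduces to `B(W)
G(X, Y)η = 0`, and `G(η, Y)η` is nonzero for any `Y` independent of `η`. -/
lemma isRecurrent_of_hatR (hn : 2 ≤ n) (hR : ∀ u ∈ slit n M, ∀ x, hatR D u x = 0) :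
    IsRecurrent D := by
  have hn' : (2 : ℝ) ≤ n := by exact_mod_cast hn
  refine ⟨hA.hCurv_nonZero, A, hA.2.1, fun u hs w x y z ↦ ?_⟩
  have h := fun x y z ↦ nablaV_hCurv_of_concircular hD hL hA hs w x y z
  set B := (nablaScalar L D u ![w] - scalarCurv L D u * A u ![w]) / ((n : ℝ) * ((n : ℝ) - 1))
  suffices hB : B = 0 by rw [h, hB, zero_smul, add_zero]
  by_contra hB
  have hu := mem_dom_self u
  have hp := crd_mem_cdom hu hs
  have h1 : ∀ b, gtForm u L (crd u u) (crd u u).2 b (crd u u).2 = 0 := fun b ↦ by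
    have h2 := h (eta n M u) (tauInv u u b) (eta n M u)
    have h3 : hCurv D u ![eta n M u, tauInv u u b, eta n M u] = 0 :=
      hR u hs ![eta n M u, tauInv u u b]
    rw [nablaV_hCurv_eta hD hL hR hs, h3, smul_zero, zero_add] at h2
    have h4 := congrArg (tau u u) ((smul_eq_zero.1 h2.symm).resolve_left hB)
    rw [tau_gTensor hL hu hs, map_zero] at h4
    have e1 := tau_tauInv hu b
    have e3 := crd_snd hu
    refine Eq.trans ?_ h4
    exact congr (congrArg₂ (gtForm u L (crd u u)) e3 e1.symm) e3
  have hpos := gform_pos hL u hp _ hp.2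
  set p := crd u u
  -- Since `g(y, y) > 0`, the relation `g(y, y)b = g(b, y)y` can be solved for `b`, so `y` spans the
  -- fibre.
  have hfr : Module.finrank ℝ (EuclideanSpace ℝ (Fin n)) ≤ 1 := by
    refine finrank_le_one p.2 fun b ↦ ⟨gform u L p b p.2 / gform u L p p.2 p.2, ?_⟩
    have h2 := sub_eq_zero.1 (h1 b)
    rw [div_eq_inv_mul, mul_smul, ← h2, smul_smul, inv_mul_cancel₀ hpos.ne', one_smul]
  rw [finrank_euclideanSpace_fin] at hfr
  omega

end Cartan

end Finsler

end

theorem mainTheorem4 {n : ℕ} (hn : 3 ≤ n) {M : Type*} [TopologicalSpace M] [T2Space M]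
    [SecondCountableTopology M] [ChartedSpace (EuclideanSpace ℝ (Fin n)) M]
    [IsManifold (𝓡 n) ∞ M]
    (L : TangentBundle (𝓡 n) M → ℝ) (hL : Finsler.IsFinsler L)
    (D : Finsler.Conn n M) (hD : Finsler.IsCartan L D)
    (A : Finsler.STensor n M 1) (hA : Finsler.IsConcircularlyRecurrent L D A) :
    ((Finsler.STensor.NonZero (n := n) (M := M) (k := 2) fun u x ↦
        Finsler.nablaS D A u x + A u ![x 0] * A u ![x 1]) →
      Finsler.IsTwoConcircularlyRecurrent L D) ∧
    ((Finsler.STensor.NonZero (n := n) (M := M) (k := 1) fun u x ↦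
        Finsler.nablaScalar L D u x - Finsler.scalarCurv L D u * A u x) →
      Finsler.IsGeneralizedRecurrent L D ∧ Finsler.IsGeneralizedRicciRecurrent L D) ∧
    ((∀ u ∈ Finsler.slit n M, ∀ x, Finsler.hatR D u x = 0) →
      Finsler.IsRecurrent D) := by
  exact ⟨Finsler.isTwoConcircularlyRecurrent hD hL hA, fun h ↦
    ⟨Finsler.isGeneralizedRecurrent hD hL hA (by omega) h,
      Finsler.isGeneralizedRicciRecurrent hD hL hA (by omega) h⟩,
    Finsler.isRecurrent_of_hatR hD hL hA (by omega)⟩
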